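/- **Model.** For each sample size $n$ let $\mathbf Y=\tilde{\mathbf Y}+\mathbf E$, $\tilde{\mathbf Y}=\sum_{j=1}^{p_n}\mathbf X_j\mathbf B_j^*$, with random $\mathbf X_j\in\mathbb R^{n\times q_{n,j}}$, $\mathbf E\in\mathbb R^{n\times d_n}$ and deterministic $\mathbf B_j^*\in\mathbb R^{q_{n,j}\times d_n}$ ($p_n,d_n,q_{n,j}\ge 1$). Put $\hat{\mathbf\Sigma}_j=n^{-1}\mathbf X_j^\top\mathbf X_j$, $\xi_E=\max_j\|\mathbf X_j^\top\mathbf E\|_{op}$, $J_n=\{j:\mathbf B_j^*\ne 0\}$, $r_j^*=\mathrm{rank}(\mathbf B_j^*)$, $\bar r_j=\mathrm{rank}(\mathbf X_j^\top\tilde{\mathbf Y})$, $J_o=\{j\in J_n:\min(q_{n,j},d_n)>\bar r_j\}$. Write $\langle\cdot,\cdot\rangle$ for the trace inner product, $\|\cdot\|_*$ for the nuclear norm, $\sigma_l$ for the $l$-th largest singular value. $x_n=O_p(y_n)$ means that for every $\epsilon>0$ there is $M<\infty$ with $\limsup_n\mathbb P(x_n>My_n)<\epsilon$; $x_n=o_p(y_n)$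 means $\mathbb P(x_n<\epsilon y_n)\to1$ for every $\epsilon>0$. **Conditions.** (C1) For some $\mu>0$, with probability tending to one all eigenvalues of all $\hat{\mathbf\Sigma}_j$ lie in $[\mu^{-1},\mu]$. (C2) $K_n\ge1$ are integers, $K_n\to\infty$, $K_n\xi_E=O_p(nd_n^{1/2})$. (C3) With probability tending to one, $\lambda_{\min}(n^{-1}\mathbf X(J)^\top\mathbf X(J))>\mu^{-1}$ for all $J$ with $\sharp(J)\le 2K_n$, where $\mathbf X(J)=(\mathbf X_j:j\in J)$. (C4) $d_n^{-1/2}\sum_j\|\mathbf B_j^*\|_*\le L<\infty$, and there is a non-decreasing positive sequence $s_n$ with $s_n^2=o(K_n)$ and $\min_{j\in J_n}\sigma^2_{r_j^*}(d_n^{-1/2}\mathbf B_j^*)\ge s_n^{-1}$. (C5) There are $\delta_n>0$ with $\xi_E=o_p(n\delta_n)$ and, with probability tending to one, $\min_{j\in J_o}\sigma_{\bar r_j}(\mathbf X_j^\top\tilde{\mathbf Y})\ge n\delta_n$. (C6) With probability tending to one, for all $j\in J_o$: if the columns of $\tilde{\mathbf U}_j,\tilde{\mathbf V}_j$ are the leading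 $\bar r_j$ pairs of singular vectors of $\mathbf X_j^\top\tilde{\mathbf Y}$, then $\hat{\mathbf\Sigma}_j\mathbf B_j^*=\tilde{\mathbf U}_j\mathbf\Lambda_j\tilde{\mathbf V}_j^\top$ for some $\bar r_j\times\bar r_j$ matrix $\mathbf\Lambda_j$. Moreover, for some $0<M_o<\infty$, $M_o^{-1}\le(nd_n)^{-1}\|\mathbf E\|_F^2\le M_o$ with probability tending to one. **First stage.** Let $L_n=d_n^{1/2}L_0$, where $L_0>0$, $L_0\ge L/(1-\epsilon_L)$ and $0<1-\epsilon_L\le\mu^{-2}/4$. Start with $\hat{\mathbf B}_j=0$, $\hat{\mathbf G}^{(0)}=0$. At step $k$ choose any $(\hat j_k,\tilde{\mathbf B})\in\arg\max\{\langle\mathbf Y-\hat{\mathbf G}^{(k-1)},\mathbf X_j\mathbf B\rangle:1\le j\le p_n,\|\mathbf B\|_*\le L_n\}$ and any $\hat\lambda_k\in\arg\min_{0\le\lambda\le1}\|\mathbf Y-(1-\lambda)\hat{\mathbf G}^{(k-1)}-\lambda\mathbf X_{\hat j_k}\tilde{\mathbf B}\|_F$; multiply all coefficient matrices by $1-\hat\lambda_k$,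 add $\hat\lambda_k\tilde{\mathbf B}$ to the $\hat j_k$-th one, and let $\hat{\mathbf G}^{(k)}$ be the new fit. With $\hat\sigma_k^2=(nd_n)^{-1}\|\mathbf Y-\hat{\mathbf G}^{(k)}\|_F^2$ let $\hat k$ be the first $1\le k\le K_n$ with $\hat\sigma_k^2/\hat\sigma_{k-1}^2\ge1-Cs_n^{-2}$, and $\hat k=K_n$ if there is none. Put $\hat J=\{\hat j_1,\dots,\hat j_{\hat k}\}$, $\hat r=\sum_{j\in\hat J}\mathrm{rank}(\hat{\mathbf B}_j^{(\hat k)})$ and $\hat J_o=\{j\in\hat J:\hat r<\min(q_{n,j},d_n)\}$. **Second stage.** Start again from $0$. At step $k$ choose any $(\hat j_k,\hat{\mathbf S}_k)$ maximizing $\langle\mathbf Y-\hat{\mathbf G}^{(k-1)},\mathbf X_j\hat{\mathbf\Sigma}_j^{-1}\mathbf U_j\mathbf S\mathbf V_j^\top\rangle$ over $j\in\hat J$, $\|\mathbf S\|_*\le L_n$, where for $j\in\hat J_o$ the columns of $\mathbf U_j,\mathbf V_j$ are the leading $\hat r$ pairs of singular vectors of $\mathbf X_j^\top\mathbf Y$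 and $\mathbf S\in\mathbb R^{\hat r\times\hat r}$, while for $j\in\hat J\setminus\hat J_o$ they are the full sets of singular vectors and $\mathbf S\in\mathbb R^{q_{n,j}\times d_n}$. The step length and the updates are as before, with $\hat{\mathbf\Sigma}_{\hat j_k}^{-1}\mathbf U_{\hat j_k}\hat{\mathbf S}_k\mathbf V_{\hat j_k}^\top$ in place of $\tilde{\mathbf B}$. Let $\hat{\mathbf B}_j^{(m)}$ be the coefficient matrices after $m$ steps of the second stage ($0$ for $j\notin\hat J$). **Theorem.** There is $C_0>0$, depending only on $\mu,L_0,M_o$, such that the following holds whenever $0<C\le C_0$ and the above conditions hold. Let $\xi_n>0$ with $\xi_E=O_p(\xi_n)$ and $\limsup_n \xi_n/(nd_n^{1/2})<1$, let $0<\tau<1$ be arbitrary, $\rho=64\mu^5/\tau^2$, $$\kappa_n=\sharp(\hat J)\max\Big\{\max_{j\in\hat J\setminus\hat J_o}\min(q_{n,j},d_n),\ \hat r\,\mathbf 1\{\hat J_o\ne\emptyset\}\Big\},\qquad m_n=\Big\lceil\rho\kappa_n\log\frac{n^2d_n}{\xi_n^2}\Big\rceil .$$ Then $$\sup_{m\ge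 m_n}\frac1{d_n}\sum_{j=1}^{p_n}\|\mathbf B_j^*-\hat{\mathbf B}_j^{(m)}\|_F^2=O_p\Big(\frac{\kappa_n\xi_n^2}{n^2d_n}\log\frac{n^2d_n}{\xi_n^2}+\frac{\xi_n^2}{n^2\delta_n^2}\mathbf 1\{J_o\ne\emptyset\}\Big).$$ -/

import Mathlib

open MeasureTheory Filter Topology Matrix Asymptotics

noncomputable section

namespace TSRGA

/-! ### Matrix notions -/

/-- The trace inner product `⟨A, B⟩ = tr(Aᵀ B)`. -/
def inn {m n : ℕ} (A B : Matrix (Fin m) (Fin n) ℝ) : ℝ := (Aᵀ * B).trace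

/-- The squared Frobenius norm. -/
def frobSq {m n : ℕ} (A : Matrix (Fin m) (Fin n) ℝ) : ℝ := inn A A

/-- The operator norm with respect to the Euclidean norms. -/
def opNorm {m n : ℕ} (A : Matrix (Fin m) (Fin n) ℝ) : ℝ :=
  ‖LinearMap.toContinuousLinearMap (Matrix.toEuclideanLin A)‖

/-- The singular values in descending order, numbered from `0` and continued by `0`:
`sv A i` is the `(i+1)`-st largest singular value. -/
def sv {m n : ℕ} (A : Matrix (Fin m) (Fin n) ℝ) (i : ℕ) : ℝ :=
  (Matrix.toEuclideanLin A).singularValues i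

/-- The nuclear norm, the sum of all singular values. -/
def nuc {m n : ℕ} (A : Matrix (Fin m) (Fin n) ℝ) : ℝ := ∑ i ∈ Finset.range n, sv A i

/-- The columns of `U` and `V` are orthonormal and are leading left and right singular vectors
of `A`. For `a = b` these are the leading `a` pairs `A vᵢ = σᵢ uᵢ`, `Aᵀ uᵢ = σᵢ vᵢ`;
for `a = m`, `b = n` they form the full set of singular vectors. -/
structure IsLeadingSVD {m n a b : ℕ} (A : Matrix (Fin m) (Fin n) ℝ)
    (U : Matrix (Fin m) (Fin a) ℝ) (V : Matrix (Fin n) (Fin b) ℝ) : Prop where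
  left_orthonormal : Uᵀ * U = 1
  right_orthonormal : Vᵀ * V = 1
  mul_right : A * V =
    U * Matrix.of fun (i : Fin a) (k : Fin b) => if (i : ℕ) = k then sv A i else 0
  transpose_mul_left : Aᵀ * U =
    V * Matrix.of fun (k : Fin b) (i : Fin a) => if (i : ℕ) = k then sv A i else 0

/-- The sample covariance matrix `n⁻¹ Xᵀ X`. -/
def gram {n : ℕ} {ι : Type*} (X : Matrix (Fin n) ι ℝ) : Matrix ι ι ℝ :=
  (n : ℝ)⁻¹ • (Xᵀ * X)

theorem gram_isHermitian {n : ℕ} {ι : Type*} (X : Matrix (Fin n) ι ℝ) :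
    (gram X).IsHermitian := by
  unfold gram Matrix.IsHermitian
  simp [Matrix.conjTranspose_eq_transpose_of_trivial, Matrix.transpose_mul]

/-! ### The regression model for a fixed sample size -/

section Fixed

variable {n p d : ℕ} {q : Fin p → ℕ}

/-- `X(J)`: the design matrices `X_j`, `j ∈ J`, side by side. -/
def stack (X : ∀ j, Matrix (Fin n) (Fin (q j)) ℝ) (J : Finset (Fin p)) :
    Matrix (Fin n) (Σ j : {j // j ∈ J}, Fin (q j)) ℝ :=
  Matrix.of fun t a => X a.1 t a.2

/-- `∑ⱼ Xⱼ Bⱼ`. -/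
def fitted (X : ∀ j, Matrix (Fin n) (Fin (q j)) ℝ)
    (B : ∀ j, Matrix (Fin (q j)) (Fin d) ℝ) : Matrix (Fin n) (Fin d) ℝ :=
  ∑ j, X j * B j

/-- The response `Y = ∑ⱼ Xⱼ Bⱼ + E`. -/
def response (X : ∀ j, Matrix (Fin n) (Fin (q j)) ℝ)
    (B : ∀ j, Matrix (Fin (q j)) (Fin d) ℝ) (E : Matrix (Fin n) (Fin d) ℝ) :
    Matrix (Fin n) (Fin d) ℝ :=
  fitted X B + E

/-- `ξ_E = maxⱼ ‖Xⱼᵀ E‖_op`. -/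
def noiseSize (X : ∀ j, Matrix (Fin n) (Fin (q j)) ℝ) (E : Matrix (Fin n) (Fin d) ℝ) : ℝ :=
  ⨆ j, opNorm ((X j)ᵀ * E)

/-- `J_n`: the relevant predictors. -/
def relevant (B : ∀ j, Matrix (Fin (q j)) (Fin d) ℝ) : Set (Fin p) := {j | B j ≠ 0}

/-- `r̄_j = rank(X_jᵀ Ỹ)`, with `Ỹ` the noiseless response. -/
def marginalRank (X : ∀ j, Matrix (Fin n) (Fin (q j)) ℝ)
    (B : ∀ j, Matrix (Fin (q j)) (Fin d) ℝ) (j : Fin p) : ℕ :=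
  ((X j)ᵀ * fitted X B).rank

/-- `J_o`: the relevant predictors of large dimension. -/
def largeRelevant (X : ∀ j, Matrix (Fin n) (Fin (q j)) ℝ)
    (B : ∀ j, Matrix (Fin (q j)) (Fin d) ℝ) : Set (Fin p) :=
  {j | j ∈ relevant B ∧ marginalRank X B j < min (q j) d}

/-! ### First stage -/

/-- The choices made along a run of the first stage. Step `k + 1` of the algorithm selects the
predictor `idx k`, the matrix `atom k` and the step length `lam k`. -/
structure FirstStage {p : ℕ} (q : Fin p → ℕ) (d : ℕ) where
  idx : ℕ → Fin p
  atom : ∀ k, Matrix (Fin (q (idx k))) (Fin d) ℝ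
  lam : ℕ → ℝ

namespace FirstStage

/-- The coefficient matrices after `k` steps. -/
def coef (R : FirstStage q d) : ℕ → ∀ j, Matrix (Fin (q j)) (Fin d) ℝ
  | 0 => 0
  | k + 1 => (1 - R.lam k) • R.coef k +
      R.lam k • (Pi.single (R.idx k) (R.atom k) : ∀ j, Matrix (Fin (q j)) (Fin d) ℝ)

/-- `Ĝ⁽ᵏ⁾`. -/
def fit (R : FirstStage q d) (X : ∀ j, Matrix (Fin n) (Fin (q j)) ℝ) (k : ℕ) :
    Matrix (Fin n) (Fin d) ℝ :=
  fitted X (R.coef k)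

/-- The choices are those of the relaxed greedy algorithm with nuclear norm bound `Ln`:
every selected pair is some maximizer of the correlation with the current residual, and
every step length is some minimizer of the residual norm. -/
structure IsRGA (R : FirstStage q d) (X : ∀ j, Matrix (Fin n) (Fin (q j)) ℝ)
    (Y : Matrix (Fin n) (Fin d) ℝ) (Ln : ℝ) : Prop where
  atom_le : ∀ k, nuc (R.atom k) ≤ Ln
  atom_max : ∀ k j (B : Matrix (Fin (q j)) (Fin d) ℝ), nuc B ≤ Ln →
    inn (Y - R.fit X k) (X j * B) ≤ inn (Y - R.fit X k) (X (R.idx k) * R.atom k)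
  lam_mem : ∀ k, R.lam k ∈ Set.Icc (0 : ℝ) 1
  lam_min : ∀ k, ∀ l ∈ Set.Icc (0 : ℝ) 1,
    frobSq (Y - (1 - R.lam k) • R.fit X k - R.lam k • (X (R.idx k) * R.atom k)) ≤
      frobSq (Y - (1 - l) • R.fit X k - l • (X (R.idx k) * R.atom k))

/-- `σ̂ₖ² = (n d)⁻¹ ‖Y - Ĝ⁽ᵏ⁾‖_F²`. -/
def sigmaSq (R : FirstStage q d) (X : ∀ j, Matrix (Fin n) (Fin (q j)) ℝ)
    (Y : Matrix (Fin n) (Fin d) ℝ) (k : ℕ) : ℝ :=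
  ((n : ℝ) * d)⁻¹ * frobSq (Y - R.fit X k)

open Classical in
/-- The just-in-time stopping time: the first `1 ≤ k ≤ K` with `σ̂ₖ² / σ̂ₖ₋₁² ≥ 1 - t`,
and `K` if there is none. -/
def kHat (R : FirstStage q d) (X : ∀ j, Matrix (Fin n) (Fin (q j)) ℝ)
    (Y : Matrix (Fin n) (Fin d) ℝ) (K : ℕ) (t : ℝ) : ℕ :=
  if h : ∃ k, 1 ≤ k ∧ k ≤ K ∧ 1 - t ≤ R.sigmaSq X Y k / R.sigmaSq X Y (k - 1) then
    Nat.find h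
  else K

/-- The set of predictors selected in the first `k` steps. -/
def selected (R : FirstStage q d) (k : ℕ) : Finset (Fin p) :=
  (Finset.range k).image R.idx

/-- The sum of the ranks of the coefficient matrices of the predictors selected in the first
`k` steps; for `k = k̂` it is `r̂ = ∑_{j ∈ Ĵ} r̂ⱼ`. -/
def totalRank (R : FirstStage q d) (k : ℕ) : ℕ :=
  ∑ j ∈ R.selected k, (R.coef k j).rank

end FirstStage

/-! ### Second stage -/

/-- The number of columns of `U_j`: `r` if `r < min q d`, and `q` otherwise. -/
def leftDim (r q d : ℕ) : ℕ := if r < min q d then r else q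

/-- The number of columns of `V_j`: `r` if `r < min q d`, and `d` otherwise. -/
def rightDim (r q d : ℕ) : ℕ := if r < min q d then r else d

/-- The singular vectors used by the second stage with rank parameter `r` and the choices made
along a run. Step `k + 1` selects `idx k`, `core k` and `lam k`. -/
structure SecondStage {p : ℕ} (q : Fin p → ℕ) (d r : ℕ) where
  U : ∀ j, Matrix (Fin (q j)) (Fin (leftDim r (q j) d)) ℝ
  V : ∀ j, Matrix (Fin d) (Fin (rightDim r (q j) d)) ℝ
  idx : ℕ → Fin p
  core : ∀ k, Matrix (Fin (leftDim r (q (idx k)) d)) (Fin (rightDim r (q (idx k)) d)) ℝ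
  lam : ℕ → ℝ

namespace SecondStage

variable {r : ℕ}

/-- The coefficient matrix `Σ̂ⱼ⁻¹ Uⱼ S Vⱼᵀ`. -/
def lift (R : SecondStage q d r) (X : ∀ j, Matrix (Fin n) (Fin (q j)) ℝ) (j : Fin p)
    (S : Matrix (Fin (leftDim r (q j) d)) (Fin (rightDim r (q j) d)) ℝ) :
    Matrix (Fin (q j)) (Fin d) ℝ :=
  (gram (X j))⁻¹ * R.U j * S * (R.V j)ᵀ

/-- The coefficient matrices after `k` steps. -/
def coef (R : SecondStage q d r) (X : ∀ j, Matrix (Fin n) (Fin (q j)) ℝ) :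
    ℕ → ∀ j, Matrix (Fin (q j)) (Fin d) ℝ
  | 0 => 0
  | k + 1 => (1 - R.lam k) • R.coef X k +
      R.lam k • (Pi.single (R.idx k) (R.lift X (R.idx k) (R.core k)) :
        ∀ j, Matrix (Fin (q j)) (Fin d) ℝ)

/-- `Ĝ⁽ᵏ⁾` of the second stage. -/
def fit (R : SecondStage q d r) (X : ∀ j, Matrix (Fin n) (Fin (q j)) ℝ) (k : ℕ) :
    Matrix (Fin n) (Fin d) ℝ :=
  fitted X (R.coef X k)

/-- `Uⱼ`, `Vⱼ` are leading singular vectors of `Xⱼᵀ Y`, and the choices are those of the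
second-stage relaxed greedy algorithm over the predictors in `J` with nuclear norm bound `Ln`. -/
structure IsRGA (R : SecondStage q d r) (X : ∀ j, Matrix (Fin n) (Fin (q j)) ℝ)
    (Y : Matrix (Fin n) (Fin d) ℝ) (J : Finset (Fin p)) (Ln : ℝ) : Prop where
  svd : ∀ j ∈ J, IsLeadingSVD ((X j)ᵀ * Y) (R.U j) (R.V j)
  idx_mem : ∀ k, R.idx k ∈ J
  core_le : ∀ k, nuc (R.core k) ≤ Ln
  core_max : ∀ k, ∀ j ∈ J,
    ∀ S : Matrix (Fin (leftDim r (q j) d)) (Fin (rightDim r (q j) d)) ℝ, nuc S ≤ Ln →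
      inn (Y - R.fit X k) (X j * R.lift X j S) ≤
        inn (Y - R.fit X k) (X (R.idx k) * R.lift X (R.idx k) (R.core k))
  lam_mem : ∀ k, R.lam k ∈ Set.Icc (0 : ℝ) 1
  lam_min : ∀ k, ∀ l ∈ Set.Icc (0 : ℝ) 1,
    frobSq (Y - (1 - R.lam k) • R.fit X k
        - R.lam k • (X (R.idx k) * R.lift X (R.idx k) (R.core k))) ≤
      frobSq (Y - (1 - l) • R.fit X k - l • (X (R.idx k) * R.lift X (R.idx k) (R.core k)))

end SecondStage

/-- `Ĵ_o = {j ∈ J : r < min(q_j, d)}`. -/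
def largeSelected (q : Fin p → ℕ) (d : ℕ) (J : Finset (Fin p)) (r : ℕ) : Finset (Fin p) :=
  J.filter fun j => r < min (q j) d

/-- `κ = #J · max{ max_{j ∈ J \ Ĵ_o} min(q_j, d), r · 1{Ĵ_o ≠ ∅} }`. -/
def kappa (q : Fin p → ℕ) (d : ℕ) (J : Finset (Fin p)) (r : ℕ) : ℕ :=
  J.card * max ((J \ largeSelected q d J r).sup fun j => min (q j) d)
    (if (largeSelected q d J r).Nonempty then r else 0)

end Fixed

/-! ### Stochastic orders -/

section Orders

variable {Ω : Type*} [MeasurableSpace Ω]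

/-- The events `A n` hold with probability tending to one (complements are used, so that the
notion is the right one even without measurability). -/
def WPTO (P : Measure Ω) (A : ℕ → Ω → Prop) : Prop :=
  Tendsto (fun n => P {ω | ¬ A n ω}) atTop (𝓝 0)

/-- `x_n = O_p(y_n)` for an extended real `x_n` (suprema are taken in `EReal`). -/
def IsBigOp (P : Measure Ω) (x : ℕ → Ω → EReal) (y : ℕ → Ω → ℝ) : Prop :=
  ∀ ε : ℝ, 0 < ε → ∃ M : ℝ,
    limsup (fun n => P {ω | ((M * y n ω : ℝ) : EReal) < x n ω}) atTop < ENNReal.ofReal ε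

/-- `x_n = o_p(y_n)`. -/
def IsLittleOp (P : Measure Ω) (x y : ℕ → Ω → ℝ) : Prop :=
  ∀ ε : ℝ, 0 < ε → WPTO P fun n ω => x n ω < ε * y n ω

end Orders

/-! ### The conditions on the sequence of models -/

section Conditions

variable {Ω : Type*} [MeasurableSpace Ω] {p d : ℕ → ℕ} {q : ∀ n, Fin (p n) → ℕ}

/-- (C1): with probability tending to one all eigenvalues of all `Σ̂ⱼ` lie in `[μ⁻¹, μ]`. -/
def CondC1 (P : Measure Ω) (X : ∀ n, Ω → ∀ j, Matrix (Fin n) (Fin (q n j)) ℝ) (μ : ℝ) : Prop :=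
  WPTO P fun n ω => ∀ j i,
    μ⁻¹ ≤ (gram_isHermitian (X n ω j)).eigenvalues i ∧
      (gram_isHermitian (X n ω j)).eigenvalues i ≤ μ

/-- (C2): `K_n → ∞` and `K_n ξ_E = O_p(n d_n^{1/2})`. -/
def CondC2 (P : Measure Ω) (X : ∀ n, Ω → ∀ j, Matrix (Fin n) (Fin (q n j)) ℝ)
    (E : ∀ n, Ω → Matrix (Fin n) (Fin (d n)) ℝ) (K : ℕ → ℕ) : Prop :=
  Tendsto K atTop atTop ∧
    IsBigOp P (fun n ω => ((K n * noiseSize (X n ω) (E n ω) : ℝ) : EReal))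
      (fun n _ => n * √(d n))

/-- (C3): with probability tending to one `λ_min(n⁻¹ X(J)ᵀ X(J)) > μ⁻¹` whenever
`#J ≤ 2 K_n`. -/
def CondC3 (P : Measure Ω) (X : ∀ n, Ω → ∀ j, Matrix (Fin n) (Fin (q n j)) ℝ) (K : ℕ → ℕ)
    (μ : ℝ) : Prop :=
  WPTO P fun n ω => ∀ J : Finset (Fin (p n)), J.card ≤ 2 * K n →
    ∀ i, μ⁻¹ < (gram_isHermitian (stack (X n ω) J)).eigenvalues i

/-- (C4): `d_n^{-1/2} ∑ⱼ ‖Bⱼ‖_* ≤ L`, and `s_n` is a non-decreasing positive sequence with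
`s_n² = o(K_n)` such that the squared smallest non-zero singular value of `d_n^{-1/2} Bⱼ` is at
least `s_n⁻¹` for every relevant `j`. -/
def CondC4 (B : ∀ n j, Matrix (Fin (q n j)) (Fin (d n)) ℝ) (K : ℕ → ℕ) (s : ℕ → ℝ) (L : ℝ) :
    Prop :=
  (∀ n, (√(d n))⁻¹ * ∑ j, nuc (B n j) ≤ L) ∧
  (∀ n, 0 < s n) ∧ Monotone s ∧
  (fun n => s n ^ 2) =o[atTop] (fun n => (K n : ℝ)) ∧
  ∀ n, ∀ j ∈ relevant (B n),
    (s n)⁻¹ ≤ sv ((√(d n))⁻¹ • B n j) ((B n j).rank - 1) ^ 2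

/-- (C5): `ξ_E = o_p(n δ_n)`, and with probability tending to one the smallest non-zero singular
value of `Xⱼᵀ Ỹ` is at least `n δ_n` for every `j ∈ J_o`. -/
def CondC5 (P : Measure Ω) (X : ∀ n, Ω → ∀ j, Matrix (Fin n) (Fin (q n j)) ℝ)
    (B : ∀ n j, Matrix (Fin (q n j)) (Fin (d n)) ℝ)
    (E : ∀ n, Ω → Matrix (Fin n) (Fin (d n)) ℝ) (δ : ℕ → ℝ) : Prop :=
  (∀ n, 0 < δ n) ∧
  IsLittleOp P (fun n ω => noiseSize (X n ω) (E n ω)) (fun n _ => n * δ n) ∧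
  WPTO P fun n ω => ∀ j ∈ largeRelevant (X n ω) (B n),
    n * δ n ≤ sv ((X n ω j)ᵀ * fitted (X n ω) (B n)) (marginalRank (X n ω) (B n) j - 1)

/-- (C6), local revelation: with probability tending to one, for every `j ∈ J_o`, if the columns
of `Ũ`, `Ṽ` are the leading `r̄_j` pairs of singular vectors of `Xⱼᵀ Ỹ`, then
`Σ̂ⱼ Bⱼ = Ũ Λ Ṽᵀ` for some `r̄_j × r̄_j` matrix `Λ`. -/
def CondC6 (P : Measure Ω) (X : ∀ n, Ω → ∀ j, Matrix (Fin n) (Fin (q n j)) ℝ)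
    (B : ∀ n j, Matrix (Fin (q n j)) (Fin (d n)) ℝ) : Prop :=
  WPTO P fun n ω => ∀ j ∈ largeRelevant (X n ω) (B n),
    ∀ (U : Matrix (Fin (q n j)) (Fin (marginalRank (X n ω) (B n) j)) ℝ)
      (V : Matrix (Fin (d n)) (Fin (marginalRank (X n ω) (B n) j)) ℝ),
      IsLeadingSVD ((X n ω j)ᵀ * fitted (X n ω) (B n)) U V →
        ∃ Λ : Matrix (Fin (marginalRank (X n ω) (B n) j))
            (Fin (marginalRank (X n ω) (B n) j)) ℝ,
          gram (X n ω j) * B n j = U * Λ * Vᵀ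

/-- The noise level condition: `Mₒ⁻¹ ≤ (n d_n)⁻¹ ‖E‖_F² ≤ Mₒ` with probability tending to
one. -/
def NoiseLevel (P : Measure Ω) (E : ∀ n, Ω → Matrix (Fin n) (Fin (d n)) ℝ) (Mo : ℝ) : Prop :=
  WPTO P fun n ω => Mo⁻¹ ≤ ((n : ℝ) * d n)⁻¹ * frobSq (E n ω) ∧
    ((n : ℝ) * d n)⁻¹ * frobSq (E n ω) ≤ Mo

end Conditions

end TSRGA

end

/-! All estimates are deterministic on an event of probability tending to one. Probability enters
only through intersecting finitely many such events (`WPTO.and`, `wpto_noise_small`) and through the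
final transfer of the order of `noiseSize` (`isBigOp_of_wpto`).

Screening (`rank_le_rank_coef_kHat`). Suppose the stopped first stage gives a relevant predictor a
coefficient matrix of rank below that of B_j (rank 0 if it was never selected). A matrix of too
small rank has squared distance at least d/s_n from B_j (`sv_sq_le_fro_sub_sq`), so by restricted
strong convexity the squared error of the fit is at least nd/(μ s_n). With such an error the last
greedy step lowers the squared residual by a multiple of nd/s_n², more than the stopping rule
tolerates when C is small. If the rule never fires, the squared residual shrinks by the factor
exp(-C K_n/s_n²) and falls below the noise level, which is impossible because the fits are almost
uncorrelated with E. Hence the selected set contains all relevant predictors, and the total rank r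
dominates the sum of the ranks of the B_j, therefore every marginal rank.

Bias (`IsRGA.fro_bias_le`). The second stage is compared with the target U_jᵀ Σ̂_j B_j V_j. If U_j
and V_j are full, the target reproduces B_j. Otherwise X_jᵀY perturbs a matrix of rank at most r
whose nonzero singular values are at least nδ and whose singular spaces carry Σ̂_j B_j. The leading
r singular vectors of the perturbed matrix then capture Σ̂_j B_j up to a relative error of order
ξ_E/(nδ), without any spectral gap at r (`IsLeadingSVD.fro_sub_proj_le`).

Contraction (`IsRGA.residual_step`). Let D be the norm of target fit minus current fit. This
difference comes from blocks whose smaller dimensions add up to at most κ. By strong convexity and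
Cauchy-Schwarz, a correlation of order D² between residual and difference forces the largest
operator-norm correlation of the dictionary to be of order D√(n/κ). The target lies well inside the
feasible set, so the greedy atom beats it by a fixed fraction, and the optimal step lowers the
squared residual by a multiple of D²/κ. This linear convergence lasts until D reaches the noise
visible to the dictionary, of order ξ√(κ/n), plus the bias. After m_n steps the geometric factor is
at most κξ²/(n²d), and monotonicity of the residual extends the bound to all later m. -/

noncomputable section

namespace TSRGA

/-! ### Frobenius inner product and norm -/

section Frobenius

variable {m n l : ℕ}

/-- A matrix as a vector of a Euclidean space. -/
def vecE : Matrix (Fin m) (Fin n) ℝ →ₗ[ℝ] EuclideanSpace ℝ (Fin m × Fin n) where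
  toFun A := WithLp.toLp 2 fun p => A p.1 p.2
  map_add' _ _ := rfl
  map_smul' _ _ := rfl

/-- The Frobenius norm. -/
def fro (A : Matrix (Fin m) (Fin n) ℝ) : ℝ := ‖vecE A‖

theorem inn_eq_sum (A B : Matrix (Fin m) (Fin n) ℝ) : inn A B = ∑ j, ∑ i, A i j * B i j := by
  simp [inn, Matrix.trace, Matrix.mul_apply]

theorem inn_eq_inner (A B : Matrix (Fin m) (Fin n) ℝ) : inn A B = inner ℝ (vecE A) (vecE B) := by
  rw [inn_eq_sum, Finset.sum_comm]
  simp only [PiLp.inner_apply, Fintype.sum_prod_type, RCLike.inner_apply, conj_trivial]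
  exact Finset.sum_congr rfl fun i _ => Finset.sum_congr rfl fun j _ => mul_comm _ _

theorem frobSq_eq (A : Matrix (Fin m) (Fin n) ℝ) : frobSq A = fro A ^ 2 := by
  rw [frobSq, inn_eq_inner, fro, real_inner_self_eq_norm_sq]

theorem fro_nonneg (A : Matrix (Fin m) (Fin n) ℝ) : 0 ≤ fro A := norm_nonneg _

theorem fro_zero : fro (0 : Matrix (Fin m) (Fin n) ℝ) = 0 := by simp [fro]

theorem fro_eq_zero {A : Matrix (Fin m) (Fin n) ℝ} (h : fro A = 0) : A = 0 := by
  have h' : vecE A = 0 := norm_eq_zero.1 h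
  ext i j
  exact congrArg (fun v : EuclideanSpace ℝ (Fin m × Fin n) => v (i, j)) h'

theorem fro_add_le (A B : Matrix (Fin m) (Fin n) ℝ) : fro (A + B) ≤ fro A + fro B := by
  simpa [fro] using norm_add_le (vecE A) (vecE B)

theorem fro_sub_le (A B : Matrix (Fin m) (Fin n) ℝ) : fro (A - B) ≤ fro A + fro B := by
  simpa [fro] using norm_sub_le (vecE A) (vecE B)

theorem fro_smul (c : ℝ) (A : Matrix (Fin m) (Fin n) ℝ) : fro (c • A) = |c| * fro A := by
  simp [fro, norm_smul]

theorem fro_sum_le {ι : Type*} (s : Finset ι) (A : ι → Matrix (Fin m) (Fin n) ℝ) :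
    fro (∑ i ∈ s, A i) ≤ ∑ i ∈ s, fro (A i) := by
  simpa [fro] using norm_sum_le s fun i => vecE (A i)

theorem abs_inn_le (A B : Matrix (Fin m) (Fin n) ℝ) : |inn A B| ≤ fro A * fro B := by
  rw [inn_eq_inner]; exact abs_real_inner_le_norm _ _

theorem inn_le (A B : Matrix (Fin m) (Fin n) ℝ) : inn A B ≤ fro A * fro B :=
  (le_abs_self _).trans (abs_inn_le A B)

theorem inn_self (A : Matrix (Fin m) (Fin n) ℝ) : inn A A = fro A ^ 2 := frobSq_eq A

theorem inn_comm (A B : Matrix (Fin m) (Fin n) ℝ) : inn A B = inn B A := by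
  simp [inn_eq_inner, real_inner_comm]

theorem inn_add_left (A B C : Matrix (Fin m) (Fin n) ℝ) : inn (A + B) C = inn A C + inn B C := by
  simp [inn_eq_inner, inner_add_left]

theorem inn_add_right (A B C : Matrix (Fin m) (Fin n) ℝ) : inn A (B + C) = inn A B + inn A C := by
  simp [inn_eq_inner, inner_add_right]

theorem inn_sub_left (A B C : Matrix (Fin m) (Fin n) ℝ) : inn (A - B) C = inn A C - inn B C := by
  simp [inn_eq_inner, inner_sub_left]

theorem inn_sub_right (A B C : Matrix (Fin m) (Fin n) ℝ) : inn A (B - C) = inn A B - inn A C := by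
  simp [inn_eq_inner, inner_sub_right]

theorem inn_smul_left (c : ℝ) (A B : Matrix (Fin m) (Fin n) ℝ) : inn (c • A) B = c * inn A B := by
  simp [inn_eq_inner, real_inner_smul_left]

theorem inn_smul_right (c : ℝ) (A B : Matrix (Fin m) (Fin n) ℝ) : inn A (c • B) = c * inn A B := by
  simp [inn_eq_inner, real_inner_smul_right]

theorem inn_zero_right (A : Matrix (Fin m) (Fin n) ℝ) : inn A 0 = 0 := by
  simp [inn]

theorem inn_sum_right {ι : Type*} (s : Finset ι) (A : Matrix (Fin m) (Fin n) ℝ)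
    (B : ι → Matrix (Fin m) (Fin n) ℝ) : inn A (∑ i ∈ s, B i) = ∑ i ∈ s, inn A (B i) := by
  simp [inn_eq_inner, inner_sum]

theorem inn_mul_right (A : Matrix (Fin m) (Fin n) ℝ) (X : Matrix (Fin m) (Fin l) ℝ)
    (B : Matrix (Fin l) (Fin n) ℝ) : inn A (X * B) = inn (Xᵀ * A) B := by
  simp [inn, Matrix.mul_assoc]

theorem inn_mul_right' (A : Matrix (Fin m) (Fin n) ℝ) (B : Matrix (Fin m) (Fin l) ℝ)
    (X : Matrix (Fin l) (Fin n) ℝ) : inn A (B * X) = inn (A * Xᵀ) B := by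
  simp only [inn, Matrix.transpose_mul, Matrix.transpose_transpose]
  rw [← Matrix.mul_assoc, Matrix.trace_mul_comm, Matrix.mul_assoc]

theorem fro_transpose (A : Matrix (Fin m) (Fin n) ℝ) : fro Aᵀ = fro A := by
  have h : fro Aᵀ ^ 2 = fro A ^ 2 := by
    rw [← inn_self, ← inn_self, inn_eq_sum, inn_eq_sum, Finset.sum_comm]; rfl
  exact (sq_eq_sq₀ (fro_nonneg _) (fro_nonneg _)).1 h

theorem fro_sq_add (A B : Matrix (Fin m) (Fin n) ℝ) :
    fro (A + B) ^ 2 = fro A ^ 2 + 2 * inn A B + fro B ^ 2 := by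
  simp only [← inn_self, inn_add_left, inn_add_right, inn_comm B A]; ring

theorem fro_sq_sub (A B : Matrix (Fin m) (Fin n) ℝ) :
    fro (A - B) ^ 2 = fro A ^ 2 - 2 * inn A B + fro B ^ 2 := by
  simp only [← inn_self, inn_sub_left, inn_sub_right, inn_comm B A]; ring

/-- The squared Frobenius norm is the sum of the squared norms of the columns. -/
theorem fro_sq_eq_cols (A : Matrix (Fin m) (Fin n) ℝ) :
    fro A ^ 2 = ∑ j, A.col j ⬝ᵥ A.col j := by
  rw [← inn_self, inn_eq_sum]; rfl

/-- Matrix products act column by column, so each quadratic-form bound on vectors passes to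
Frobenius norms; operator norms and Gram bounds both enter this way. -/
theorem fro_sq_mul_le_of_forall {A : Matrix (Fin m) (Fin n) ℝ} {c : ℝ}
    (h : ∀ x, (A *ᵥ x) ⬝ᵥ (A *ᵥ x) ≤ c * (x ⬝ᵥ x)) (B : Matrix (Fin n) (Fin l) ℝ) :
    fro (A * B) ^ 2 ≤ c * fro B ^ 2 := by
  rw [fro_sq_eq_cols, fro_sq_eq_cols, Finset.mul_sum]
  exact Finset.sum_le_sum fun j _ => h (B.col j)

theorem dotProduct_mulVec_self (A : Matrix (Fin m) (Fin n) ℝ) (x : Fin n → ℝ) :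
    (A *ᵥ x) ⬝ᵥ (A *ᵥ x) = x ⬝ᵥ ((Aᵀ * A) *ᵥ x) := by
  rw [← Matrix.mulVec_mulVec, Matrix.dotProduct_mulVec, Matrix.mulVec_transpose, dotProduct_comm]

/-! ### Operator norm -/

-- True by definition; it gives access to submultiplicativity and invariance under transposition.
open scoped Matrix.Norms.L2Operator in
theorem opNorm_eq_norm (A : Matrix (Fin m) (Fin n) ℝ) : opNorm A = ‖A‖ := rfl

theorem opNorm_nonneg (A : Matrix (Fin m) (Fin n) ℝ) : 0 ≤ opNorm A := norm_nonneg _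

open scoped Matrix.Norms.L2Operator in
theorem opNorm_transpose (A : Matrix (Fin m) (Fin n) ℝ) : opNorm Aᵀ = opNorm A := by
  rw [opNorm_eq_norm, opNorm_eq_norm, ← Matrix.conjTranspose_eq_transpose_of_trivial,
    Matrix.l2_opNorm_conjTranspose]

open scoped Matrix.Norms.L2Operator in
theorem opNorm_mul_le (A : Matrix (Fin m) (Fin n) ℝ) (B : Matrix (Fin n) (Fin l) ℝ) :
    opNorm (A * B) ≤ opNorm A * opNorm B :=
  Matrix.l2_opNorm_mul A B

open scoped Matrix.Norms.L2Operator in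
theorem opNorm_sub_le (A B : Matrix (Fin m) (Fin n) ℝ) : opNorm (A - B) ≤ opNorm A + opNorm B :=
  norm_sub_le A B

theorem norm_toLp_sq {ι : Type*} [Fintype ι] (x : ι → ℝ) : ‖WithLp.toLp 2 x‖ ^ 2 = x ⬝ᵥ x := by
  rw [EuclideanSpace.norm_sq_eq]
  simp [dotProduct, pow_two]

theorem mulVec_sq_le (A : Matrix (Fin m) (Fin n) ℝ) (x : Fin n → ℝ) :
    (A *ᵥ x) ⬝ᵥ (A *ᵥ x) ≤ opNorm A ^ 2 * (x ⬝ᵥ x) := by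
  have h := (LinearMap.toContinuousLinearMap (Matrix.toEuclideanLin A)).le_opNorm
    (WithLp.toLp 2 x)
  rw [← norm_toLp_sq, ← norm_toLp_sq, ← mul_pow]
  exact pow_le_pow_left₀ (norm_nonneg _) h 2

theorem opNorm_le_of_forall {A : Matrix (Fin m) (Fin n) ℝ} {c : ℝ} (hc : 0 ≤ c)
    (h : ∀ x, (A *ᵥ x) ⬝ᵥ (A *ᵥ x) ≤ c ^ 2 * (x ⬝ᵥ x)) : opNorm A ≤ c := by
  refine ContinuousLinearMap.opNorm_le_bound _ hc fun x => ?_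
  refine le_of_sq_le_sq ?_ (by positivity)
  have := h x.ofLp
  rw [← norm_toLp_sq, ← norm_toLp_sq, ← mul_pow] at this
  exact this

theorem fro_mul_le (A : Matrix (Fin m) (Fin n) ℝ) (B : Matrix (Fin n) (Fin l) ℝ) :
    fro (A * B) ≤ opNorm A * fro B := by
  refine le_of_sq_le_sq ?_ (mul_nonneg (opNorm_nonneg _) (fro_nonneg _))
  rw [mul_pow]
  exact fro_sq_mul_le_of_forall (mulVec_sq_le A) B

theorem fro_mul_le' (A : Matrix (Fin m) (Fin n) ℝ) (B : Matrix (Fin n) (Fin l) ℝ) :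
    fro (A * B) ≤ fro A * opNorm B := by
  rw [← fro_transpose, Matrix.transpose_mul, ← fro_transpose A, ← opNorm_transpose B, mul_comm]
  exact fro_mul_le _ _

theorem opNorm_le_fro (A : Matrix (Fin m) (Fin n) ℝ) : opNorm A ≤ fro A := by
  refine opNorm_le_of_forall (fro_nonneg _) fun x => ?_
  have h : ∀ i, (A *ᵥ x) i * (A *ᵥ x) i ≤ (∑ j, A i j ^ 2) * (x ⬝ᵥ x) := fun i => by
    have := Finset.sum_mul_sq_le_sq_mul_sq Finset.univ (A i) x
    simpa [Matrix.mulVec, dotProduct, pow_two] using this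
  calc (A *ᵥ x) ⬝ᵥ (A *ᵥ x) ≤ ∑ i, (∑ j, A i j ^ 2) * (x ⬝ᵥ x) := Finset.sum_le_sum fun i _ => h i
    _ = fro A ^ 2 * (x ⬝ᵥ x) := by
      rw [← Finset.sum_mul, ← inn_self, inn_eq_sum, Finset.sum_comm]
      simp [pow_two]

theorem fro_sq_le_cols (A : Matrix (Fin m) (Fin n) ℝ) : fro A ^ 2 ≤ n * opNorm A ^ 2 := by
  have h := fro_sq_mul_le_of_forall (mulVec_sq_le A) (1 : Matrix (Fin n) (Fin n) ℝ)
  rw [Matrix.mul_one] at h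
  refine h.trans_eq ?_
  rw [← inn_self]
  simp [inn, mul_comm]

/-- Source of the dimension factors: passing from operator-norm to Frobenius-norm correlations costs
min(q, d) per block, and these costs add up to κ. -/
theorem fro_sq_le_min (A : Matrix (Fin m) (Fin n) ℝ) :
    fro A ^ 2 ≤ (min m n : ℕ) * opNorm A ^ 2 := by
  rcases le_total m n with h | h
  · rw [min_eq_left h, ← fro_transpose, ← opNorm_transpose]; exact fro_sq_le_cols _
  · rw [min_eq_right h]; exact fro_sq_le_cols _

/-! ### Matrices with orthonormal columns -/

theorem mulVec_sq_of_orthonormal {U : Matrix (Fin m) (Fin n) ℝ} (hU : Uᵀ * U = 1)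
    (x : Fin n → ℝ) : (U *ᵥ x) ⬝ᵥ (U *ᵥ x) = x ⬝ᵥ x := by
  rw [dotProduct_mulVec_self, hU, Matrix.one_mulVec]

theorem opNorm_le_one_of_orthonormal {U : Matrix (Fin m) (Fin n) ℝ} (hU : Uᵀ * U = 1) :
    opNorm U ≤ 1 :=
  opNorm_le_of_forall zero_le_one fun x => by rw [mulVec_sq_of_orthonormal hU]; simp

theorem fro_orthonormal_mul {U : Matrix (Fin m) (Fin n) ℝ} (hU : Uᵀ * U = 1)
    (A : Matrix (Fin n) (Fin l) ℝ) : fro (U * A) = fro A := by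
  have h : fro (U * A) ^ 2 = fro A ^ 2 := by
    rw [← inn_self, inn_mul_right, ← Matrix.mul_assoc, hU, Matrix.one_mul, inn_self]
  exact (sq_eq_sq₀ (fro_nonneg _) (fro_nonneg _)).1 h

theorem fro_mul_orthonormal_transpose {V : Matrix (Fin m) (Fin n) ℝ} (hV : Vᵀ * V = 1)
    (A : Matrix (Fin l) (Fin n) ℝ) : fro (A * Vᵀ) = fro A := by
  rw [← fro_transpose, Matrix.transpose_mul, Matrix.transpose_transpose, fro_orthonormal_mul hV,
    fro_transpose]

theorem one_sub_proj_sq {V : Matrix (Fin m) (Fin n) ℝ} (hV : Vᵀ * V = 1) :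
    (1 - V * Vᵀ)ᵀ * (1 - V * Vᵀ) = 1 - V * Vᵀ := by
  have : V * Vᵀ * (V * Vᵀ) = V * Vᵀ := by
    rw [Matrix.mul_assoc, ← Matrix.mul_assoc Vᵀ, hV, Matrix.one_mul]
  simp [Matrix.mul_sub, Matrix.sub_mul, this]

theorem one_sub_proj_mulVec_sq_le {V : Matrix (Fin m) (Fin n) ℝ} (hV : Vᵀ * V = 1)
    (x : Fin m → ℝ) : ((1 - V * Vᵀ) *ᵥ x) ⬝ᵥ ((1 - V * Vᵀ) *ᵥ x) ≤ x ⬝ᵥ x := by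
  rw [dotProduct_mulVec_self, one_sub_proj_sq hV, Matrix.sub_mulVec, Matrix.one_mulVec,
    dotProduct_sub]
  have h := dotProduct_mulVec_self Vᵀ x
  rw [Matrix.transpose_transpose] at h
  rw [← h]
  have : 0 ≤ (Vᵀ *ᵥ x) ⬝ᵥ (Vᵀ *ᵥ x) := Finset.sum_nonneg fun i _ => mul_self_nonneg _
  linarith

theorem opNorm_one_sub_proj_le {V : Matrix (Fin m) (Fin n) ℝ} (hV : Vᵀ * V = 1) :
    opNorm (1 - V * Vᵀ) ≤ 1 :=
  opNorm_le_of_forall zero_le_one fun x => by simpa using one_sub_proj_mulVec_sq_le hV x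

end Frobenius

/-! ### Singular values -/

section Singular

variable {m n l : ℕ}

theorem sv_nonneg (A : Matrix (Fin m) (Fin n) ℝ) (i : ℕ) : 0 ≤ sv A i :=
  LinearMap.singularValues_nonneg _ _

theorem sv_antitone (A : Matrix (Fin m) (Fin n) ℝ) : Antitone (sv A) :=
  LinearMap.singularValues_antitone _

theorem nuc_nonneg (A : Matrix (Fin m) (Fin n) ℝ) : 0 ≤ nuc A :=
  Finset.sum_nonneg fun i _ => sv_nonneg A i

theorem finrank_range_toEuclideanLin (A : Matrix (Fin m) (Fin n) ℝ) :
    Module.finrank ℝ (Matrix.toEuclideanLin A).range = A.rank := by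
  rw [Matrix.toEuclideanLin_eq_toLin_orthonormal]
  exact (Matrix.rank_eq_finrank_range_toLin A _ _).symm

theorem sv_pos_iff (A : Matrix (Fin m) (Fin n) ℝ) (i : ℕ) : 0 < sv A i ↔ i < A.rank := by
  rw [sv, LinearMap.singularValues_pos_iff_lt_finrank_range, finrank_range_toEuclideanLin]

theorem sv_eq_zero_of_rank_le {A : Matrix (Fin m) (Fin n) ℝ} {i : ℕ} (h : A.rank ≤ i) :
    sv A i = 0 :=
  le_antisymm (not_lt.1 fun h' => absurd ((sv_pos_iff A i).1 h') (not_lt.2 h)) (sv_nonneg A i)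

/-- The right singular vectors form an orthogonal matrix. -/
theorem exists_right_singular (A : Matrix (Fin m) (Fin n) ℝ) :
    ∃ W : Matrix (Fin n) (Fin n) ℝ, Wᵀ * W = 1 ∧ W * Wᵀ = 1 ∧
      Aᵀ * A * W = W * Matrix.diagonal fun i : Fin n => sv A i ^ 2 := by
  set T := Matrix.toEuclideanLin A with hT
  have hn : Module.finrank ℝ (EuclideanSpace ℝ (Fin n)) = n := by simp
  set b := T.isSymmetric_adjoint_comp_self.eigenvectorBasis hn with hb
  let W : Matrix (Fin n) (Fin n) ℝ := Matrix.of fun i k => b k i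
  have hW : Wᵀ * W = 1 := by
    ext i k
    have := (orthonormal_iff_ite.1 b.orthonormal) i k
    rw [PiLp.inner_apply] at this
    simp only [RCLike.inner_apply, conj_trivial] at this
    rw [Matrix.mul_apply, Matrix.one_apply, ← this]
    exact Finset.sum_congr rfl fun x _ => mul_comm _ _
  refine ⟨W, hW, mul_eq_one_comm.1 hW, ?_⟩
  have hadj : LinearMap.adjoint T = Matrix.toEuclideanLin Aᵀ := by
    rw [hT, ← Matrix.conjTranspose_eq_transpose_of_trivial,
      Matrix.toEuclideanLin_conjTranspose_eq_adjoint]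
  ext i k
  have hk := T.isSymmetric_adjoint_comp_self.apply_eigenvectorBasis hn k
  rw [← T.sq_singularValues_fin hn k, LinearMap.comp_apply, ← hb,
    LinearMap.congr_fun hadj] at hk
  have hk' := congrArg (fun v : EuclideanSpace ℝ (Fin n) => v i) hk
  have h1 : (Aᵀ * A * W) i k = (Aᵀ *ᵥ (A *ᵥ (b k).ofLp)) i := by
    rw [Matrix.mulVec_mulVec]; rfl
  rw [h1, Matrix.mul_diagonal, mul_comm]
  exact hk'

/-- The quadratic form of `Aᵀ * A` is diagonal in the right singular basis. The min-max arguments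
below need only this, not a full singular value decomposition. -/
theorem right_singular_mulVec_sq {A : Matrix (Fin m) (Fin n) ℝ} {W : Matrix (Fin n) (Fin n) ℝ}
    (hW : Wᵀ * W = 1)
    (h : Aᵀ * A * W = W * Matrix.diagonal fun i : Fin n => sv A i ^ 2) (y : Fin n → ℝ) :
    (A *ᵥ (W *ᵥ y)) ⬝ᵥ (A *ᵥ (W *ᵥ y)) = ∑ i : Fin n, sv A i ^ 2 * (y i * y i) := by
  rw [Matrix.mulVec_mulVec, dotProduct_mulVec_self, Matrix.transpose_mul, Matrix.mul_assoc,
    ← Matrix.mul_assoc Aᵀ, h, ← Matrix.mul_assoc, hW, Matrix.one_mul]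
  simp only [dotProduct, Matrix.mulVec_diagonal]
  exact Finset.sum_congr rfl fun i _ => by ring

theorem dotProduct_le_sqrt {ι : Type*} [Fintype ι] (x y : ι → ℝ) :
    x ⬝ᵥ y ≤ √(x ⬝ᵥ x) * √(y ⬝ᵥ y) := by
  have h := real_inner_le_norm (WithLp.toLp 2 x) (WithLp.toLp 2 y)
  rw [← norm_toLp_sq, ← norm_toLp_sq, Real.sqrt_sq (norm_nonneg _), Real.sqrt_sq (norm_nonneg _)]
  refine le_trans (le_of_eq ?_) h
  simp [PiLp.inner_apply, dotProduct, mul_comm]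

theorem dotProduct_self_nonneg' {ι : Type*} [Fintype ι] (x : ι → ℝ) : 0 ≤ x ⬝ᵥ x :=
  Finset.sum_nonneg fun _ _ => mul_self_nonneg _

/-- Duality between the operator norm and the nuclear norm. -/
theorem inn_le_opNorm_mul_nuc (A B : Matrix (Fin m) (Fin n) ℝ) :
    inn A B ≤ opNorm A * nuc B := by
  obtain ⟨W, hW, hW', h⟩ := exists_right_singular B
  -- In the right singular basis of `B` the j-th column of `B * W` has length `sv B j`, so
  -- Cauchy-Schwarz in each column produces the nuclear norm.
  have h1 : inn A B = inn (A * W) (B * W) := by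
    rw [inn_mul_right', Matrix.mul_assoc, hW', Matrix.mul_one]
  have hcol : ∀ j, W.col j ⬝ᵥ W.col j = 1 := fun j => by
    have := congrFun (congrFun hW j) j
    rw [Matrix.one_apply_eq] at this
    exact this
  rw [h1, inn_eq_sum, nuc, Finset.sum_range, Finset.mul_sum]
  refine Finset.sum_le_sum fun j _ => ?_
  have h2 : (B *ᵥ W.col j) ⬝ᵥ (B *ᵥ W.col j) = sv B j ^ 2 := by
    have := right_singular_mulVec_sq hW h (Pi.single j 1)
    rw [Matrix.mulVec_single_one] at this
    rw [this, Finset.sum_eq_single j] <;> simp +contextual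
  have h3 : (A *ᵥ W.col j) ⬝ᵥ (A *ᵥ W.col j) ≤ opNorm A ^ 2 := by
    simpa [hcol] using mulVec_sq_le A (W.col j)
  calc ∑ i, (A * W) i j * (B * W) i j = (A *ᵥ W.col j) ⬝ᵥ (B *ᵥ W.col j) := rfl
    _ ≤ √((A *ᵥ W.col j) ⬝ᵥ (A *ᵥ W.col j)) * √((B *ᵥ W.col j) ⬝ᵥ (B *ᵥ W.col j)) :=
      dotProduct_le_sqrt _ _
    _ ≤ opNorm A * sv B j := by
      rw [h2, Real.sqrt_sq (sv_nonneg _ _)]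
      refine mul_le_mul_of_nonneg_right ?_ (sv_nonneg _ _)
      exact Real.sqrt_le_iff.2 ⟨opNorm_nonneg _, h3⟩

theorem abs_inn_le_opNorm_mul_nuc (A B : Matrix (Fin m) (Fin n) ℝ) :
    |inn A B| ≤ opNorm A * nuc B := by
  refine abs_le'.2 ⟨inn_le_opNorm_mul_nuc A B, ?_⟩
  have h := inn_le_opNorm_mul_nuc (-A) B
  have h1 : inn (-A) B = -inn A B := by simpa using inn_smul_left (-1) A B
  have h2 : opNorm (-A) = opNorm A := by simp [opNorm]
  rwa [h1, h2] at h

/-- Pair `B` with itself in the duality, bound the operator norm by the Frobenius norm and cancel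
one factor. -/
theorem fro_le_nuc (B : Matrix (Fin m) (Fin n) ℝ) : fro B ≤ nuc B := by
  rcases (fro_nonneg B).eq_or_lt with h | h
  · rw [← h]; exact nuc_nonneg B
  · have h1 : fro B * fro B ≤ fro B * nuc B := by
      rw [← pow_two, ← inn_self]
      exact (inn_le_opNorm_mul_nuc B B).trans
        (mul_le_mul_of_nonneg_right (opNorm_le_fro B) (nuc_nonneg B))
    exact le_of_mul_le_mul_left h1 h

/-- The singular values are at most the operator norm. -/
theorem sv_le_opNorm (A : Matrix (Fin m) (Fin n) ℝ) (i : ℕ) (hi : i < n) :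
    sv A i ≤ opNorm A := by
  obtain ⟨W, hW, -, h⟩ := exists_right_singular A
  have h1 := right_singular_mulVec_sq hW h (Pi.single ⟨i, hi⟩ 1)
  have h2 := mulVec_sq_le A (W *ᵥ Pi.single ⟨i, hi⟩ 1)
  rw [h1, Finset.sum_eq_single ⟨i, hi⟩, mulVec_sq_of_orthonormal hW] at h2
  · simp only [Pi.single_eq_same, mul_one, single_dotProduct] at h2
    exact le_of_sq_le_sq h2 (opNorm_nonneg _)
  · simp +contextual
  · simp

theorem nuc_le_opNorm_of_rank_le_one {A : Matrix (Fin m) (Fin n) ℝ} (h : A.rank ≤ 1) :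
    nuc A ≤ opNorm A := by
  rcases n.eq_zero_or_pos with rfl | hn
  · simpa [nuc] using opNorm_nonneg A
  · rw [nuc, Finset.sum_eq_single 0]
    · exact sv_le_opNorm A 0 hn
    · intro i _ hi
      exact sv_eq_zero_of_rank_le (h.trans (Nat.one_le_iff_ne_zero.2 hi))
    · simp [hn.ne']

/-- A linear functional that is at most `c` on the nuclear norm ball of radius `r` is given by a
matrix of operator norm at most `c / r`. -/
theorem mul_opNorm_le_of_forall {A : Matrix (Fin m) (Fin n) ℝ} {r c : ℝ} (hr : 0 < r)
    (h : ∀ B, nuc B ≤ r → inn A B ≤ c) : r * opNorm A ≤ c := by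
  have hc : 0 ≤ c := by
    have := h 0 (by
      have h0 : nuc (0 : Matrix (Fin m) (Fin n) ℝ) ≤ opNorm 0 :=
        nuc_le_opNorm_of_rank_le_one (by simp)
      have : opNorm (0 : Matrix (Fin m) (Fin n) ℝ) = 0 := by simp [opNorm]
      linarith)
    rwa [inn_zero_right] at this
  rw [mul_comm, ← le_div_iff₀ hr]
  refine opNorm_le_of_forall (by positivity) fun x => ?_
  set a := √((A *ᵥ x) ⬝ᵥ (A *ᵥ x)) with ha
  set b := √(x ⬝ᵥ x) with hb
  have ha2 : a ^ 2 = (A *ᵥ x) ⬝ᵥ (A *ᵥ x) := Real.sq_sqrt (dotProduct_self_nonneg' _)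
  have hb2 : b ^ 2 = x ⬝ᵥ x := Real.sq_sqrt (dotProduct_self_nonneg' _)
  have ha0 : 0 ≤ a := Real.sqrt_nonneg _
  have hb0 : 0 ≤ b := Real.sqrt_nonneg _
  rw [← ha2, ← hb2, ← mul_pow]
  refine pow_le_pow_left₀ ha0 ?_ 2
  rcases ha0.eq_or_lt with ha' | ha'
  · rw [← ha']; positivity
  have hb' : 0 < b := by
    refine hb0.lt_of_ne fun hb' => ?_
    have hx : x = 0 := by
      rw [← dotProduct_self_eq_zero, ← hb2, ← hb']; simp
    rw [hx] at ha2
    simp at ha2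
    exact ha'.ne' ha2
  -- The rank-one test matrix in the direction `A x ⊗ x`, scaled to Frobenius norm `r`; at rank one
  -- the nuclear norm is no larger than that.
  let B : Matrix (Fin m) (Fin n) ℝ := (r / (a * b)) • Matrix.vecMulVec (A *ᵥ x) x
  have hfro : fro (Matrix.vecMulVec (A *ᵥ x) x) = a * b := by
    refine (sq_eq_sq₀ (fro_nonneg _) (by positivity)).1 ?_
    rw [← inn_self, inn_eq_sum, mul_pow, ha2, hb2, mul_comm]
    simp only [dotProduct, Matrix.vecMulVec_apply, Finset.sum_mul_sum]
    exact Finset.sum_congr rfl fun i _ => Finset.sum_congr rfl fun j _ => by ring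
  have hB : nuc B ≤ r := by
    have h1 : B.rank ≤ 1 := by
      have : B = Matrix.vecMulVec ((r / (a * b)) • (A *ᵥ x)) x := by
        rw [Matrix.smul_vecMulVec]
      rw [this]; exact Matrix.rank_vecMulVec_le _ _
    refine (nuc_le_opNorm_of_rank_le_one h1).trans ((opNorm_le_fro B).trans_eq ?_)
    rw [fro_smul, hfro, abs_of_pos (by positivity)]
    field_simp
  have h2 := h B hB
  have h3 : inn A (Matrix.vecMulVec (A *ᵥ x) x) = a ^ 2 := by
    rw [ha2, inn_eq_sum, Finset.sum_comm]
    refine Finset.sum_congr rfl fun i _ => ?_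
    simp only [Matrix.vecMulVec_apply, Matrix.mulVec, dotProduct, Finset.sum_mul, Finset.mul_sum]
    refine Finset.sum_congr rfl fun j _ => ?_
    exact Finset.sum_congr rfl fun k _ => by ring
  rw [inn_smul_right, h3] at h2
  rw [div_mul_eq_mul_div, le_div_iff₀ hr]
  have h4 : r / (a * b) * a ^ 2 = a * r / b := by field_simp
  rw [h4, div_le_iff₀ hb'] at h2
  exact h2

/-! ### Min-max principles -/

theorem exists_mulVec_eq_zero_of_card_lt {ι κ : Type*} [Fintype ι] [Fintype κ]
    (A : Matrix ι κ ℝ) (h : Fintype.card ι < Fintype.card κ) : ∃ c ≠ 0, A *ᵥ c = 0 := by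
  classical
  obtain ⟨c, hc, hc0⟩ := Submodule.exists_mem_ne_zero_of_ne_bot
    (LinearMap.ker_ne_bot_of_finrank_lt (f := Matrix.mulVecLin A) (by simpa using h))
  exact ⟨c, hc0, hc⟩

theorem exists_mulVec_eq_zero_of_rank_lt {ι κ : Type*} [Fintype ι] [Fintype κ] [DecidableEq κ]
    (A : Matrix ι κ ℝ) (h : A.rank < Fintype.card κ) : ∃ c ≠ 0, A *ᵥ c = 0 := by
  have hk : (Matrix.mulVecLin A).ker ≠ ⊥ := by
    intro hb
    have := LinearMap.finrank_range_add_finrank_ker (Matrix.mulVecLin A)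
    rw [hb] at this
    simp only [finrank_bot, add_zero, Module.finrank_fintype_fun_eq_card] at this
    rw [Matrix.rank] at h
    omega
  obtain ⟨c, hc, hc0⟩ := Submodule.exists_mem_ne_zero_of_ne_bot hk
  exact ⟨c, hc0, hc⟩

/-- In every space spanned by more than `t` vectors there is a direction that is stretched by at
most the `(t+1)`-st largest singular value. -/
theorem exists_mulVec_sq_le_sv {κ : Type*} [Fintype κ] (A : Matrix (Fin m) (Fin n) ℝ) (t : ℕ)
    (Z : Matrix (Fin n) κ ℝ) (h : t < Fintype.card κ) :
    ∃ c ≠ 0, (A *ᵥ (Z *ᵥ c)) ⬝ᵥ (A *ᵥ (Z *ᵥ c)) ≤ sv A t ^ 2 * ((Z *ᵥ c) ⬝ᵥ (Z *ᵥ c)) := by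
  obtain ⟨W, hW, hW', hA⟩ := exists_right_singular A
  have hcard : Fintype.card {i : Fin n // (i : ℕ) < t} ≤ t := by
    have := Fintype.card_le_of_injective
      (fun i : {i : Fin n // (i : ℕ) < t} => (⟨i.1, i.2⟩ : Fin t))
      (fun i j hij => by simpa [Subtype.ext_iff, Fin.ext_iff] using hij)
    simpa using this
  -- Killing the at most `t` leading coordinates in the right singular basis leaves only directions
  -- stretched by at most `sv A t`.
  obtain ⟨c, hc0, hc⟩ := exists_mulVec_eq_zero_of_card_lt
    ((Wᵀ * Z).submatrix (fun i : {i : Fin n // (i : ℕ) < t} => i.1) id) (hcard.trans_lt h)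
  refine ⟨c, hc0, ?_⟩
  set y := (Wᵀ * Z) *ᵥ c with hy
  have hy0 : ∀ i : Fin n, (i : ℕ) < t → y i = 0 := fun i hi => congrFun hc ⟨i, hi⟩
  have hZ : Z *ᵥ c = W *ᵥ y := by
    rw [hy, Matrix.mulVec_mulVec, ← Matrix.mul_assoc, hW', Matrix.one_mul]
  rw [hZ, right_singular_mulVec_sq hW hA, mulVec_sq_of_orthonormal hW, dotProduct, Finset.mul_sum]
  refine Finset.sum_le_sum fun i _ => ?_
  rcases lt_or_ge (i : ℕ) t with hi | hi
  · simp [hy0 i hi]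
  · exact mul_le_mul_of_nonneg_right
      (pow_le_pow_left₀ (sv_nonneg _ _) (sv_antitone A hi) 2) (mul_self_nonneg _)

/-- Extension of a vector by zeros. -/
def extendZero {t r : ℕ} (c : Fin t → ℝ) : Fin r → ℝ :=
  fun i => if hi : (i : ℕ) < t then c ⟨i, hi⟩ else 0

theorem submatrix_castLE_mulVec {t r : ℕ} (M : Matrix (Fin m) (Fin r) ℝ) (h : t ≤ r)
    (c : Fin t → ℝ) : M.submatrix id (Fin.castLE h) *ᵥ c = M *ᵥ extendZero c := by
  ext i
  simp only [Matrix.mulVec, dotProduct]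
  rw [← Finset.sum_subset (Finset.subset_univ (Finset.univ.map (Fin.castLEEmb h)))]
  · rw [Finset.sum_map]
    exact Finset.sum_congr rfl fun k _ => by simp [extendZero]
  · intro k _ hk
    have : ¬ (k : ℕ) < t := fun hk' => hk (by
      simp only [Finset.mem_map, Finset.mem_univ, true_and]
      exact ⟨⟨k, hk'⟩, rfl⟩)
    simp [extendZero, this]

theorem eq_zero_of_extendZero_eq_zero {t r : ℕ} (h : t ≤ r) {c : Fin t → ℝ}
    (hc : (extendZero c : Fin r → ℝ) = 0) : c = 0 := by
  ext k
  simpa [extendZero] using congrFun hc (Fin.castLE h k)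

/-- A matrix of smaller rank is at least as far away as the smallest non-zero singular value. -/
theorem sv_sq_le_fro_sub_sq {A B : Matrix (Fin m) (Fin n) ℝ} (h : A.rank < B.rank) :
    sv B (B.rank - 1) ^ 2 ≤ fro (B - A) ^ 2 := by
  obtain ⟨W, hW, hW', hB⟩ := exists_right_singular B
  have hr : B.rank ≤ n := B.rank_le_width
  let Z : Matrix (Fin n) (Fin B.rank) ℝ := W.submatrix id (Fin.castLE hr)
  -- A direction in the span of the leading right singular vectors of `B` on which `A` vanishes:
  -- there `B - A` acts as `B` and stretches by at least the last nonzero singular value.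
  obtain ⟨c, hc0, hc⟩ := exists_mulVec_eq_zero_of_rank_lt (A * Z)
    (by simpa using (Matrix.rank_mul_le_left A Z).trans_lt h)
  set y : Fin n → ℝ := extendZero c with hydef
  have hy : Z *ᵥ c = W *ᵥ y := submatrix_castLE_mulVec W hr c
  have hyy : 0 < y ⬝ᵥ y := by
    refine (dotProduct_self_nonneg' y).lt_of_ne fun h0 => hc0 ?_
    have : y = 0 := dotProduct_self_eq_zero.1 h0.symm
    exact eq_zero_of_extendZero_eq_zero hr this
  have h1 : sv B (B.rank - 1) ^ 2 * (y ⬝ᵥ y) ≤ (B *ᵥ (W *ᵥ y)) ⬝ᵥ (B *ᵥ (W *ᵥ y)) := by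
    rw [right_singular_mulVec_sq hW hB, dotProduct, Finset.mul_sum]
    refine Finset.sum_le_sum fun i _ => ?_
    by_cases hi : (i : ℕ) < B.rank
    · exact mul_le_mul_of_nonneg_right
        (pow_le_pow_left₀ (sv_nonneg _ _) (sv_antitone B (by omega)) 2) (mul_self_nonneg _)
    · simp [hydef, extendZero, hi]
  have h2 : B *ᵥ (W *ᵥ y) = (B - A) *ᵥ (W *ᵥ y) := by
    rw [← hy, Matrix.sub_mulVec, Matrix.mulVec_mulVec _ A, hc, sub_zero]
  have h3 := mulVec_sq_le (B - A) (W *ᵥ y)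
  rw [← h2, mulVec_sq_of_orthonormal hW] at h3
  have h4 := le_of_mul_le_mul_right (h1.trans h3) hyy
  exact h4.trans (pow_le_pow_left₀ (opNorm_nonneg _) (opNorm_le_fro _) 2)

/-! ### Leading singular vectors -/

theorem of_ite_eq_diagonal {r : ℕ} (f : ℕ → ℝ) :
    (Matrix.of fun (i k : Fin r) => if (i : ℕ) = k then f i else 0) =
      Matrix.diagonal fun i : Fin r => f i := by
  ext i k
  simp [Matrix.diagonal_apply, Fin.ext_iff]

theorem of_ite_eq_diagonal' {r : ℕ} (f : ℕ → ℝ) :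
    (Matrix.of fun (k i : Fin r) => if (i : ℕ) = k then f i else 0) =
      Matrix.diagonal fun i : Fin r => f i := by
  ext i k
  by_cases h : i = k
  · simp [h]
  · have : ¬ (k : ℕ) = i := fun h' => h (Fin.ext h'.symm)
    simp [h, this]

theorem IsLeadingSVD.mul_right_diag {r : ℕ} {A : Matrix (Fin m) (Fin n) ℝ}
    {U : Matrix (Fin m) (Fin r) ℝ} {V : Matrix (Fin n) (Fin r) ℝ} (h : IsLeadingSVD A U V) :
    A * V = U * Matrix.diagonal fun i : Fin r => sv A i := by
  rw [h.mul_right, of_ite_eq_diagonal]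

theorem IsLeadingSVD.transpose_mul_left_diag {r : ℕ} {A : Matrix (Fin m) (Fin n) ℝ}
    {U : Matrix (Fin m) (Fin r) ℝ} {V : Matrix (Fin n) (Fin r) ℝ} (h : IsLeadingSVD A U V) :
    Aᵀ * U = V * Matrix.diagonal fun i : Fin r => sv A i := by
  rw [h.transpose_mul_left, of_ite_eq_diagonal']

/-- Take right singular vectors and define the left ones as `A V D⁻¹`, which is possible up to the
rank. The local revelation condition quantifies over all such pairs, so one pair must be exhibited
to use it. -/
theorem exists_isLeadingSVD_rank (A : Matrix (Fin m) (Fin n) ℝ) :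
    ∃ (U : Matrix (Fin m) (Fin A.rank) ℝ) (V : Matrix (Fin n) (Fin A.rank) ℝ),
      IsLeadingSVD A U V := by
  obtain ⟨W, hW, hW', hA⟩ := exists_right_singular A
  have hr : A.rank ≤ n := A.rank_le_width
  let V : Matrix (Fin n) (Fin A.rank) ℝ := W.submatrix id (Fin.castLE hr)
  let D : Matrix (Fin A.rank) (Fin A.rank) ℝ := Matrix.diagonal fun i => sv A i
  let D' : Matrix (Fin A.rank) (Fin A.rank) ℝ := Matrix.diagonal fun i => (sv A i)⁻¹
  have hpos : ∀ i : Fin A.rank, sv A i ≠ 0 := fun i => ((sv_pos_iff A i).2 i.2).ne'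
  have hD : D' * D = 1 := by
    rw [Matrix.diagonal_mul_diagonal, ← Matrix.diagonal_one]
    congr 1; ext i; exact inv_mul_cancel₀ (hpos i)
  have hD' : D * D' = 1 := mul_eq_one_comm.1 hD
  have hV : Vᵀ * V = 1 := by
    ext i k
    have := congrFun (congrFun hW (Fin.castLE hr i)) (Fin.castLE hr k)
    rw [Matrix.one_apply] at this ⊢
    simp only [Fin.ext_iff, Fin.val_castLE] at this ⊢
    exact this
  have hAV : Aᵀ * A * V = V * (D * D) := by
    ext i k
    have := congrFun (congrFun hA i) (Fin.castLE hr k)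
    rw [Matrix.mul_diagonal] at this
    rw [Matrix.diagonal_mul_diagonal, Matrix.mul_diagonal, ← pow_two]
    exact this
  refine ⟨A * V * D', V, ⟨?_, hV, ?_, ?_⟩⟩
  · have hDt : D'ᵀ = D' := Matrix.diagonal_transpose _
    calc (A * V * D')ᵀ * (A * V * D') = D' * (Vᵀ * (Aᵀ * A * V)) * D' := by
          simp only [Matrix.transpose_mul, hDt, Matrix.mul_assoc]
      _ = (D' * D) * (D * D') := by
          rw [hAV, ← Matrix.mul_assoc Vᵀ, hV, Matrix.one_mul]; simp only [Matrix.mul_assoc]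
      _ = 1 := by rw [hD, hD', Matrix.one_mul]
  · rw [of_ite_eq_diagonal]
    change A * V = A * V * D' * D
    rw [Matrix.mul_assoc _ D', hD, Matrix.mul_one]
  · rw [of_ite_eq_diagonal']
    change Aᵀ * (A * V * D') = V * D
    rw [← Matrix.mul_assoc, ← Matrix.mul_assoc, hAV, Matrix.mul_assoc, Matrix.mul_assoc D, hD',
      Matrix.mul_one]

end Singular

/-! ### Perturbation of leading singular subspaces -/

section Perturbation

variable {m n r : ℕ}

/-- If `A` has rank at most `r`, then away from the leading `r` right singular vectors the matrix
`A'` is bounded by the norm of `A' - A`. -/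
theorem IsLeadingSVD.mulVec_sq_le_of_orthogonal {A A' : Matrix (Fin m) (Fin n) ℝ}
    {U : Matrix (Fin m) (Fin r) ℝ} {V : Matrix (Fin n) (Fin r) ℝ} (h : IsLeadingSVD A' U V)
    (hr : A.rank ≤ r) {x : Fin n → ℝ} (hx : Vᵀ *ᵥ x = 0) :
    (A' *ᵥ x) ⬝ᵥ (A' *ᵥ x) ≤ opNorm (A' - A) ^ 2 * (x ⬝ᵥ x) := by
  classical
  set N := opNorm (A' - A) with hN
  have hN0 : 0 ≤ N := opNorm_nonneg _
  by_contra! hlt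
  -- The first index `t` where the singular values of `A'` have dropped to `N`, capped at `r`. Below
  -- it they all exceed `N`.
  have hex : ∃ t, r ≤ t ∨ sv A' t ≤ N := ⟨r, Or.inl le_rfl⟩
  set t := Nat.find hex with ht
  have ht_le : t ≤ r := Nat.find_min' hex (Or.inl le_rfl)
  have hbelow : ∀ i < t, N < sv A' i := fun i hi => by
    have := Nat.find_min hex hi
    push Not at this
    exact this.2
  let D : Matrix (Fin r) (Fin r) ℝ := Matrix.diagonal fun i => sv A' i
  have hAV : A' * V = U * D := h.mul_right_diag
  have hAU : A'ᵀ * U = V * D := h.transpose_mul_left_diag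
  -- Adjoin the supposed bad vector `x` to the leading `t` right singular vectors. On this span `A'`
  -- stretches every nonzero combination by more than `N`, which `key` records in contrapositive
  -- form.
  let Z : Matrix (Fin n) (Fin t ⊕ Unit) ℝ :=
    Matrix.fromCols (V.submatrix id (Fin.castLE ht_le)) (Matrix.replicateCol Unit x)
  have key : ∀ c : Fin t ⊕ Unit → ℝ,
      (A' *ᵥ (Z *ᵥ c)) ⬝ᵥ (A' *ᵥ (Z *ᵥ c)) ≤ N ^ 2 * ((Z *ᵥ c) ⬝ᵥ (Z *ᵥ c)) → c = 0 := by
    intro c hc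
    set y : Fin r → ℝ := extendZero (c ∘ Sum.inl) with hy
    set γ := c (Sum.inr ()) with hγ
    have hZ : Z *ᵥ c = V *ᵥ y + γ • x := by
      rw [Matrix.fromCols_mulVec, submatrix_castLE_mulVec]
      congr 1
      ext i
      simp [Matrix.mulVec, dotProduct, hγ, mul_comm]
    have h1 : (V *ᵥ y) ⬝ᵥ x = 0 := by
      rw [← Matrix.vecMul_transpose, ← Matrix.dotProduct_mulVec, hx, dotProduct_zero]
    -- The two-sided singular vector relations remove the cross term: `A'` keeps the orthogonality
    -- of `x` to the columns of `V`.
    have h2 : (A' *ᵥ (V *ᵥ y)) ⬝ᵥ (A' *ᵥ x) = 0 := by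
      rw [Matrix.mulVec_mulVec, hAV, ← Matrix.vecMul_transpose, ← Matrix.dotProduct_mulVec,
        Matrix.mulVec_mulVec]
      have : (U * D)ᵀ * A' = D * (D * Vᵀ) := by
        have hD : Dᵀ = D := Matrix.diagonal_transpose _
        rw [Matrix.transpose_mul, Matrix.mul_assoc, hD]
        congr 1
        have := congrArg Matrix.transpose hAU
        simpa [Matrix.transpose_mul, hD] using this
      rw [this, ← Matrix.mulVec_mulVec, ← Matrix.mulVec_mulVec, hx]
      simp
    have h3 : (V *ᵥ y) ⬝ᵥ (V *ᵥ y) = ∑ i, y i * y i :=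
      mulVec_sq_of_orthonormal h.right_orthonormal y
    have h4 : (A' *ᵥ (V *ᵥ y)) ⬝ᵥ (A' *ᵥ (V *ᵥ y)) = ∑ i : Fin r, sv A' i ^ 2 * (y i * y i) := by
      rw [Matrix.mulVec_mulVec, hAV, ← Matrix.mulVec_mulVec,
        mulVec_sq_of_orthonormal h.left_orthonormal]
      simp only [dotProduct, D, Matrix.mulVec_diagonal]
      exact Finset.sum_congr rfl fun i _ => by ring
    rw [hZ, Matrix.mulVec_add, Matrix.mulVec_smul] at hc
    simp only [add_dotProduct, dotProduct_add, smul_dotProduct, dotProduct_smul, smul_eq_mul,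
      dotProduct_comm x (V *ᵥ y), dotProduct_comm (A' *ᵥ x) (A' *ᵥ (V *ᵥ y)), h1, h2, h3, h4] at hc
    have hterm : ∀ i : Fin r, 0 ≤ (sv A' i ^ 2 - N ^ 2) * (y i * y i) := fun i => by
      by_cases hi : (i : ℕ) < t
      · have := pow_le_pow_left₀ hN0 (hbelow i hi).le 2
        exact mul_nonneg (by linarith) (mul_self_nonneg _)
      · simp [hy, extendZero, hi]
    have hsum : ∑ i : Fin r, (sv A' i ^ 2 - N ^ 2) * (y i * y i) +
        γ * γ * ((A' *ᵥ x) ⬝ᵥ (A' *ᵥ x) - N ^ 2 * (x ⬝ᵥ x)) ≤ 0 := by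
      simp only [sub_mul, Finset.sum_sub_distrib, ← Finset.mul_sum]
      nlinarith
    have hS := Finset.sum_nonneg fun i (_ : i ∈ Finset.univ) => hterm i
    have hγ0 : γ = 0 := by
      by_contra hne
      have := mul_pos (mul_self_pos.2 hne) (sub_pos.2 hlt)
      linarith
    have hS0 : ∑ i : Fin r, (sv A' i ^ 2 - N ^ 2) * (y i * y i) = 0 := by
      rw [hγ0] at hsum; linarith
    have hcl : c ∘ Sum.inl = 0 := by
      ext k
      have hk := (Finset.sum_eq_zero_iff_of_nonneg fun i _ => hterm i).1 hS0
        (Fin.castLE ht_le k) (Finset.mem_univ _)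
      have hpos : 0 < sv A' (k : ℕ) ^ 2 - N ^ 2 :=
        sub_pos.2 (pow_lt_pow_left₀ (hbelow k k.2) hN0 two_ne_zero)
      rcases mul_eq_zero.1 hk with hk | hk
      · exact absurd hk hpos.ne'
      · simpa [hy, extendZero] using mul_self_eq_zero.1 hk
    ext k
    rcases k with k | ⟨⟩
    · exact congrFun hcl k
    · exact hγ0
  -- The `t + 1` parameters give a contradiction either way: if `t` has reached `r`, some
  -- combination is killed by `A`, whose rank is at most `r`, so there `A'` equals `A' - A`;
  -- otherwise the min-max bound at index `t` gives a combination stretched by at most `N`.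
  rcases Nat.find_spec hex with hcase | hcase
  · obtain ⟨c, hc0, hc⟩ := exists_mulVec_eq_zero_of_rank_lt (A * Z) (by
      have := Matrix.rank_mul_le_left A Z
      simp only [Fintype.card_sum, Fintype.card_fin, Fintype.card_unit]
      omega)
    refine hc0 (key c ?_)
    have : A' *ᵥ (Z *ᵥ c) = (A' - A) *ᵥ (Z *ᵥ c) := by
      rw [Matrix.sub_mulVec, Matrix.mulVec_mulVec _ A, hc, sub_zero]
    rw [this]
    exact mulVec_sq_le _ _
  · obtain ⟨c, hc0, hc⟩ := exists_mulVec_sq_le_sv A' t Z (by simp)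
    refine hc0 (key c (hc.trans ?_))
    exact mul_le_mul_of_nonneg_right (pow_le_pow_left₀ (sv_nonneg _ _) hcase 2)
      (dotProduct_self_nonneg' _)

theorem IsLeadingSVD.opNorm_mul_one_sub_le {A A' : Matrix (Fin m) (Fin n) ℝ}
    {U : Matrix (Fin m) (Fin r) ℝ} {V : Matrix (Fin n) (Fin r) ℝ} (h : IsLeadingSVD A' U V)
    (hr : A.rank ≤ r) : opNorm (A' * (1 - V * Vᵀ)) ≤ opNorm (A' - A) := by
  refine opNorm_le_of_forall (opNorm_nonneg _) fun x => ?_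
  rw [← Matrix.mulVec_mulVec]
  refine (h.mulVec_sq_le_of_orthogonal hr ?_).trans
    (mul_le_mul_of_nonneg_left (one_sub_proj_mulVec_sq_le h.right_orthonormal x) (sq_nonneg _))
  rw [Matrix.mulVec_mulVec, Matrix.mul_sub, ← Matrix.mul_assoc, h.right_orthonormal]
  simp

/-- Both sides subtract the same truncated expansion `U D Vᵀ` from `A`. This converts bounds for
right projections into bounds for left ones. -/
theorem IsLeadingSVD.one_sub_mul {A : Matrix (Fin m) (Fin n) ℝ}
    {U : Matrix (Fin m) (Fin r) ℝ} {V : Matrix (Fin n) (Fin r) ℝ} (h : IsLeadingSVD A U V) :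
    (1 - U * Uᵀ) * A = A * (1 - V * Vᵀ) := by
  have h1 : Uᵀ * A = (Matrix.diagonal fun i : Fin r => sv A i) * Vᵀ := by
    have := congrArg Matrix.transpose h.transpose_mul_left_diag
    simpa [Matrix.transpose_mul] using this
  rw [Matrix.sub_mul, Matrix.mul_sub, Matrix.one_mul, Matrix.mul_one, Matrix.mul_assoc, h1,
    ← Matrix.mul_assoc, ← Matrix.mul_assoc, h.mul_right_diag]

/-- The factor 2 counts `A'` off its own leading vectors and the replacement of `A'` by `A`, each
costing at most the size of the perturbation. -/
theorem IsLeadingSVD.opNorm_right_le {A A' : Matrix (Fin m) (Fin n) ℝ}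
    {U : Matrix (Fin m) (Fin r) ℝ} {V : Matrix (Fin n) (Fin r) ℝ} (h : IsLeadingSVD A' U V)
    (hr : A.rank ≤ r) : opNorm (A * (1 - V * Vᵀ)) ≤ 2 * opNorm (A' - A) := by
  have h1 : A * (1 - V * Vᵀ) = A' * (1 - V * Vᵀ) - (A' - A) * (1 - V * Vᵀ) := by
    rw [← Matrix.sub_mul]; congr 1; abel
  have h2 := opNorm_mul_le (A' - A) (1 - V * Vᵀ)
  have h3 := mul_le_mul_of_nonneg_left (opNorm_one_sub_proj_le h.right_orthonormal)
    (opNorm_nonneg (A' - A))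
  rw [h1]
  linarith [opNorm_sub_le (A' * (1 - V * Vᵀ)) ((A' - A) * (1 - V * Vᵀ)),
    h.opNorm_mul_one_sub_le hr]

theorem IsLeadingSVD.opNorm_left_le {A A' : Matrix (Fin m) (Fin n) ℝ}
    {U : Matrix (Fin m) (Fin r) ℝ} {V : Matrix (Fin n) (Fin r) ℝ} (h : IsLeadingSVD A' U V)
    (hr : A.rank ≤ r) : opNorm ((1 - U * Uᵀ) * A) ≤ 2 * opNorm (A' - A) := by
  have h1 : (1 - U * Uᵀ) * A = (1 - U * Uᵀ) * A' - (1 - U * Uᵀ) * (A' - A) := by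
    rw [← Matrix.mul_sub]; congr 1; abel
  have h2 := opNorm_mul_le (1 - U * Uᵀ) (A' - A)
  have h3 := mul_le_mul_of_nonneg_right (opNorm_one_sub_proj_le h.left_orthonormal)
    (opNorm_nonneg (A' - A))
  have h4 := h.opNorm_mul_one_sub_le hr
  rw [← h.one_sub_mul] at h4
  rw [h1]
  linarith [opNorm_sub_le ((1 - U * Uᵀ) * A') ((1 - U * Uᵀ) * (A' - A))]

theorem opNorm_diagonal_le {c : ℝ} (hc : 0 ≤ c) {f : Fin r → ℝ} (hf : ∀ i, |f i| ≤ c) :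
    opNorm (Matrix.diagonal f) ≤ c := by
  refine opNorm_le_of_forall hc fun x => ?_
  simp only [dotProduct, Matrix.mulVec_diagonal, Finset.mul_sum]
  refine Finset.sum_le_sum fun i _ => ?_
  have : f i ^ 2 ≤ c ^ 2 := by
    rw [← sq_abs]; exact pow_le_pow_left₀ (abs_nonneg _) (hf i) 2
  nlinarith [mul_self_nonneg (x i)]

/-- A matrix whose row and column spaces are spanned by the singular vectors of `A` is almost
preserved by the projections on the leading singular vectors of a perturbation of `A`. -/
theorem IsLeadingSVD.fro_sub_proj_le {s : ℕ} {A A' M : Matrix (Fin m) (Fin n) ℝ}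
    {U : Matrix (Fin m) (Fin r) ℝ} {V : Matrix (Fin n) (Fin r) ℝ} (h : IsLeadingSVD A' U V)
    (hr : A.rank ≤ r) {U₀ : Matrix (Fin m) (Fin s) ℝ} {V₀ : Matrix (Fin n) (Fin s) ℝ}
    (h₀ : IsLeadingSVD A U₀ V₀) {c : ℝ} (hc : 0 < c) (hsv : ∀ i : Fin s, c ≤ sv A i)
    {Q : Matrix (Fin s) (Fin s) ℝ} (hM : M = U₀ * Q * V₀ᵀ) :
    fro (M - U * (Uᵀ * M * V) * Vᵀ) ≤ 4 * opNorm (A' - A) / c * fro M := by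
  let D' : Matrix (Fin s) (Fin s) ℝ := Matrix.diagonal fun i => (sv A i)⁻¹
  have hD : (Matrix.diagonal fun i : Fin s => sv A i) * D' = 1 := by
    rw [Matrix.diagonal_mul_diagonal, ← Matrix.diagonal_one]
    congr 1; ext i; exact mul_inv_cancel₀ (hc.trans_le (hsv i)).ne'
  have hD' : opNorm D' ≤ 1 / c := opNorm_diagonal_le (by positivity) fun i => by
    rw [abs_of_nonneg (inv_nonneg.2 (sv_nonneg _ _)), ← one_div]
    exact one_div_le_one_div_of_le hc (hsv i)
  have hDt : D'ᵀ = D' := Matrix.diagonal_transpose _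
  -- Writing the singular vectors as images of `A` and `Aᵀ` lets the bounds on `(1 - U Uᵀ) A` and `A
  -- (1 - V Vᵀ)` apply to `M`, at the price `1 / c` of inverting the singular values.
  have hU₀ : U₀ = A * (V₀ * D') := by
    rw [← Matrix.mul_assoc, h₀.mul_right_diag, Matrix.mul_assoc, hD, Matrix.mul_one]
  have hV₀ : V₀ᵀ = D' * U₀ᵀ * A := by
    have : V₀ = Aᵀ * (U₀ * D') := by
      rw [← Matrix.mul_assoc, h₀.transpose_mul_left_diag, Matrix.mul_assoc, hD, Matrix.mul_one]
    rw [this]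
    simp [Matrix.transpose_mul, hDt]
  have hQ : fro Q = fro M := by
    rw [hM, fro_mul_orthonormal_transpose h₀.right_orthonormal,
      fro_orthonormal_mul h₀.left_orthonormal]
  have hN := opNorm_nonneg (A' - A)
  have e1 : fro ((1 - U * Uᵀ) * M) ≤ 2 * opNorm (A' - A) / c * fro M := by
    have : (1 - U * Uᵀ) * M = (1 - U * Uᵀ) * A * (V₀ * (D' * Q) * V₀ᵀ) := by
      rw [hM]; nth_rewrite 1 [hU₀]; simp only [Matrix.mul_assoc]
    rw [this]
    refine (fro_mul_le _ _).trans ?_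
    rw [fro_mul_orthonormal_transpose h₀.right_orthonormal,
      fro_orthonormal_mul h₀.right_orthonormal]
    have h1 : fro (D' * Q) ≤ 1 / c * fro M :=
      (fro_mul_le _ _).trans (by rw [hQ]; exact mul_le_mul_of_nonneg_right hD' (fro_nonneg _))
    calc _ ≤ 2 * opNorm (A' - A) * (1 / c * fro M) :=
          mul_le_mul (h.opNorm_left_le hr) h1 (fro_nonneg _) (by positivity)
      _ = _ := by ring
  have e2 : fro (M * (1 - V * Vᵀ)) ≤ 2 * opNorm (A' - A) / c * fro M := by
    have : M * (1 - V * Vᵀ) = U₀ * (Q * D') * U₀ᵀ * (A * (1 - V * Vᵀ)) := by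
      rw [hM]; nth_rewrite 1 [hV₀]; simp only [Matrix.mul_assoc]
    rw [this]
    refine (fro_mul_le' _ _).trans ?_
    rw [fro_mul_orthonormal_transpose h₀.left_orthonormal,
      fro_orthonormal_mul h₀.left_orthonormal]
    have h1 : fro (Q * D') ≤ fro M * (1 / c) :=
      (fro_mul_le' _ _).trans (by rw [hQ]; exact mul_le_mul_of_nonneg_left hD' (fro_nonneg _))
    calc _ ≤ fro M * (1 / c) * (2 * opNorm (A' - A)) :=
          mul_le_mul h1 (h.opNorm_right_le hr) (opNorm_nonneg _)
            (mul_nonneg (fro_nonneg _) (by positivity))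
      _ = _ := by ring
  -- Telescoping M - PMQ = (1 - P)M + PM(1 - Q); each term contributes a factor 2 to the final 4.
  have hsplit : M - U * (Uᵀ * M * V) * Vᵀ =
      (1 - U * Uᵀ) * M + U * (Uᵀ * (M * (1 - V * Vᵀ))) := by
    simp only [Matrix.sub_mul, Matrix.mul_sub, Matrix.one_mul, Matrix.mul_one, Matrix.mul_assoc]
    abel
  have e3 : fro (U * (Uᵀ * (M * (1 - V * Vᵀ)))) ≤ fro (M * (1 - V * Vᵀ)) := by
    rw [fro_orthonormal_mul h.left_orthonormal]
    refine (fro_mul_le _ _).trans ?_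
    rw [opNorm_transpose]
    exact mul_le_of_le_one_left (fro_nonneg _) (opNorm_le_one_of_orthonormal h.left_orthonormal)
  rw [hsplit]
  refine (fro_add_le _ _).trans ?_
  calc _ ≤ 2 * opNorm (A' - A) / c * fro M + 2 * opNorm (A' - A) / c * fro M := by linarith
    _ = _ := by ring

end Perturbation

/-! ### Gram matrices -/

section Gram

theorem quadForm_eq_sum {ι : Type*} [Fintype ι] [DecidableEq ι] {A : Matrix ι ι ℝ}
    (hA : A.IsHermitian) (x : ι → ℝ) :
    x ⬝ᵥ (A *ᵥ x) = ∑ i, hA.eigenvalues i * inner ℝ (hA.eigenvectorBasis i) (WithLp.toLp 2 x) ^ 2 ∧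
      x ⬝ᵥ x = ∑ i, inner ℝ (hA.eigenvectorBasis i) (WithLp.toLp 2 x) ^ 2 := by
  set b := hA.eigenvectorBasis with hb
  have hdot : ∀ u v : ι → ℝ, u ⬝ᵥ v = inner ℝ (WithLp.toLp 2 u) (WithLp.toLp 2 v) := fun u v => by
    simp [PiLp.inner_apply, dotProduct, mul_comm]
  have hAt : Aᵀ = A := by
    rw [← Matrix.conjTranspose_eq_transpose_of_trivial]; exact hA
  constructor
  · rw [hdot, ← b.sum_inner_mul_inner]
    refine Finset.sum_congr rfl fun i _ => ?_
    have h1 : inner ℝ (b i) (WithLp.toLp 2 (A *ᵥ x)) =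
        hA.eigenvalues i * inner ℝ (b i) (WithLp.toLp 2 x) := by
      have h2 := hdot (b i).ofLp (A *ᵥ x)
      have h3 := hdot (b i).ofLp x
      simp only [WithLp.toLp_ofLp] at h2 h3
      rw [← h2, ← h3, Matrix.dotProduct_mulVec, ← Matrix.mulVec_transpose, hAt,
        hA.mulVec_eigenvectorBasis, smul_dotProduct, smul_eq_mul]
    rw [h1, real_inner_comm]; ring
  · rw [hdot, ← b.sum_inner_mul_inner]
    refine Finset.sum_congr rfl fun i _ => ?_
    rw [real_inner_comm]; ring

theorem le_quadForm {ι : Type*} [Fintype ι] [DecidableEq ι] {A : Matrix ι ι ℝ}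
    (hA : A.IsHermitian) {c : ℝ} (h : ∀ i, c ≤ hA.eigenvalues i) (x : ι → ℝ) :
    c * (x ⬝ᵥ x) ≤ x ⬝ᵥ (A *ᵥ x) := by
  rw [(quadForm_eq_sum hA x).1, (quadForm_eq_sum hA x).2, Finset.mul_sum]
  exact Finset.sum_le_sum fun i _ => mul_le_mul_of_nonneg_right (h i) (sq_nonneg _)

theorem quadForm_le {ι : Type*} [Fintype ι] [DecidableEq ι] {A : Matrix ι ι ℝ}
    (hA : A.IsHermitian) {c : ℝ} (h : ∀ i, hA.eigenvalues i ≤ c) (x : ι → ℝ) :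
    x ⬝ᵥ (A *ᵥ x) ≤ c * (x ⬝ᵥ x) := by
  rw [(quadForm_eq_sum hA x).1, (quadForm_eq_sum hA x).2, Finset.mul_sum]
  exact Finset.sum_le_sum fun i _ => mul_le_mul_of_nonneg_right (h i) (sq_nonneg _)

theorem natCast_mul_quadForm_gram {n : ℕ} (hn : 0 < n) {ι : Type*} [Fintype ι]
    (X : Matrix (Fin n) ι ℝ) (x : ι → ℝ) :
    (X *ᵥ x) ⬝ᵥ (X *ᵥ x) = n * (x ⬝ᵥ (gram X *ᵥ x)) := by
  have : (n : ℝ) ≠ 0 := by positivity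
  rw [gram, Matrix.smul_mulVec, dotProduct_smul, smul_eq_mul, mul_inv_cancel_left₀ this,
    ← Matrix.mulVec_mulVec, Matrix.dotProduct_mulVec, Matrix.mulVec_transpose, dotProduct_comm]

variable {n q d : ℕ}

/-- All eigenvalues of the Gram matrix lie in `[μ⁻¹, μ]`. -/
def GramBound (X : Matrix (Fin n) (Fin q) ℝ) (μ : ℝ) : Prop :=
  ∀ x, μ⁻¹ * (x ⬝ᵥ x) ≤ x ⬝ᵥ (gram X *ᵥ x) ∧ x ⬝ᵥ (gram X *ᵥ x) ≤ μ * (x ⬝ᵥ x)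

namespace GramBound

variable {X : Matrix (Fin n) (Fin q) ℝ} {μ : ℝ}

/-- Test both Gram bounds on a coordinate vector to get `μ⁻¹ ≤ μ`. So `1 ≤ μ` need not be assumed.
-/
theorem one_le (h : GramBound X μ) (hμ : 0 < μ) (hq : 0 < q) : 1 ≤ μ := by
  have := h (Pi.single ⟨0, hq⟩ 1)
  simp only [single_dotProduct, Pi.single_eq_same, mul_one] at this
  have h1 := this.1.trans this.2
  by_contra! hlt
  have := one_lt_inv₀ hμ |>.2 hlt
  linarith

theorem fro_mul_sq_le (h : GramBound X μ) (hn : 0 < n) (B : Matrix (Fin q) (Fin d) ℝ) :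
    fro (X * B) ^ 2 ≤ n * μ * fro B ^ 2 := by
  refine fro_sq_mul_le_of_forall (fun x => ?_) B
  rw [natCast_mul_quadForm_gram hn, mul_assoc]
  exact mul_le_mul_of_nonneg_left (h x).2 (by positivity)

theorem fro_mul_le (h : GramBound X μ) (hn : 0 < n) (hμ : 0 < μ) (B : Matrix (Fin q) (Fin d) ℝ) :
    fro (X * B) ≤ √(n * μ) * fro B := by
  refine le_of_sq_le_sq ?_ (mul_nonneg (Real.sqrt_nonneg _) (fro_nonneg _))
  rw [mul_pow, Real.sq_sqrt (by positivity)]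
  exact h.fro_mul_sq_le hn B

theorem opNorm_le (h : GramBound X μ) (hn : 0 < n) (hμ : 0 < μ) : opNorm X ≤ √(n * μ) := by
  refine opNorm_le_of_forall (Real.sqrt_nonneg _) fun x => ?_
  rw [Real.sq_sqrt (by positivity), natCast_mul_quadForm_gram hn, mul_assoc]
  exact mul_le_mul_of_nonneg_left (h x).2 (by positivity)

theorem opNorm_gram_le (h : GramBound X μ) (hn : 0 < n) (hμ : 0 < μ) : opNorm (gram X) ≤ μ := by
  have h1 : opNorm (Xᵀ * X) ≤ n * μ := by
    refine (opNorm_mul_le _ _).trans ?_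
    rw [opNorm_transpose, ← Real.mul_self_sqrt (show 0 ≤ (n : ℝ) * μ by positivity)]
    exact mul_self_le_mul_self (opNorm_nonneg _) (h.opNorm_le hn hμ)
  have h2 : opNorm (gram X) = (n : ℝ)⁻¹ * opNorm (Xᵀ * X) := by
    simp [gram, opNorm, norm_smul]
  rw [h2, inv_mul_le_iff₀ (by positivity)]
  exact h1

theorem isUnit_det (h : GramBound X μ) (hμ : 0 < μ) : IsUnit (gram X).det := by
  rw [isUnit_iff_ne_zero]
  intro h0
  obtain ⟨x, hx0, hx⟩ := Matrix.exists_mulVec_eq_zero_iff.2 h0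
  have h1 := (h x).1
  rw [hx, dotProduct_zero] at h1
  have h2 : 0 < x ⬝ᵥ x := (dotProduct_self_nonneg' x).lt_of_ne fun h' =>
    hx0 (dotProduct_self_eq_zero.1 h'.symm)
  have : 0 < μ⁻¹ * (x ⬝ᵥ x) := by positivity
  linarith

theorem gram_mul_inv (h : GramBound X μ) (hμ : 0 < μ) : gram X * (gram X)⁻¹ = 1 :=
  Matrix.mul_nonsing_inv _ (h.isUnit_det hμ)

theorem inv_mul_gram (h : GramBound X μ) (hμ : 0 < μ) : (gram X)⁻¹ * gram X = 1 :=
  Matrix.nonsing_inv_mul _ (h.isUnit_det hμ)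

/-- For y = Σ̂⁻¹x the lower Gram bound reads |y|² ≤ μ⟨y, x⟩, and Cauchy-Schwarz finishes. -/
theorem opNorm_inv_le (h : GramBound X μ) (hμ : 0 < μ) : opNorm (gram X)⁻¹ ≤ μ := by
  refine opNorm_le_of_forall hμ.le fun x => ?_
  set y := (gram X)⁻¹ *ᵥ x with hy
  have hx : gram X *ᵥ y = x := by
    rw [hy, Matrix.mulVec_mulVec, h.gram_mul_inv hμ, Matrix.one_mulVec]
  have h1 := (h y).1
  rw [hx, inv_mul_le_iff₀ hμ] at h1
  have h2 : (y ⬝ᵥ x) ^ 2 ≤ (y ⬝ᵥ y) * (x ⬝ᵥ x) := by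
    have := Finset.sum_mul_sq_le_sq_mul_sq Finset.univ y x
    simpa [dotProduct, pow_two] using this
  have hyy := dotProduct_self_nonneg' y
  rcases hyy.eq_or_lt with h0 | h0
  · rw [← h0]; exact mul_nonneg (sq_nonneg _) (dotProduct_self_nonneg' x)
  · have h3 : (y ⬝ᵥ y) * (y ⬝ᵥ y) ≤ (y ⬝ᵥ y) * (μ ^ 2 * (x ⬝ᵥ x)) := by
      calc (y ⬝ᵥ y) * (y ⬝ᵥ y) ≤ (μ * (y ⬝ᵥ x)) * (μ * (y ⬝ᵥ x)) := mul_self_le_mul_self hyy h1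
        _ = μ ^ 2 * (y ⬝ᵥ x) ^ 2 := by ring
        _ ≤ μ ^ 2 * ((y ⬝ᵥ y) * (x ⬝ᵥ x)) := mul_le_mul_of_nonneg_left h2 (sq_nonneg _)
        _ = _ := by ring
    exact le_of_mul_le_mul_left h3 h0

/-- Since XᵀX = nΣ̂, one inverse cancels and the squared norm is n⟨W, Σ̂⁻¹W⟩; this saves powers of μ
over bounding the factors separately. -/
theorem fro_mul_inv_mul_le (h : GramBound X μ) (hn : 0 < n) (hμ : 0 < μ)
    (W : Matrix (Fin q) (Fin d) ℝ) : fro (X * ((gram X)⁻¹ * W)) ≤ √(n * μ) * fro W := by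
  refine le_of_sq_le_sq ?_ (mul_nonneg (Real.sqrt_nonneg _) (fro_nonneg _))
  have hn' : (n : ℝ) ≠ 0 := by positivity
  have hXX : Xᵀ * X = (n : ℝ) • gram X := by rw [gram, smul_smul, mul_inv_cancel₀ hn', one_smul]
  rw [mul_pow, Real.sq_sqrt (by positivity), ← inn_self, inn_mul_right, ← Matrix.mul_assoc Xᵀ, hXX,
    Matrix.smul_mul, ← Matrix.mul_assoc, h.gram_mul_inv hμ, Matrix.one_mul, inn_smul_left, mul_assoc]
  refine mul_le_mul_of_nonneg_left ?_ (by positivity)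
  calc inn W ((gram X)⁻¹ * W) ≤ fro W * fro ((gram X)⁻¹ * W) := inn_le _ _
    _ ≤ fro W * (μ * fro W) := by
      refine mul_le_mul_of_nonneg_left ((TSRGA.fro_mul_le _ _).trans ?_) (fro_nonneg _)
      exact mul_le_mul_of_nonneg_right (h.opNorm_inv_le hμ) (fro_nonneg _)
    _ = μ * fro W ^ 2 := by ring

theorem fro_le_mul_fro_inv_mul (h : GramBound X μ) (hn : 0 < n) (hμ : 0 < μ)
    (W : Matrix (Fin q) (Fin d) ℝ) : fro W ≤ μ * fro ((gram X)⁻¹ * W) := by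
  have : W = gram X * ((gram X)⁻¹ * W) := by
    rw [← Matrix.mul_assoc, h.gram_mul_inv hμ, Matrix.one_mul]
  nth_rewrite 1 [this]
  exact (TSRGA.fro_mul_le _ _).trans
    (mul_le_mul_of_nonneg_right (h.opNorm_gram_le hn hμ) (fro_nonneg _))

end GramBound

theorem gramBound_of_eigenvalues {X : Matrix (Fin n) (Fin q) ℝ} {μ : ℝ}
    (h : ∀ i, μ⁻¹ ≤ (gram_isHermitian X).eigenvalues i ∧ (gram_isHermitian X).eigenvalues i ≤ μ) :
    GramBound X μ := fun x =>
  ⟨le_quadForm _ (fun i => (h i).1) x, quadForm_le _ (fun i => (h i).2) x⟩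

/-- Restricted strong convexity of the least squares criterion. -/
theorem le_fro_fitted_sq {p : ℕ} {q : Fin p → ℕ} (hn : 0 < n)
    {X : ∀ j, Matrix (Fin n) (Fin (q j)) ℝ} {J : Finset (Fin p)} {c : ℝ}
    (h : ∀ i, c < (gram_isHermitian (stack X J)).eigenvalues i)
    {C : ∀ j, Matrix (Fin (q j)) (Fin d) ℝ} (hC : ∀ j, j ∉ J → C j = 0) :
    n * c * ∑ j, fro (C j) ^ 2 ≤ fro (fitted X C) ^ 2 := by
  -- `x k` stacks the k-th columns of the blocks in `J`, so each column of the fit is the stacked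
  -- design applied to a vector.
  let x : Fin d → (Σ j : {j // j ∈ J}, Fin (q j)) → ℝ := fun k a => C a.1 a.2 k
  have hcol : ∀ k, (fitted X C).col k = stack X J *ᵥ x k := fun k => by
    ext t
    simp only [Matrix.col_apply, fitted, Matrix.sum_apply, Matrix.mulVec, dotProduct, stack,
      Matrix.of_apply, x, Fintype.sum_sigma]
    rw [← Finset.sum_subset (Finset.subset_univ J), ← Finset.sum_coe_sort J]
    · rfl
    · intro j _ hj; simp [hC j hj]
  have hx : ∀ k, x k ⬝ᵥ x k = ∑ j, (C j).col k ⬝ᵥ (C j).col k := fun k => by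
    simp only [dotProduct, x, Fintype.sum_sigma]
    rw [← Finset.sum_subset (Finset.subset_univ J), ← Finset.sum_coe_sort J]
    · rfl
    · intro j _ hj; simp [hC j hj]
  have hsum : ∑ j, fro (C j) ^ 2 = ∑ k, x k ⬝ᵥ x k := by
    simp only [fro_sq_eq_cols, hx]
    exact Finset.sum_comm
  rw [hsum, fro_sq_eq_cols, Finset.mul_sum]
  refine Finset.sum_le_sum fun k _ => ?_
  rw [hcol, natCast_mul_quadForm_gram hn, mul_assoc]
  exact mul_le_mul_of_nonneg_left (le_quadForm _ (fun i => (h i).le) _) (by positivity)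

end Gram

/-! ### Relaxed greedy paths -/

/-- A sequence of fits `G k` that moves from `G k` towards `A k` with optimal step length. -/
structure GreedyPath {n d : ℕ} (Y : Matrix (Fin n) (Fin d) ℝ) (G A : ℕ → Matrix (Fin n) (Fin d) ℝ)
    (lam : ℕ → ℝ) : Prop where
  zero : G 0 = 0
  succ : ∀ k, G (k + 1) = (1 - lam k) • G k + lam k • A k
  mem : ∀ k, lam k ∈ Set.Icc (0 : ℝ) 1
  min : ∀ k, ∀ l ∈ Set.Icc (0 : ℝ) 1,
    frobSq (Y - (1 - lam k) • G k - lam k • A k) ≤ frobSq (Y - (1 - l) • G k - l • A k)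

namespace GreedyPath

variable {n d : ℕ} {Y : Matrix (Fin n) (Fin d) ℝ} {G A : ℕ → Matrix (Fin n) (Fin d) ℝ}
  {lam : ℕ → ℝ}

theorem residual_sq_le (h : GreedyPath Y G A lam) (k : ℕ) {l : ℝ} (hl : l ∈ Set.Icc (0 : ℝ) 1) :
    fro (Y - G (k + 1)) ^ 2 ≤ fro (Y - G k - l • (A k - G k)) ^ 2 := by
  have h1 : Y - (1 - lam k) • G k - lam k • A k = Y - G (k + 1) := by rw [h.succ]; abel
  have h2 : Y - (1 - l) • G k - l • A k = Y - G k - l • (A k - G k) := by module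
  have := h.min k l hl
  rwa [h1, h2, frobSq_eq, frobSq_eq] at this

theorem residual_sq_succ_le (h : GreedyPath Y G A lam) (k : ℕ) :
    fro (Y - G (k + 1)) ^ 2 ≤ fro (Y - G k) ^ 2 := by
  simpa using h.residual_sq_le k (l := 0) (by simp)

theorem residual_sq_antitone (h : GreedyPath Y G A lam) :
    Antitone fun k => fro (Y - G k) ^ 2 :=
  antitone_nat_of_succ_le h.residual_sq_succ_le

/-- The decrease of the residual in one step. -/
theorem residual_sq_le_sub_min (h : GreedyPath Y G A lam) (k : ℕ) {a b : ℝ} (ha : 0 ≤ a)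
    (hb : 0 < b) (hab : a ≤ inn (Y - G k) (A k - G k)) (hfro : fro (A k - G k) ^ 2 ≤ b) :
    fro (Y - G (k + 1)) ^ 2 ≤ fro (Y - G k) ^ 2 - Min.min a (a ^ 2 / b) := by
  have key : ∀ l ∈ Set.Icc (0 : ℝ) 1,
      fro (Y - G (k + 1)) ^ 2 ≤ fro (Y - G k) ^ 2 - 2 * l * a + l ^ 2 * b := fun l hl => by
    have h1 := h.residual_sq_le k hl
    rw [fro_sq_sub (Y - G k), inn_smul_right, fro_smul, mul_pow, sq_abs] at h1
    have h2 := mul_le_mul_of_nonneg_left hab hl.1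
    have h3 := mul_le_mul_of_nonneg_left hfro (sq_nonneg l)
    linarith
  -- The bound is a parabola in the step length with vertex at `a / b`; if the vertex lies beyond 1,
  -- the full step is used.
  rcases le_total b a with hba | hba
  · have := key 1 (by simp)
    have h2 := min_le_left a (a ^ 2 / b)
    linarith
  · have := key (a / b) ⟨by positivity, (div_le_one hb).2 hba⟩
    have h2 := min_le_right a (a ^ 2 / b)
    have h3 : 2 * (a / b) * a = 2 * (a ^ 2 / b) := by ring
    have h4 : (a / b) ^ 2 * b = a ^ 2 / b := by field_simp
    linarith

/-- Each fit is a convex combination of 0 and the earlier atoms, so it inherits every convex bound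
that they satisfy. -/
theorem fro_le (h : GreedyPath Y G A lam) {β : ℝ} (hβ : 0 ≤ β) (hA : ∀ k, fro (A k) ≤ β) (k : ℕ) :
    fro (G k) ≤ β := by
  induction k with
  | zero => rw [h.zero, fro_zero]; exact hβ
  | succ k ih =>
    obtain ⟨h0, h1⟩ := h.mem k
    rw [h.succ]
    refine (fro_add_le _ _).trans ?_
    rw [fro_smul, fro_smul, abs_of_nonneg h0, abs_of_nonneg (sub_nonneg.2 h1)]
    nlinarith [mul_le_mul_of_nonneg_left ih (sub_nonneg.2 h1),
      mul_le_mul_of_nonneg_left (hA k) h0]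

theorem abs_inn_le (h : GreedyPath Y G A lam) {Z : Matrix (Fin n) (Fin d) ℝ} {c : ℝ} (hc : 0 ≤ c)
    (hA : ∀ k, |inn Z (A k)| ≤ c) (k : ℕ) : |inn Z (G k)| ≤ c := by
  induction k with
  | zero => rw [h.zero, inn_zero_right, abs_zero]; exact hc
  | succ k ih =>
    obtain ⟨h0, h1⟩ := h.mem k
    rw [h.succ, inn_add_right, inn_smul_right, inn_smul_right]
    refine (abs_add_le _ _).trans ?_
    rw [abs_mul, abs_mul, abs_of_nonneg h0, abs_of_nonneg (sub_nonneg.2 h1)]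
    nlinarith [mul_le_mul_of_nonneg_left ih (sub_nonneg.2 h1),
      mul_le_mul_of_nonneg_left (hA k) h0]

theorem fro_direction_sq_le (h : GreedyPath Y G A lam) {β : ℝ} (hβ : 0 ≤ β)
    (hA : ∀ k, fro (A k) ≤ β) (k : ℕ) : fro (A k - G k) ^ 2 ≤ 4 * β ^ 2 := by
  have h1 := fro_sub_le (A k) (G k)
  have h2 := h.fro_le hβ hA k
  have h3 := hA k
  calc fro (A k - G k) ^ 2 ≤ (2 * β) ^ 2 := pow_le_pow_left₀ (fro_nonneg _) (by linarith) 2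
    _ = _ := by ring

end GreedyPath

/-! ### Linearity of the fit -/

section Fit

variable {n p d : ℕ} {q : Fin p → ℕ} (X : ∀ j, Matrix (Fin n) (Fin (q j)) ℝ)

theorem fitted_add (B C : ∀ j, Matrix (Fin (q j)) (Fin d) ℝ) :
    fitted X (B + C) = fitted X B + fitted X C := by
  simp [fitted, Matrix.mul_add, Finset.sum_add_distrib]

theorem fitted_sub (B C : ∀ j, Matrix (Fin (q j)) (Fin d) ℝ) :
    fitted X (B - C) = fitted X B - fitted X C := by
  simp [fitted, Matrix.mul_sub, Finset.sum_sub_distrib]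

theorem fitted_smul (c : ℝ) (B : ∀ j, Matrix (Fin (q j)) (Fin d) ℝ) :
    fitted X (c • B) = c • fitted X B := by
  simp [fitted, Finset.smul_sum]

theorem fitted_zero : fitted X (0 : ∀ j, Matrix (Fin (q j)) (Fin d) ℝ) = 0 := by
  simp [fitted]

theorem fitted_single (j : Fin p) (M : Matrix (Fin (q j)) (Fin d) ℝ) :
    fitted X (Pi.single j M : ∀ j, Matrix (Fin (q j)) (Fin d) ℝ) = X j * M := by
  rw [fitted, Finset.sum_eq_single j]
  · simp
  · intro k _ hk; simp [Pi.single_eq_of_ne hk]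
  · simp

theorem opNorm_le_noiseSize (E : Matrix (Fin n) (Fin d) ℝ) (j : Fin p) :
    opNorm ((X j)ᵀ * E) ≤ noiseSize X E :=
  le_ciSup (f := fun j => opNorm ((X j)ᵀ * E)) (Set.finite_range _).bddAbove j

theorem noiseSize_nonneg (E : Matrix (Fin n) (Fin d) ℝ) : 0 ≤ noiseSize X E :=
  Real.iSup_nonneg fun _ => opNorm_nonneg _

theorem abs_inn_noise_le (E : Matrix (Fin n) (Fin d) ℝ) (j : Fin p)
    (B : Matrix (Fin (q j)) (Fin d) ℝ) : |inn E (X j * B)| ≤ noiseSize X E * nuc B := by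
  rw [inn_mul_right]
  exact (abs_inn_le_opNorm_mul_nuc _ _).trans
    (mul_le_mul_of_nonneg_right (opNorm_le_noiseSize X E j) (nuc_nonneg _))

theorem abs_inn_noise_fitted_le (E : Matrix (Fin n) (Fin d) ℝ)
    (B : ∀ j, Matrix (Fin (q j)) (Fin d) ℝ) :
    |inn E (fitted X B)| ≤ noiseSize X E * ∑ j, nuc (B j) := by
  rw [fitted, inn_sum_right, Finset.mul_sum]
  exact (Finset.abs_sum_le_sum_abs _ _).trans (Finset.sum_le_sum fun j _ => abs_inn_noise_le X E j _)

theorem fro_fitted_le {μ : ℝ} (hn : 0 < n) (hμ : 0 < μ) (hX : ∀ j, GramBound (X j) μ)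
    (B : ∀ j, Matrix (Fin (q j)) (Fin d) ℝ) :
    fro (fitted X B) ≤ √(n * μ) * ∑ j, nuc (B j) := by
  rw [fitted, Finset.mul_sum]
  refine (fro_sum_le _ _).trans (Finset.sum_le_sum fun j _ => ?_)
  exact ((hX j).fro_mul_le hn hμ _).trans
    (mul_le_mul_of_nonneg_left (fro_le_nuc _) (Real.sqrt_nonneg _))

end Fit

/-! ### First stage -/

namespace FirstStage

variable {n p d : ℕ} {q : Fin p → ℕ} {X : ∀ j, Matrix (Fin n) (Fin (q j)) ℝ}
  {Y : Matrix (Fin n) (Fin d) ℝ} {Ln : ℝ} {R : FirstStage q d}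

theorem IsRGA.greedyPath (h : R.IsRGA X Y Ln) :
    GreedyPath Y (R.fit X) (fun k => X (R.idx k) * R.atom k) R.lam where
  zero := by simp [fit, coef, fitted_zero]
  succ k := by
    simp only [fit]
    rw [coef, fitted_add, fitted_smul, fitted_smul, fitted_single]
  mem := h.lam_mem
  min := h.lam_min

/-- The selected atom is at least as correlated with the residual as any fit whose total nuclear
norm is within the bound. -/
theorem IsRGA.inn_fitted_le (h : R.IsRGA X Y Ln) (hLn : 0 < Ln) (k : ℕ)
    {B : ∀ j, Matrix (Fin (q j)) (Fin d) ℝ} (hB : ∑ j, nuc (B j) ≤ Ln) :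
    inn (Y - R.fit X k) (fitted X B) ≤ inn (Y - R.fit X k) (X (R.idx k) * R.atom k) := by
  set a := inn (Y - R.fit X k) (X (R.idx k) * R.atom k) with ha
  -- Maximality over the whole nuclear norm ball is a bound on the dual norm, uniform in `j`; this
  -- passes from single atoms to sums over predictors.
  have h1 : ∀ j, Ln * opNorm ((X j)ᵀ * (Y - R.fit X k)) ≤ a := fun j =>
    mul_opNorm_le_of_forall hLn fun B hB => by
      rw [← inn_mul_right]; exact h.atom_max k j B hB
  have ha0 : 0 ≤ a :=
    (mul_nonneg hLn.le (opNorm_nonneg _)).trans (h1 (R.idx k))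
  rw [fitted, inn_sum_right]
  have h2 : ∀ j, inn (Y - R.fit X k) (X j * B j) ≤ a / Ln * nuc (B j) := fun j => by
    rw [inn_mul_right]
    refine (inn_le_opNorm_mul_nuc _ _).trans (mul_le_mul_of_nonneg_right ?_ (nuc_nonneg _))
    rw [le_div_iff₀ hLn, mul_comm]; exact h1 j
  calc _ ≤ ∑ j, a / Ln * nuc (B j) := Finset.sum_le_sum fun j _ => h2 j
    _ = a / Ln * ∑ j, nuc (B j) := by rw [Finset.mul_sum]
    _ ≤ a / Ln * Ln := mul_le_mul_of_nonneg_left hB (by positivity)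
    _ = a := by field_simp

theorem coef_eq_zero_of_notMem_selected (R : FirstStage q d) {k : ℕ} {j : Fin p}
    (hj : j ∉ R.selected k) : R.coef k j = 0 := by
  induction k with
  | zero => rfl
  | succ k ih =>
    have h1 : j ∉ R.selected k := fun h => hj (by
      simp only [selected, Finset.mem_image, Finset.mem_range] at h ⊢
      obtain ⟨i, hi, hij⟩ := h
      exact ⟨i, by omega, hij⟩)
    have h2 : j ≠ R.idx k := fun h => hj (by
      simp only [selected, Finset.mem_image, Finset.mem_range]
      exact ⟨k, by omega, h.symm⟩)
    simp [coef, ih h1, Pi.single_eq_of_ne h2]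

theorem card_selected_le (R : FirstStage q d) (k : ℕ) : (R.selected k).card ≤ k :=
  Finset.card_image_le.trans (by simp)

theorem sigmaSq_eq (R : FirstStage q d) (k : ℕ) :
    R.sigmaSq X Y k = ((n : ℝ) * d)⁻¹ * fro (Y - R.fit X k) ^ 2 := by
  rw [sigmaSq, frobSq_eq]

theorem kHat_le (R : FirstStage q d) (K : ℕ) (t : ℝ) : R.kHat X Y K t ≤ K := by
  classical
  unfold kHat
  split_ifs with h
  · exact (Nat.find_spec h).2.1
  · exact le_rfl

/-- Either the residual hardly decreases in the last step before stopping, or it has decreased by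
a constant factor in all `K` steps. -/
theorem IsRGA.kHat_cases (h : R.IsRGA X Y Ln) (hn : 0 < n) (hd : 0 < d) (K : ℕ) (t : ℝ) :
    (∃ k, R.kHat X Y K t = k + 1 ∧
      (1 - t) * fro (Y - R.fit X k) ^ 2 ≤ fro (Y - R.fit X (k + 1)) ^ 2) ∨
    (R.kHat X Y K t = K ∧
      fro (Y - R.fit X K) ^ 2 ≤ Real.exp (-(K * t)) * fro Y ^ 2) := by
  classical
  have hT : (0 : ℝ) < ((n : ℝ) * d)⁻¹ := by positivity
  have hpath := h.greedyPath
  have hfit0 : R.fit X 0 = 0 := hpath.zero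
  unfold kHat
  split_ifs with hex
  · left
    obtain ⟨h1, -, h3⟩ := Nat.find_spec hex
    obtain ⟨k, hk⟩ : ∃ k, Nat.find hex = k + 1 := ⟨Nat.find hex - 1, by omega⟩
    refine ⟨k, hk, ?_⟩
    rw [hk, Nat.add_sub_cancel, sigmaSq_eq, sigmaSq_eq, mul_div_mul_left _ _ hT.ne'] at h3
    rcases (sq_nonneg (fro (Y - R.fit X k))).eq_or_lt with h0 | h0
    · rw [← h0]; simp [sq_nonneg]
    · rwa [le_div_iff₀ h0] at h3
  · right
    refine ⟨rfl, ?_⟩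
    push Not at hex
    have hstep : ∀ k < K, 0 ≤ 1 - t ∧
        fro (Y - R.fit X (k + 1)) ^ 2 ≤ (1 - t) * fro (Y - R.fit X k) ^ 2 := fun k hk => by
      have h1 := hex (k + 1) (by omega) hk
      rw [Nat.add_sub_cancel, sigmaSq_eq, sigmaSq_eq, mul_div_mul_left _ _ hT.ne'] at h1
      -- A nonnegative ratio lies below `1 - t`, so `t ≤ 1` comes for free. The default value 0 of a
      -- ratio with zero denominator is harmless here.
      have ht : 0 ≤ 1 - t := (div_nonneg (sq_nonneg _) (sq_nonneg _)).trans h1.le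
      refine ⟨ht, ?_⟩
      rcases (sq_nonneg (fro (Y - R.fit X k))).eq_or_lt with h0 | h0
      · have := hpath.residual_sq_succ_le k
        rw [← h0] at this ⊢
        simpa using this
      · rw [div_lt_iff₀ h0] at h1; exact h1.le
    have hind : ∀ k ≤ K, fro (Y - R.fit X k) ^ 2 ≤ Real.exp (-(k * t)) * fro Y ^ 2 := by
      intro k
      induction k with
      | zero => intro _; simp [hfit0]
      | succ k ih =>
        intro hk
        obtain ⟨ht, h2⟩ := hstep k (by omega)
        refine h2.trans ?_
        have h3 : 1 - t ≤ Real.exp (-t) := by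
          have := Real.add_one_le_exp (-t); linarith
        calc (1 - t) * fro (Y - R.fit X k) ^ 2
            ≤ Real.exp (-t) * (Real.exp (-(k * t)) * fro Y ^ 2) :=
              mul_le_mul h3 (ih (by omega)) (sq_nonneg _) (Real.exp_pos _).le
          _ = Real.exp (-((k + 1 : ℕ) * t)) * fro Y ^ 2 := by
            rw [← mul_assoc, ← Real.exp_add]; congr 2; push_cast; ring
    exact hind K le_rfl

end FirstStage

/-! ### Sure screening by the stopped first stage -/

section Screening

variable {n p d : ℕ} {q : Fin p → ℕ} {X : ∀ j, Matrix (Fin n) (Fin (q j)) ℝ}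
  {B : ∀ j, Matrix (Fin (q j)) (Fin d) ℝ} {E : Matrix (Fin n) (Fin d) ℝ}

theorem rank_smul_eq {m n : ℕ} {c : ℝ} (hc : c ≠ 0) (A : Matrix (Fin m) (Fin n) ℝ) :
    (c • A).rank = A.rank := by
  have h : ∀ (c : ℝ) (A : Matrix (Fin m) (Fin n) ℝ), (c • A).rank ≤ A.rank := fun c A => by
    have : c • A = (c • (1 : Matrix (Fin m) (Fin m) ℝ)) * A := by simp
    rw [this]; exact Matrix.rank_mul_le_right _ _
  refine le_antisymm (h c A) ?_
  simpa [smul_smul, inv_mul_cancel₀ hc] using h c⁻¹ (c • A)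

theorem rank_pos_of_ne_zero {m n : ℕ} {A : Matrix (Fin m) (Fin n) ℝ} (hA : A ≠ 0) :
    0 < A.rank := by
  refine Nat.pos_of_ne_zero fun h => hA (fro_eq_zero (le_antisymm ?_ (fro_nonneg A)))
  refine (fro_le_nuc A).trans_eq (Finset.sum_eq_zero fun i _ => sv_eq_zero_of_rank_le ?_)
  omega

/-- The low-rank distance bound with the scaling by √d undone. With `A = 0` it also bounds each
relevant coefficient matrix from below. -/
theorem mul_inv_le_fro_sub_sq {m : ℕ} (hd : 0 < d) {A B : Matrix (Fin m) (Fin d) ℝ} {w : ℝ}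
    (hw : w ≤ sv ((√(d : ℝ))⁻¹ • B) (B.rank - 1) ^ 2) (h : A.rank < B.rank) :
    d * w ≤ fro (B - A) ^ 2 := by
  have hd' : (0 : ℝ) < d := by positivity
  have hc : (√(d : ℝ))⁻¹ ≠ 0 := by positivity
  have h1 := sv_sq_le_fro_sub_sq (A := (√(d : ℝ))⁻¹ • A) (B := (√(d : ℝ))⁻¹ • B)
    (by rwa [rank_smul_eq hc, rank_smul_eq hc])
  rw [rank_smul_eq hc, ← smul_sub, fro_smul, mul_pow, sq_abs, inv_pow, Real.sq_sqrt hd'.le] at h1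
  have h2 := hw.trans h1
  rwa [← div_eq_inv_mul, le_div_iff₀ hd', mul_comm] at h2

/-- Truth and fit both lie in the hull of atoms of nuclear norm √d L₀, and duality bounds the noise
on each of them. -/
theorem abs_inn_noise_error_le {L₀ : ℝ} (hL₀ : 0 < L₀) (hB : ∑ j, nuc (B j) ≤ √d * L₀)
    {Y : Matrix (Fin n) (Fin d) ℝ} {R : FirstStage q d} (hR : R.IsRGA X Y (√d * L₀)) (k : ℕ) :
    |inn E (fitted X B - R.fit X k)| ≤ 2 * noiseSize X E * (√d * L₀) := by
  have h0 := noiseSize_nonneg X E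
  have h1 : |inn E (fitted X B)| ≤ noiseSize X E * (√d * L₀) :=
    (abs_inn_noise_fitted_le X E B).trans (mul_le_mul_of_nonneg_left hB h0)
  have h2 : |inn E (R.fit X k)| ≤ noiseSize X E * (√d * L₀) :=
    hR.greedyPath.abs_inn_le (by positivity) (fun k => (abs_inn_noise_le X E _ _).trans
      (mul_le_mul_of_nonneg_left (hR.atom_le k) h0)) k
  rw [inn_sub_right]
  have := abs_sub (inn E (fitted X B)) (inn E (R.fit X k))
  linarith

/-- The number of relevant predictors is controlled by the total nuclear norm. -/
theorem card_relevant_le (hd : 0 < d) {L₀ w : ℝ} (hL₀ : 0 < L₀) (hw : 0 < w)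
    (hB : ∑ j, nuc (B j) ≤ √d * L₀)
    (hsv : ∀ j ∈ relevant B, w ≤ sv ((√(d : ℝ))⁻¹ • B j) ((B j).rank - 1) ^ 2)
    {S : Finset (Fin p)} (hS : ∀ j ∈ S, j ∈ relevant B) :
    S.card * w ^ 2 ≤ L₀ ^ 4 ∧ (S.Nonempty → w ≤ L₀ ^ 2) := by
  have hd' : (0 : ℝ) < √d := by positivity
  have hnuc : ∀ j, nuc (B j) ≤ √d * L₀ := fun j =>
    (Finset.single_le_sum (f := fun j => nuc (B j)) (fun j _ => nuc_nonneg _)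
      (Finset.mem_univ j)).trans hB
  have h1 : ∀ j ∈ S, √d * √d * w ≤ nuc (B j) ^ 2 := fun j hj => by
    have := mul_inv_le_fro_sub_sq (A := 0) hd (hsv j (hS j hj))
      (by rw [Matrix.rank_zero]; exact rank_pos_of_ne_zero (hS j hj))
    rw [sub_zero] at this
    rw [Real.mul_self_sqrt (by positivity)]
    exact this.trans (pow_le_pow_left₀ (fro_nonneg _) (fro_le_nuc _) 2)
  have hwL : ∀ j ∈ S, w ≤ L₀ ^ 2 := fun j hj => by
    have h2 : nuc (B j) ^ 2 ≤ (√d * L₀) ^ 2 := pow_le_pow_left₀ (nuc_nonneg _) (hnuc j) 2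
    have h3 : √d * √d * w ≤ √d * √d * L₀ ^ 2 := (h1 j hj).trans (h2.trans_eq (by ring))
    exact le_of_mul_le_mul_left h3 (by positivity)
  refine ⟨?_, fun ⟨j, hj⟩ => hwL j hj⟩
  -- One factor of the squared nuclear norm is replaced by its upper bound, leaving an inequality
  -- linear in `nuc (B j)` that can be summed against the total nuclear norm.
  have h4 : ∀ j ∈ S, √d * w ≤ L₀ * nuc (B j) := fun j hj => by
    have h5 : √d * (√d * w) ≤ √d * (L₀ * nuc (B j)) := by
      nlinarith [h1 j hj, mul_le_mul_of_nonneg_right (hnuc j) (nuc_nonneg (B j))]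
    exact le_of_mul_le_mul_left h5 hd'
  have h6 : S.card * (√d * w) ≤ L₀ * (√d * L₀) := by
    calc S.card * (√d * w) = ∑ j ∈ S, √d * w := by simp
      _ ≤ ∑ j ∈ S, L₀ * nuc (B j) := Finset.sum_le_sum h4
      _ = L₀ * ∑ j ∈ S, nuc (B j) := by rw [Finset.mul_sum]
      _ ≤ L₀ * (√d * L₀) := by
        refine mul_le_mul_of_nonneg_left (le_trans ?_ hB) hL₀.le
        exact Finset.sum_le_sum_of_subset_of_nonneg (Finset.subset_univ _)
          fun j _ _ => nuc_nonneg _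
  have h7 : S.card * w ≤ L₀ ^ 2 := by
    refine le_of_mul_le_mul_left (?_ : √d * (S.card * w) ≤ √d * L₀ ^ 2) hd'
    nlinarith
  rcases S.eq_empty_or_nonempty with rfl | ⟨j, hj⟩
  · simp; positivity
  · have h8 := hwL j hj
    calc S.card * w ^ 2 = (S.card * w) * w := by ring
      _ ≤ L₀ ^ 2 * L₀ ^ 2 := mul_le_mul h7 h8 hw.le (by positivity)
      _ = L₀ ^ 4 := by ring

/-- Sure screening: if the noise is small compared to the signal, the stopped first stage finds
every relevant predictor, with a coefficient matrix of sufficient rank. -/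
theorem rank_le_rank_coef_kHat {μ L₀ Mo C s η : ℝ} {K : ℕ} (hn : 0 < n) (hd : 0 < d)
    (hμ : 1 ≤ μ) (hL₀ : 0 < L₀) (hMo : 0 < Mo) (hC : 0 < C)
    (hC₀ : C * (64 * μ ^ 3 * L₀ ^ 2 * (Mo + μ * L₀ ^ 2)) ≤ 1) (hs : 0 < s)
    (hX : ∀ j, GramBound (X j) μ)
    (hJ : ∀ J : Finset (Fin p), J.card ≤ 2 * K →
      ∀ i, μ⁻¹ < (gram_isHermitian (stack X J)).eigenvalues i)
    (hE₁ : Mo⁻¹ * (n * d) ≤ fro E ^ 2) (hE₂ : fro E ^ 2 ≤ Mo * (n * d))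
    (hB : ∑ j, nuc (B j) ≤ √d * L₀)
    (hsv : ∀ j ∈ relevant B, s⁻¹ ≤ sv ((√(d : ℝ))⁻¹ • B j) ((B j).rank - 1) ^ 2)
    (hsK : L₀ ^ 4 * s ^ 2 ≤ K) (hsK' : 8 * Mo * (Mo + μ * L₀ ^ 2) * s ^ 2 ≤ C * K)
    (hη : 0 ≤ η) (hη₁ : 10 * μ * L₀ ^ 2 * η ≤ 1) (hη₂ : 4 * Mo * L₀ ^ 4 * η ≤ 1)
    (hξ : 2 * noiseSize X E * (√d * L₀) ≤ η * (n * d) * (s ^ 2)⁻¹)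
    {R : FirstStage q d} (hR : R.IsRGA X (response X B E) (√d * L₀)) :
    ∀ j ∈ relevant B,
      (B j).rank ≤ (R.coef (R.kHat X (response X B E) K (C * (s ^ 2)⁻¹)) j).rank := by
  classical
  intro j₀ hj₀
  by_contra! hlt
  have hμ0 : 0 < μ := by linarith
  have hn' : (0 : ℝ) < n := by positivity
  have hd' : (0 : ℝ) < d := by positivity
  have hLn : 0 < √d * L₀ := by positivity
  set w := s⁻¹ with hw
  have hw0 : 0 < w := by positivity
  have hsw : s * w = 1 := mul_inv_cancel₀ hs.ne'
  have hw2 : (s ^ 2)⁻¹ = w ^ 2 := by rw [hw, inv_pow]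
  rw [hw2] at hξ hlt
  set T : ℝ := n * d with hT
  have hT0 : 0 < T := by positivity
  set Y := response X B E with hY
  have hpath := hR.greedyPath
  set N := 2 * noiseSize X E * (√d * L₀) with hN
  set Jn : Finset (Fin p) := Finset.univ.filter fun j => j ∈ relevant B with hJn
  obtain ⟨hcard, hwL⟩ := card_relevant_le hd hL₀ hw0 hB hsv (S := Jn) (by simp [hJn])
  replace hwL : w ≤ L₀ ^ 2 := hwL ⟨j₀, by simp [hJn, hj₀]⟩
  have hcardK : Jn.card ≤ K := by
    have h1 : (Jn.card : ℝ) ≤ K := by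
      calc (Jn.card : ℝ) = Jn.card * w ^ 2 * s ^ 2 := by
            rw [mul_assoc, ← mul_pow, mul_comm w, hsw]; simp
        _ ≤ L₀ ^ 4 * s ^ 2 := mul_le_mul_of_nonneg_right hcard (sq_nonneg _)
        _ ≤ K := hsK
    exact_mod_cast h1
  -- the noise terms
  have hnoise : ∀ k, |inn E (fitted X B - R.fit X k)| ≤ N := abs_inn_noise_error_le hL₀ hB hR
  have hN0 : 0 ≤ N := (abs_nonneg _).trans (hnoise 0)
  have hN₁ : 10 * μ * N ≤ T * w := by
    calc 10 * μ * N ≤ 10 * μ * (η * T * w ^ 2) := mul_le_mul_of_nonneg_left hξ (by positivity)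
      _ = (10 * μ * η * w) * (T * w) := by ring
      _ ≤ (10 * μ * η * L₀ ^ 2) * (T * w) := by gcongr
      _ ≤ 1 * (T * w) := mul_le_mul_of_nonneg_right (by linarith) (by positivity)
      _ = T * w := one_mul _
  have hN₂ : 4 * Mo * N ≤ T := by
    calc 4 * Mo * N ≤ 4 * Mo * (η * T * w ^ 2) := mul_le_mul_of_nonneg_left hξ (by positivity)
      _ = (4 * Mo * η * w ^ 2) * T := by ring
      _ ≤ (4 * Mo * η * (L₀ ^ 2) ^ 2) * T := by gcongr
      _ = (4 * Mo * L₀ ^ 4 * η) * T := by ring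
      _ ≤ 1 * T := mul_le_mul_of_nonneg_right hη₂ hT0.le
      _ = T := one_mul _
  have hres : ∀ k, Y - R.fit X k = (fitted X B - R.fit X k) + E := fun k => by
    rw [hY, response]; abel
  have hres_sq : ∀ k, fro (Y - R.fit X k) ^ 2 =
      fro (fitted X B - R.fit X k) ^ 2 + 2 * inn E (fitted X B - R.fit X k) + fro E ^ 2 :=
    fun k => by rw [hres, fro_sq_add, inn_comm]
  -- size of the response
  have hYsq : fro Y ^ 2 ≤ 2 * T * (Mo + μ * L₀ ^ 2) := by
    have h1 : fro (fitted X B) ^ 2 ≤ T * (μ * L₀ ^ 2) := by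
      have h2 := (fro_fitted_le X hn hμ0 hX B).trans
        (mul_le_mul_of_nonneg_left hB (Real.sqrt_nonneg _))
      calc fro (fitted X B) ^ 2 ≤ (√(n * μ) * (√d * L₀)) ^ 2 :=
            pow_le_pow_left₀ (fro_nonneg _) h2 2
        _ = (n * μ) * (d * L₀ ^ 2) := by
            rw [mul_pow, mul_pow, Real.sq_sqrt (by positivity), Real.sq_sqrt hd'.le]
        _ = _ := by rw [hT]; ring
    have h2 : fro Y ≤ fro (fitted X B) + fro E := fro_add_le _ _
    have h3 : fro Y ^ 2 ≤ (fro (fitted X B) + fro E) ^ 2 := pow_le_pow_left₀ (fro_nonneg _) h2 2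
    nlinarith [sq_nonneg (fro (fitted X B) - fro E)]
  rcases hR.kHat_cases hn hd K (C * w ^ 2) with ⟨k, hk, hlast⟩ | ⟨-, hdecay⟩
  · -- failure of screening makes the error large
    have hD : T * w / μ ≤ fro (fitted X B - R.fit X (k + 1)) ^ 2 := by
      have hkK : k + 1 ≤ K := hk ▸ R.kHat_le K _
      -- Truth minus estimate is supported on at most `K` relevant and `K` selected predictors,
      -- whence the bound `2 * K` in the convexity condition.
      have h1 := le_fro_fitted_sq hn (J := Jn ∪ R.selected (k + 1)) (X := X)
        (hJ _ ((Finset.card_union_le _ _).trans (by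
          have := R.card_selected_le (k + 1)
          omega)))
        (C := B - R.coef (k + 1)) (fun j hj => by
          rw [Finset.notMem_union] at hj
          have h2 : B j = 0 := by
            by_contra h; exact hj.1 (Finset.mem_filter.2 ⟨Finset.mem_univ _, h⟩)
          simp [h2, R.coef_eq_zero_of_notMem_selected hj.2])
      rw [fitted_sub] at h1
      have h2 : d * w ≤ fro (B j₀ - R.coef (k + 1) j₀) ^ 2 := by
        refine mul_inv_le_fro_sub_sq hd (hsv j₀ hj₀) ?_
        rw [hk] at hlt; exact hlt
      have h3 : fro (B j₀ - R.coef (k + 1) j₀) ^ 2 ≤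
          ∑ j, fro ((B - R.coef (k + 1)) j) ^ 2 :=
        Finset.single_le_sum (f := fun j => fro ((B - R.coef (k + 1)) j) ^ 2)
          (fun j _ => sq_nonneg _) (Finset.mem_univ j₀)
      calc T * w / μ = n * μ⁻¹ * (d * w) := by rw [hT]; field_simp
        _ ≤ n * μ⁻¹ * ∑ j, fro ((B - R.coef (k + 1)) j) ^ 2 :=
          mul_le_mul_of_nonneg_left (h2.trans h3) (by positivity)
        _ ≤ _ := h1
    have hmono := hpath.residual_sq_succ_le k
    -- The atom is at least as correlated as the true fit, so the correlation is the squared error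
    -- at step `k` up to noise. The lower bound is known at `k + 1`; monotonicity of the residual
    -- carries it back for `4 * N`, and the noise at `k` costs one more `N`.
    have ha : T * w / (2 * μ) ≤
        inn (Y - R.fit X k) (X (R.idx k) * R.atom k - R.fit X k) := by
      have h1 := hR.inn_fitted_le hLn k hB
      have h2 : inn (Y - R.fit X k) (fitted X B - R.fit X k) =
          fro (fitted X B - R.fit X k) ^ 2 + inn E (fitted X B - R.fit X k) := by
        rw [hres, inn_add_left, inn_self]
      rw [inn_sub_right] at h2 ⊢
      rw [hres_sq, hres_sq] at hmono
      have h3 := abs_le.1 (hnoise k)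
      have h4 := abs_le.1 (hnoise (k + 1))
      have h5 : 5 * N ≤ T * w / (2 * μ) := by
        rw [le_div_iff₀ (by positivity)]; linarith
      have h6 : T * w / μ = 2 * (T * w / (2 * μ)) := by field_simp
      linarith
    have hatom : ∀ k, fro (X (R.idx k) * R.atom k) ≤ √(n * μ) * (√d * L₀) := fun k =>
      ((hX _).fro_mul_le hn hμ0 _).trans (mul_le_mul_of_nonneg_left
        ((fro_le_nuc _).trans (hR.atom_le k)) (Real.sqrt_nonneg _))
    have hdir := hpath.fro_direction_sq_le (by positivity) hatom k
    have hb : 4 * (√(n * μ) * (√d * L₀)) ^ 2 = 4 * μ * L₀ ^ 2 * T := by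
      rw [mul_pow, mul_pow, Real.sq_sqrt (by positivity), Real.sq_sqrt hd'.le, hT]; ring
    rw [hb] at hdir
    have himp := hpath.residual_sq_le_sub_min k (a := T * w / (2 * μ)) (b := 4 * μ * L₀ ^ 2 * T)
      (by positivity) (by positivity) ha hdir
    -- The left side is exactly the second entry of the minimum; that it is below the first uses `w
    -- ≤ L₀ ^ 2`.
    have hmin : T * w ^ 2 / (16 * μ ^ 3 * L₀ ^ 2) ≤
        min (T * w / (2 * μ)) ((T * w / (2 * μ)) ^ 2 / (4 * μ * L₀ ^ 2 * T)) := by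
      refine le_min ?_ (le_of_eq ?_)
      · rw [div_le_div_iff₀ (by positivity) (by positivity)]
        have h1 : 1 ≤ μ ^ 2 := one_le_pow₀ hμ
        have h2 : w * 1 ≤ L₀ ^ 2 * (8 * μ ^ 2) := mul_le_mul hwL (by linarith) (by simp) (by positivity)
        calc T * w ^ 2 * (2 * μ) = (T * w * (2 * μ)) * (w * 1) := by ring
          _ ≤ (T * w * (2 * μ)) * (L₀ ^ 2 * (8 * μ ^ 2)) :=
            mul_le_mul_of_nonneg_left h2 (by positivity)
          _ = _ := by ring
      · field_simp; ring
    have hRk : fro (Y - R.fit X k) ^ 2 ≤ 2 * T * (Mo + μ * L₀ ^ 2) := by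
      have := hpath.residual_sq_antitone (Nat.zero_le k)
      simp only [hpath.zero, sub_zero] at this
      exact this.trans hYsq
    -- The guaranteed decrease meets the small decrease certified by the stopping rule. The
    -- smallness of `C` makes the right side at most half the left.
    have h1 : T * w ^ 2 / (16 * μ ^ 3 * L₀ ^ 2) ≤ C * w ^ 2 * (2 * T * (Mo + μ * L₀ ^ 2)) := by
      have := mul_le_mul_of_nonneg_left hRk (show 0 ≤ C * w ^ 2 by positivity)
      linarith
    rw [div_le_iff₀ (by positivity)] at h1
    have h2 : C * w ^ 2 * (2 * T * (Mo + μ * L₀ ^ 2)) * (16 * μ ^ 3 * L₀ ^ 2) =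
        (C * (64 * μ ^ 3 * L₀ ^ 2 * (Mo + μ * L₀ ^ 2))) * (T * w ^ 2) / 2 := by ring
    rw [h2] at h1
    have h3 : 0 < T * w ^ 2 := by positivity
    have h4 := mul_le_mul_of_nonneg_right hC₀ h3.le
    linarith
  · -- the residual cannot decay below the noise level
    set A := 8 * Mo * (Mo + μ * L₀ ^ 2) with hA
    have hA0 : 0 < A := by positivity
    have hx : A ≤ K * (C * w ^ 2) := by
      calc A = A * s ^ 2 * w ^ 2 := by rw [mul_assoc, ← mul_pow, hsw]; simp
        _ ≤ C * K * w ^ 2 := mul_le_mul_of_nonneg_right hsK' (sq_nonneg _)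
        _ = _ := by ring
    -- From A ≤ x ≤ eˣ; the value of `A` is chosen to bring the residual down to T/(4Mo).
    have hexp : Real.exp (-(K * (C * w ^ 2))) * A ≤ 1 := by
      have h1 := Real.add_one_le_exp (K * (C * w ^ 2))
      rw [Real.exp_neg, inv_mul_le_iff₀ (Real.exp_pos _)]
      linarith
    have h1 : fro (Y - R.fit X K) ^ 2 * (4 * Mo) ≤ T := by
      calc fro (Y - R.fit X K) ^ 2 * (4 * Mo)
          ≤ Real.exp (-(K * (C * w ^ 2))) * (2 * T * (Mo + μ * L₀ ^ 2)) * (4 * Mo) :=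
            mul_le_mul_of_nonneg_right (hdecay.trans
              (mul_le_mul_of_nonneg_left hYsq (Real.exp_pos _).le)) (by positivity)
        _ = (Real.exp (-(K * (C * w ^ 2))) * A) * T := by rw [hA]; ring
        _ ≤ 1 * T := mul_le_mul_of_nonneg_right hexp hT0.le
        _ = T := one_mul T
    -- The squared residual is at least ‖E‖² - 2N ≥ T/Mo - T/(2Mo), twice the bound in `h1`.
    rw [hres_sq] at h1
    have h2 := (abs_le.1 (hnoise K)).1
    have h3 : T ≤ fro E ^ 2 * Mo := by
      rwa [inv_mul_le_iff₀ hMo, mul_comm] at hE₁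
    have h4 := mul_nonneg hMo.le (sq_nonneg (fro (fitted X B - R.fit X K)))
    have h5 := mul_nonneg hMo.le (neg_le_iff_add_nonneg.1 h2)
    linarith

end Screening

/-! ### Second stage -/

section Projection

variable {m n a b : ℕ}

theorem sub_proj_eq_zero_of_full {M : Matrix (Fin m) (Fin n) ℝ} {U : Matrix (Fin m) (Fin a) ℝ}
    {V : Matrix (Fin n) (Fin b) ℝ} (hU : Uᵀ * U = 1) (hV : Vᵀ * V = 1) (ha : a = m) (hb : b = n) :
    M - U * (Uᵀ * M * V) * Vᵀ = 0 := by
  subst ha hb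
  have hU' : U * Uᵀ = 1 := mul_eq_one_comm.1 hU
  have hV' : V * Vᵀ = 1 := mul_eq_one_comm.1 hV
  have : U * (Uᵀ * M * V) * Vᵀ = (U * Uᵀ) * M * (V * Vᵀ) := by simp only [Matrix.mul_assoc]
  rw [this, hU', hV', Matrix.one_mul, Matrix.mul_one, sub_self]

/-- The dimensions of the singular vector matrices are conditionals that equal `r` only
propositionally; this moves the perturbation bound across these equalities. -/
theorem fro_sub_proj_le_of_leading {r s : ℕ} {A A' M : Matrix (Fin m) (Fin n) ℝ}
    {U : Matrix (Fin m) (Fin a) ℝ} {V : Matrix (Fin n) (Fin b) ℝ} (h : IsLeadingSVD A' U V)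
    (ha : a = r) (hb : b = r)
    (hr : A.rank ≤ r) {U₀ : Matrix (Fin m) (Fin s) ℝ} {V₀ : Matrix (Fin n) (Fin s) ℝ}
    (h₀ : IsLeadingSVD A U₀ V₀) {c : ℝ} (hc : 0 < c) (hsv : ∀ i : Fin s, c ≤ sv A i)
    {Q : Matrix (Fin s) (Fin s) ℝ} (hM : M = U₀ * Q * V₀ᵀ) :
    fro (M - U * (Uᵀ * M * V) * Vᵀ) ≤ 4 * opNorm (A' - A) / c * fro M := by
  subst ha
  subst hb
  exact h.fro_sub_proj_le hr h₀ hc hsv hM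

end Projection

section Dimensions

variable {p : ℕ}

/-- Each block costs at most the maximum in the definition of κ: `r` for large predictors, `min (q
j) d` for the others. -/
theorem sum_min_dim_le_kappa (q : Fin p → ℕ) (d r : ℕ) (J : Finset (Fin p)) :
    ∑ j ∈ J, min (leftDim r (q j) d) (rightDim r (q j) d) ≤ kappa q d J r := by
  rw [kappa, ← smul_eq_mul]
  refine Finset.sum_le_card_nsmul _ _ _ fun j hj => ?_
  by_cases h : r < min (q j) d
  · have hm : j ∈ largeSelected q d J r := Finset.mem_filter.2 ⟨hj, h⟩
    rw [leftDim, rightDim, if_pos h, if_pos h, min_self, if_pos ⟨j, hm⟩]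
    exact le_max_right _ _
  · have hm : j ∈ J \ largeSelected q d J r :=
      Finset.mem_sdiff.2 ⟨hj, fun h' => h (Finset.mem_filter.1 h').2⟩
    rw [leftDim, rightDim, if_neg h, if_neg h]
    exact (Finset.le_sup (f := fun j => min (q j) d) hm).trans (le_max_left _ _)

end Dimensions

theorem rank_add_le' {m n : ℕ} (A B : Matrix (Fin m) (Fin n) ℝ) :
    (A + B).rank ≤ A.rank + B.rank := by
  rw [Matrix.rank, Matrix.rank, Matrix.rank, Matrix.mulVecLin_add]
  exact (Submodule.finrank_mono (LinearMap.range_add_le _ _)).trans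
    (Submodule.finrank_add_le_finrank_add_finrank _ _)

/-- The rank of each marginal correlation matrix is at most the total rank of the coefficients. -/
theorem marginalRank_le_sum {n p d : ℕ} {q : Fin p → ℕ} (X : ∀ j, Matrix (Fin n) (Fin (q j)) ℝ)
    (B : ∀ j, Matrix (Fin (q j)) (Fin d) ℝ) (j : Fin p) :
    marginalRank X B j ≤ ∑ i, (B i).rank := by
  have hsum : ∀ s : Finset (Fin p), (∑ i ∈ s, X i * B i).rank ≤ ∑ i ∈ s, (B i).rank := by
    classical
    intro s
    induction s using Finset.induction_on with
    | empty => simp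
    | insert i s hi ih =>
      rw [Finset.sum_insert hi, Finset.sum_insert hi]
      exact (rank_add_le' _ _).trans (add_le_add (Matrix.rank_mul_le_right _ _) ih)
  exact (Matrix.rank_mul_le_right _ _).trans (hsum Finset.univ)

/-- The properties of the data and of the selected predictors on which the analysis of the second
stage rests. -/
structure Regular {n p d : ℕ} {q : Fin p → ℕ} (X : ∀ j, Matrix (Fin n) (Fin (q j)) ℝ)
    (B : ∀ j, Matrix (Fin (q j)) (Fin d) ℝ) (J : Finset (Fin p)) (r : ℕ) (μ L₀ δ : ℝ) : Prop where
  n_pos : 0 < n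
  d_pos : 0 < d
  one_le : 1 ≤ μ
  radius_pos : 0 < L₀
  delta_pos : 0 < δ
  gram_bound : ∀ j, GramBound (X j) μ
  convex : ∀ i, μ⁻¹ < (gram_isHermitian (stack X J)).eigenvalues i
  relevant_mem : ∀ j ∈ relevant B, j ∈ J
  rank_le : ∀ j ∈ relevant B, marginalRank X B j ≤ r
  nuc_le : ∑ j, nuc (B j) ≤ √d * L₀ / (4 * μ ^ 2)
  sv_ge : ∀ j ∈ largeRelevant X B,
    n * δ ≤ sv ((X j)ᵀ * fitted X B) (marginalRank X B j - 1)
  revealed : ∀ j ∈ largeRelevant X B,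
    ∀ (U : Matrix (Fin (q j)) (Fin (marginalRank X B j)) ℝ)
      (V : Matrix (Fin d) (Fin (marginalRank X B j)) ℝ),
      IsLeadingSVD ((X j)ᵀ * fitted X B) U V →
        ∃ Q : Matrix (Fin (marginalRank X B j)) (Fin (marginalRank X B j)) ℝ,
          gram (X j) * B j = U * Q * Vᵀ

/-! ### Bias, convexity and correlations in the second stage -/

namespace SecondStage

variable {n p d r : ℕ} {q : Fin p → ℕ} {X : ∀ j, Matrix (Fin n) (Fin (q j)) ℝ}
  {B : ∀ j, Matrix (Fin (q j)) (Fin d) ℝ} {E Y : Matrix (Fin n) (Fin d) ℝ} {J : Finset (Fin p)}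
  {μ L₀ δ Ln : ℝ} {R : SecondStage q d r}

theorem lift_eq (R : SecondStage q d r) (X : ∀ j, Matrix (Fin n) (Fin (q j)) ℝ) (j : Fin p)
    (S : Matrix (Fin (leftDim r (q j) d)) (Fin (rightDim r (q j) d)) ℝ) :
    R.lift X j S = (gram (X j))⁻¹ * (R.U j * S * (R.V j)ᵀ) := by
  simp only [lift, Matrix.mul_assoc]

theorem lift_zero (R : SecondStage q d r) (X : ∀ j, Matrix (Fin n) (Fin (q j)) ℝ) (j : Fin p) :
    R.lift X j 0 = 0 := by
  simp [lift]

theorem lift_add (R : SecondStage q d r) (X : ∀ j, Matrix (Fin n) (Fin (q j)) ℝ) (j : Fin p)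
    (S S' : Matrix (Fin (leftDim r (q j) d)) (Fin (rightDim r (q j) d)) ℝ) :
    R.lift X j (S + S') = R.lift X j S + R.lift X j S' := by
  simp [lift, Matrix.mul_add, Matrix.add_mul]

theorem lift_sub (R : SecondStage q d r) (X : ∀ j, Matrix (Fin n) (Fin (q j)) ℝ) (j : Fin p)
    (S S' : Matrix (Fin (leftDim r (q j) d)) (Fin (rightDim r (q j) d)) ℝ) :
    R.lift X j (S - S') = R.lift X j S - R.lift X j S' := by
  simp [lift, Matrix.mul_sub, Matrix.sub_mul]

theorem lift_smul (R : SecondStage q d r) (X : ∀ j, Matrix (Fin n) (Fin (q j)) ℝ) (j : Fin p)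
    (c : ℝ) (S : Matrix (Fin (leftDim r (q j) d)) (Fin (rightDim r (q j) d)) ℝ) :
    R.lift X j (c • S) = c • R.lift X j S := by
  simp [lift]

/-- The correlation of `Z` with the dictionary of the `j`-th predictor. -/
def corr (R : SecondStage q d r) (X : ∀ j, Matrix (Fin n) (Fin (q j)) ℝ)
    (Z : Matrix (Fin n) (Fin d) ℝ) (j : Fin p) :
    Matrix (Fin (leftDim r (q j) d)) (Fin (rightDim r (q j) d)) ℝ :=
  (R.U j)ᵀ * ((gram (X j))⁻¹ᵀ * ((X j)ᵀ * Z)) * R.V j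

/-- `corr` is the adjoint of the map sending a core to its contribution to the fit, so its operator
norm is the dual norm that the greedy choice maximizes. -/
theorem inn_mul_lift (R : SecondStage q d r) (Z : Matrix (Fin n) (Fin d) ℝ) (j : Fin p)
    (S : Matrix (Fin (leftDim r (q j) d)) (Fin (rightDim r (q j) d)) ℝ) :
    inn Z (X j * R.lift X j S) = inn (R.corr X Z j) S := by
  rw [lift_eq, inn_mul_right, inn_mul_right, inn_mul_right', Matrix.transpose_transpose,
    inn_mul_right, corr]
  simp only [Matrix.mul_assoc]

theorem IsRGA.greedyPath (h : R.IsRGA X Y J Ln) :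
    GreedyPath Y (R.fit X) (fun k => X (R.idx k) * R.lift X (R.idx k) (R.core k)) R.lam where
  zero := by simp [fit, coef, fitted_zero]
  succ k := by
    simp only [fit]
    rw [coef, fitted_add, fitted_smul, fitted_smul, fitted_single]
  mem := h.lam_mem
  min := h.lam_min

/-- The coefficient matrices are lifts of matrices supported on the selected predictors. -/
theorem IsRGA.exists_coef_eq_lift (h : R.IsRGA X Y J Ln) (k : ℕ) :
    ∃ S : ∀ j, Matrix (Fin (leftDim r (q j) d)) (Fin (rightDim r (q j) d)) ℝ,
      (∀ j, R.coef X k j = R.lift X j (S j)) ∧ ∀ j, j ∉ J → S j = 0 := by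
  induction k with
  | zero => exact ⟨0, fun j => by simp [coef, lift_zero], fun j _ => rfl⟩
  | succ k ih =>
    obtain ⟨S, hS, hS0⟩ := ih
    refine ⟨(1 - R.lam k) • S + R.lam k • (Pi.single (R.idx k) (R.core k) :
      ∀ j, Matrix (Fin (leftDim r (q j) d)) (Fin (rightDim r (q j) d)) ℝ), fun j => ?_,
      fun j hj => ?_⟩
    · simp only [coef, Pi.add_apply, Pi.smul_apply, lift_add, lift_smul, hS]
      congr 2
      by_cases hj : j = R.idx k
      · subst hj; simp
      · simp [Pi.single_eq_of_ne hj, lift_zero]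
    · have hne : j ≠ R.idx k := fun h' => hj (h' ▸ h.idx_mem k)
      simp [hS0 j hj, Pi.single_eq_of_ne hne]

/-- The population counterpart of the second-stage coefficients. -/
def target (R : SecondStage q d r) (X : ∀ j, Matrix (Fin n) (Fin (q j)) ℝ)
    (B : ∀ j, Matrix (Fin (q j)) (Fin d) ℝ) (j : Fin p) :
    Matrix (Fin (leftDim r (q j) d)) (Fin (rightDim r (q j) d)) ℝ :=
  (R.U j)ᵀ * (gram (X j) * B j) * R.V j

theorem target_eq_zero (R : SecondStage q d r) (hreg : Regular X B J r μ L₀ δ) {j : Fin p}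
    (hj : j ∉ J) : B j = 0 ∧ R.target X B j = 0 := by
  have h : B j = 0 := by
    by_contra h; exact hj (hreg.relevant_mem j h)
  exact ⟨h, by simp [target, h]⟩

theorem IsRGA.fro_mul_lift_le (h : R.IsRGA X Y J Ln) (hreg : Regular X B J r μ L₀ δ) {j : Fin p}
    (hj : j ∈ J) (S : Matrix (Fin (leftDim r (q j) d)) (Fin (rightDim r (q j) d)) ℝ) :
    fro (X j * R.lift X j S) ≤ √(n * μ) * fro S := by
  have hμ : 0 < μ := by linarith [hreg.one_le]
  rw [lift_eq]
  refine ((hreg.gram_bound j).fro_mul_inv_mul_le hreg.n_pos hμ _).trans_eq ?_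
  rw [fro_mul_orthonormal_transpose (h.svd j hj).right_orthonormal,
    fro_orthonormal_mul (h.svd j hj).left_orthonormal]

/-- The bias of the second stage that is caused by the estimated singular vectors. -/
theorem IsRGA.fro_bias_le (h : R.IsRGA X (response X B E) J Ln)
    (hreg : Regular X B J r μ L₀ δ) :
    fro (fitted X B - fitted X fun j => R.lift X j (R.target X B j)) ≤
      √(n * μ) * (√d * L₀) * (noiseSize X E / (n * δ)) *
        (open Classical in if (largeRelevant X B).Nonempty then 1 else 0) := by
  classical
  have hμ : 0 < μ := by linarith [hreg.one_le]
  have hn : (0 : ℝ) < n := by exact_mod_cast hreg.n_pos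
  have hδ := hreg.delta_pos
  have hL := hreg.radius_pos
  have hξ0 := noiseSize_nonneg X E
  set ind : ℝ := if (largeRelevant X B).Nonempty then 1 else 0 with hind
  have hind0 : 0 ≤ ind := by rw [hind]; split_ifs <;> norm_num
  have hterm : ∀ j, fro (X j * (B j - R.lift X j (R.target X B j))) ≤
      √(n * μ) * (4 * noiseSize X E / (n * δ) * (μ * nuc (B j))) * ind := fun j => by
    have hnn : 0 ≤ √(n * μ) * (4 * noiseSize X E / (n * δ) * (μ * nuc (B j))) * ind := by
      have := nuc_nonneg (B j)
      positivity
    by_cases hj : B j = 0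
    · have : R.target X B j = 0 := by simp [target, hj]
      rw [this, lift_zero, hj, sub_zero, Matrix.mul_zero, fro_zero]
      exact hj ▸ hnn
    have hjJ := hreg.relevant_mem j hj
    set M := gram (X j) * B j with hM
    have hB : B j = (gram (X j))⁻¹ * M := by
      rw [hM, ← Matrix.mul_assoc, (hreg.gram_bound j).inv_mul_gram hμ, Matrix.one_mul]
    have hdiff : B j - R.lift X j (R.target X B j) =
        (gram (X j))⁻¹ * (M - R.U j * ((R.U j)ᵀ * M * R.V j) * (R.V j)ᵀ) := by
      rw [lift_eq, Matrix.mul_sub, ← hB]; rfl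
    have hsvd := h.svd j hjJ
    by_cases hlarge : r < min (q j) d
    -- A relevant predictor that is truncated at `r` has marginal rank at most `r`, so it is large;
    -- this is where the indicator in the rate arises.
    · have hmem : j ∈ largeRelevant X B := ⟨hj, (hreg.rank_le j hj).trans_lt hlarge⟩
      have hind1 : ind = 1 := by rw [hind, if_pos ⟨j, hmem⟩]
      obtain ⟨U₀, V₀, h₀⟩ := exists_isLeadingSVD_rank ((X j)ᵀ * fitted X B)
      obtain ⟨Q, hQ⟩ := hreg.revealed j hmem U₀ V₀ h₀
      have hsv : ∀ i : Fin ((X j)ᵀ * fitted X B).rank,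
          (n * δ : ℝ) ≤ sv ((X j)ᵀ * fitted X B) i := fun i =>
        (hreg.sv_ge j hmem).trans (sv_antitone _ (Nat.le_sub_one_of_lt i.2))
      have hbound := fro_sub_proj_le_of_leading hsvd (by rw [leftDim, if_pos hlarge])
        (by rw [rightDim, if_pos hlarge]) (hreg.rank_le j hj) h₀ (by positivity) hsv hQ
      have hnoise : opNorm ((X j)ᵀ * response X B E - (X j)ᵀ * fitted X B) ≤ noiseSize X E := by
        rw [← Matrix.mul_sub, response, add_sub_cancel_left]
        exact opNorm_le_noiseSize X E j
      have hfroM : fro M ≤ μ * nuc (B j) :=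
        (fro_mul_le _ _).trans (mul_le_mul
          ((hreg.gram_bound j).opNorm_gram_le hreg.n_pos hμ) (fro_le_nuc _) (fro_nonneg _) hμ.le)
      rw [hdiff, hind1, mul_one]
      refine ((hreg.gram_bound j).fro_mul_inv_mul_le hreg.n_pos hμ _).trans
        (mul_le_mul_of_nonneg_left (hbound.trans ?_) (Real.sqrt_nonneg _))
      refine mul_le_mul ?_ hfroM (fro_nonneg _) (by positivity)
      gcongr
    · rw [hdiff, sub_proj_eq_zero_of_full hsvd.left_orthonormal hsvd.right_orthonormal
        (by rw [leftDim, if_neg hlarge]) (by rw [rightDim, if_neg hlarge]), Matrix.mul_zero,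
        Matrix.mul_zero, fro_zero]
      exact hnn
  have heq : (fitted X B - fitted X fun j => R.lift X j (R.target X B j)) =
      ∑ j, X j * (B j - R.lift X j (R.target X B j)) := by
    simp [fitted, Matrix.mul_sub, Finset.sum_sub_distrib]
  rw [heq]
  calc _ ≤ ∑ j, √(n * μ) * (4 * noiseSize X E / (n * δ) * (μ * nuc (B j))) * ind :=
        (fro_sum_le _ _).trans (Finset.sum_le_sum fun j _ => hterm j)
    _ = √(n * μ) * (4 * noiseSize X E / (n * δ) * μ) * ind * ∑ j, nuc (B j) := by
        rw [Finset.mul_sum]; exact Finset.sum_congr rfl fun j _ => by ring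
    _ ≤ √(n * μ) * (4 * noiseSize X E / (n * δ) * μ) * ind * (√d * L₀ / (4 * μ ^ 2)) :=
        mul_le_mul_of_nonneg_left hreg.nuc_le (by positivity)
    -- The constant 4 and the factor μ of the termwise bound are absorbed by the `4 * μ ^ 2` of the
    -- nuclear norm condition.
    _ = √(n * μ) * (√d * L₀) * (noiseSize X E / (n * δ)) * ind * μ⁻¹ := by field_simp
    _ ≤ √(n * μ) * (√d * L₀) * (noiseSize X E / (n * δ)) * ind * 1 :=
        mul_le_mul_of_nonneg_left (inv_le_one_of_one_le₀ hreg.one_le) (by positivity)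
    _ = _ := mul_one _

/-- Strong convexity in terms of the second-stage coefficients. -/
theorem IsRGA.sum_fro_sq_le (h : R.IsRGA X Y J Ln) (hreg : Regular X B J r μ L₀ δ)
    {S : ∀ j, Matrix (Fin (leftDim r (q j) d)) (Fin (rightDim r (q j) d)) ℝ}
    (hS : ∀ j, j ∉ J → S j = 0) :
    n * ∑ j, fro (S j) ^ 2 ≤ μ ^ 3 * fro (fitted X fun j => R.lift X j (S j)) ^ 2 := by
  have hμ : 0 < μ := by linarith [hreg.one_le]
  have h1 := le_fro_fitted_sq hreg.n_pos hreg.convex (C := fun j => R.lift X j (S j))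
    (fun j hj => by rw [hS j hj, lift_zero])
  have h2 : ∀ j, fro (S j) ^ 2 ≤ μ ^ 2 * fro (R.lift X j (S j)) ^ 2 := fun j => by
    by_cases hj : j ∈ J
    · rw [← mul_pow]
      refine pow_le_pow_left₀ (fro_nonneg _) ?_ 2
      rw [lift_eq]
      refine le_trans (le_of_eq ?_)
        ((hreg.gram_bound j).fro_le_mul_fro_inv_mul hreg.n_pos hμ _)
      rw [fro_mul_orthonormal_transpose (h.svd j hj).right_orthonormal,
        fro_orthonormal_mul (h.svd j hj).left_orthonormal]
    · rw [hS j hj, fro_zero, zero_pow two_ne_zero]; positivity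
  calc (n : ℝ) * ∑ j, fro (S j) ^ 2 ≤ n * ∑ j, μ ^ 2 * fro (R.lift X j (S j)) ^ 2 :=
        mul_le_mul_of_nonneg_left (Finset.sum_le_sum fun j _ => h2 j) (Nat.cast_nonneg _)
    _ = μ ^ 3 * (n * μ⁻¹ * ∑ j, fro (R.lift X j (S j)) ^ 2) := by
        rw [← Finset.mul_sum]; field_simp
    _ ≤ _ := mul_le_mul_of_nonneg_left h1 (by positivity)

/-- Blockwise Cauchy-Schwarz: the correlations contribute κψ² in squared Frobenius norm, and strong
convexity returns the cores to the fit. It is used with the noise, for an upper bound, and with the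
residual, to bound ψ from below. -/
theorem IsRGA.inn_fitted_lift_sq_le (h : R.IsRGA X Y J Ln) (hreg : Regular X B J r μ L₀ δ)
    {S : ∀ j, Matrix (Fin (leftDim r (q j) d)) (Fin (rightDim r (q j) d)) ℝ}
    (hS : ∀ j, j ∉ J → S j = 0) {Z : Matrix (Fin n) (Fin d) ℝ} {ψ : ℝ}
    (hψ : ∀ j ∈ J, opNorm (R.corr X Z j) ≤ ψ) :
    n * inn Z (fitted X fun j => R.lift X j (S j)) ^ 2 ≤
      kappa q d J r * ψ ^ 2 * (μ ^ 3 * fro (fitted X fun j => R.lift X j (S j)) ^ 2) := by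
  have h1 : inn Z (fitted X fun j => R.lift X j (S j)) = ∑ j ∈ J, inn (R.corr X Z j) (S j) := by
    rw [fitted, inn_sum_right, ← Finset.sum_subset (Finset.subset_univ J)]
    · exact Finset.sum_congr rfl fun j _ => inn_mul_lift R Z j (S j)
    · intro j _ hj
      rw [hS j hj, lift_zero, Matrix.mul_zero, inn_zero_right]
  have h2 : |∑ j ∈ J, inn (R.corr X Z j) (S j)| ≤ ∑ j ∈ J, fro (R.corr X Z j) * fro (S j) :=
    (Finset.abs_sum_le_sum_abs _ _).trans (Finset.sum_le_sum fun j _ => abs_inn_le _ _)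
  have h3 := Finset.sum_mul_sq_le_sq_mul_sq J (fun j => fro (R.corr X Z j)) fun j => fro (S j)
  have h4 : ∑ j ∈ J, fro (R.corr X Z j) ^ 2 ≤ kappa q d J r * ψ ^ 2 := by
    calc ∑ j ∈ J, fro (R.corr X Z j) ^ 2
        ≤ ∑ j ∈ J, ((min (leftDim r (q j) d) (rightDim r (q j) d) : ℕ) : ℝ) * ψ ^ 2 := by
          refine Finset.sum_le_sum fun j hj => (fro_sq_le_min _).trans ?_
          exact mul_le_mul_of_nonneg_left
            (pow_le_pow_left₀ (opNorm_nonneg _) (hψ j hj) 2) (Nat.cast_nonneg _)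
      _ = ((∑ j ∈ J, min (leftDim r (q j) d) (rightDim r (q j) d) : ℕ) : ℝ) * ψ ^ 2 := by
          rw [← Finset.sum_mul, Nat.cast_sum]
      _ ≤ _ := mul_le_mul_of_nonneg_right
          (by exact_mod_cast sum_min_dim_le_kappa q d r J) (sq_nonneg _)
  have h5 : ∑ j ∈ J, fro (S j) ^ 2 ≤ ∑ j, fro (S j) ^ 2 :=
    Finset.sum_le_sum_of_subset_of_nonneg (Finset.subset_univ _) fun j _ _ => sq_nonneg _
  have h6 := h.sum_fro_sq_le hreg hS
  rw [h1]
  calc (n : ℝ) * (∑ j ∈ J, inn (R.corr X Z j) (S j)) ^ 2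
      ≤ n * (kappa q d J r * ψ ^ 2 * ∑ j, fro (S j) ^ 2) := by
        refine mul_le_mul_of_nonneg_left ?_ (Nat.cast_nonneg _)
        rw [← sq_abs]
        refine (pow_le_pow_left₀ (abs_nonneg _) h2 2).trans (h3.trans ?_)
        exact mul_le_mul h4 h5 (Finset.sum_nonneg fun j _ => sq_nonneg _) (by positivity)
    _ = kappa q d J r * ψ ^ 2 * (n * ∑ j, fro (S j) ^ 2) := by ring
    _ ≤ _ := mul_le_mul_of_nonneg_left h6 (by positivity)

theorem IsRGA.opNorm_corr_noise_le (h : R.IsRGA X Y J Ln) (hreg : Regular X B J r μ L₀ δ)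
    {j : Fin p} (hj : j ∈ J) : opNorm (R.corr X E j) ≤ μ * noiseSize X E := by
  have hμ : 0 < μ := by linarith [hreg.one_le]
  have hU : opNorm (R.U j)ᵀ ≤ 1 := by
    rw [opNorm_transpose]; exact opNorm_le_one_of_orthonormal (h.svd j hj).left_orthonormal
  have hV : opNorm (R.V j) ≤ 1 := opNorm_le_one_of_orthonormal (h.svd j hj).right_orthonormal
  have hG : opNorm (gram (X j))⁻¹ᵀ ≤ μ := by
    rw [opNorm_transpose]; exact (hreg.gram_bound j).opNorm_inv_le hμ
  have h1 : opNorm ((gram (X j))⁻¹ᵀ * ((X j)ᵀ * E)) ≤ μ * noiseSize X E :=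
    (opNorm_mul_le _ _).trans (mul_le_mul hG (opNorm_le_noiseSize X E j) (opNorm_nonneg _) hμ.le)
  have h0 : 0 ≤ μ * noiseSize X E := (opNorm_nonneg _).trans h1
  have h2 : opNorm ((R.U j)ᵀ * ((gram (X j))⁻¹ᵀ * ((X j)ᵀ * E))) ≤ 1 * (μ * noiseSize X E) :=
    (opNorm_mul_le _ _).trans (mul_le_mul hU h1 (opNorm_nonneg _) zero_le_one)
  rw [one_mul] at h2
  refine (opNorm_mul_le _ _).trans ((mul_le_mul h2 hV (opNorm_nonneg _) h0).trans_eq (mul_one _))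

/-- The target is well inside the feasible set, so its correlation with the residual is at most a
quarter of the maximal one. -/
theorem IsRGA.inn_target_le (h : R.IsRGA X Y J Ln) (hreg : Regular X B J r μ L₀ δ)
    {Z : Matrix (Fin n) (Fin d) ℝ} {ψ : ℝ} (hψ0 : 0 ≤ ψ)
    (hψ : ∀ j ∈ J, opNorm (R.corr X Z j) ≤ ψ) :
    inn Z (fitted X fun j => R.lift X j (R.target X B j)) ≤ √d * L₀ * ψ / 4 := by
  have hμ : 0 < μ := by linarith [hreg.one_le]
  have hL := hreg.radius_pos
  have hterm : ∀ j, inn Z (X j * R.lift X j (R.target X B j)) ≤ μ * ψ * nuc (B j) := fun j => by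
    by_cases hj : j ∈ J
    · rw [inn_mul_lift, target, inn_mul_right', inn_mul_right, Matrix.transpose_transpose,
        inn_mul_right]
      refine (inn_le_opNorm_mul_nuc _ _).trans (mul_le_mul_of_nonneg_right ?_ (nuc_nonneg _))
      have hU : opNorm (R.U j) ≤ 1 := opNorm_le_one_of_orthonormal (h.svd j hj).left_orthonormal
      have hV : opNorm (R.V j)ᵀ ≤ 1 := by
        rw [opNorm_transpose]; exact opNorm_le_one_of_orthonormal (h.svd j hj).right_orthonormal
      have hG : opNorm (gram (X j))ᵀ ≤ μ := by
        rw [opNorm_transpose]; exact (hreg.gram_bound j).opNorm_gram_le hreg.n_pos hμ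
      have h1 : opNorm (R.corr X Z j * (R.V j)ᵀ) ≤ ψ * 1 :=
        (opNorm_mul_le _ _).trans (mul_le_mul (hψ j hj) hV (opNorm_nonneg _) hψ0)
      have h2 : opNorm (R.U j * (R.corr X Z j * (R.V j)ᵀ)) ≤ 1 * (ψ * 1) :=
        (opNorm_mul_le _ _).trans (mul_le_mul hU h1 (opNorm_nonneg _) zero_le_one)
      rw [one_mul, mul_one] at h2
      exact (opNorm_mul_le _ _).trans (mul_le_mul hG h2 (opNorm_nonneg _) hμ.le)
    · rw [(R.target_eq_zero hreg hj).2, lift_zero, Matrix.mul_zero, inn_zero_right]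
      exact mul_nonneg (by positivity) (nuc_nonneg _)
  rw [fitted, inn_sum_right]
  calc _ ≤ ∑ j, μ * ψ * nuc (B j) := Finset.sum_le_sum fun j _ => hterm j
    _ = μ * ψ * ∑ j, nuc (B j) := by rw [Finset.mul_sum]
    _ ≤ μ * ψ * (√d * L₀ / (4 * μ ^ 2)) :=
        mul_le_mul_of_nonneg_left hreg.nuc_le (by positivity)
    _ = √d * L₀ * ψ / 4 * μ⁻¹ := by field_simp
    _ ≤ √d * L₀ * ψ / 4 * 1 :=
        mul_le_mul_of_nonneg_left (inv_le_one_of_one_le₀ hreg.one_le) (by positivity)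
    _ = _ := mul_one _

/-- The second stage starts from 0, so this is the initial error of the linear convergence. -/
theorem IsRGA.fro_target_le (h : R.IsRGA X Y J Ln) (hreg : Regular X B J r μ L₀ δ) :
    fro (fitted X fun j => R.lift X j (R.target X B j)) ≤ √(n * μ) * (√d * L₀) := by
  have hμ : 0 < μ := by linarith [hreg.one_le]
  have hL := hreg.radius_pos
  have hterm : ∀ j, fro (X j * R.lift X j (R.target X B j)) ≤ √(n * μ) * (μ * nuc (B j)) :=
    fun j => by
    by_cases hj : j ∈ J
    · refine (h.fro_mul_lift_le hreg hj _).trans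
        (mul_le_mul_of_nonneg_left ?_ (Real.sqrt_nonneg _))
      have hU : opNorm (R.U j)ᵀ ≤ 1 := by
        rw [opNorm_transpose]; exact opNorm_le_one_of_orthonormal (h.svd j hj).left_orthonormal
      have hV : opNorm (R.V j) ≤ 1 := opNorm_le_one_of_orthonormal (h.svd j hj).right_orthonormal
      have h1 : fro (gram (X j) * B j) ≤ μ * nuc (B j) :=
        (fro_mul_le _ _).trans (mul_le_mul
          ((hreg.gram_bound j).opNorm_gram_le hreg.n_pos hμ) (fro_le_nuc _) (fro_nonneg _) hμ.le)
      have h2 : fro ((R.U j)ᵀ * (gram (X j) * B j)) ≤ 1 * (μ * nuc (B j)) :=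
        (fro_mul_le _ _).trans (mul_le_mul hU h1 (fro_nonneg _) zero_le_one)
      rw [one_mul] at h2
      exact (fro_mul_le' _ _).trans ((mul_le_mul h2 hV (opNorm_nonneg _)
        (mul_nonneg hμ.le (nuc_nonneg _))).trans_eq (mul_one _))
    · rw [(R.target_eq_zero hreg hj).2, lift_zero, Matrix.mul_zero, fro_zero]
      exact mul_nonneg (Real.sqrt_nonneg _) (mul_nonneg hμ.le (nuc_nonneg _))
  rw [fitted]
  calc _ ≤ ∑ j, √(n * μ) * (μ * nuc (B j)) :=
        (fro_sum_le _ _).trans (Finset.sum_le_sum fun j _ => hterm j)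
    _ = √(n * μ) * μ * ∑ j, nuc (B j) := by
        rw [Finset.mul_sum]; exact Finset.sum_congr rfl fun j _ => by ring
    _ ≤ √(n * μ) * μ * (√d * L₀ / (4 * μ ^ 2)) :=
        mul_le_mul_of_nonneg_left hreg.nuc_le (by positivity)
    _ = √(n * μ) * (√d * L₀) * ((4 * μ)⁻¹) := by field_simp
    _ ≤ √(n * μ) * (√d * L₀) * 1 :=
        mul_le_mul_of_nonneg_left (inv_le_one_of_one_le₀ (by linarith [hreg.one_le]))
          (by positivity)
    _ = _ := mul_one _

end SecondStage

/-! ### Convergence of the second stage -/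

/-- Linear convergence down to the noise level. -/
theorem error_sq_le_of_contraction {D f e : ℕ → ℝ} {ν c : ℝ} (hD : ∀ k, 0 ≤ D k) (hν : 0 ≤ ν)
    (hc : 0 ≤ c) (hf : ∀ k, f k = D k ^ 2 + 2 * e k) (he : ∀ k, |e k| ≤ ν * D k)
    (hanti : Antitone f) (hstep : ∀ k, 4 * ν ≤ D k → f (k + 1) ≤ f k - c * D k ^ 2)
    {M m : ℕ} (hm : M ≤ m) :
    D m ^ 2 ≤ 52 * ν ^ 2 + 3 * Real.exp (-(2 * c / 3 * M)) * D 0 ^ 2 := by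
  -- Completing the square in f ≥ D² - 2νD. If some earlier D is below 4ν, then f ≤ 16ν² + 8ν², and
  -- 2 · 24 + 4 = 52.
  have hfin : D m ^ 2 ≤ 2 * f m + 4 * ν ^ 2 := by
    have h1 := (abs_le.1 (he m)).1
    rw [hf]
    nlinarith [sq_nonneg (D m - 2 * ν)]
  have hexp := Real.exp_pos (-(2 * c / 3 * M))
  by_cases hsmall : ∃ k ≤ M, D k < 4 * ν
  · obtain ⟨k, hk, hkD⟩ := hsmall
    have h1 : f m ≤ f k := hanti (hk.trans hm)
    have h2 : f k ≤ 24 * ν ^ 2 := by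
      have h3 := (abs_le.1 (he k)).2
      rw [hf]
      nlinarith [hD k, mul_le_mul_of_nonneg_left hkD.le hν,
        pow_le_pow_left₀ (hD k) hkD.le 2]
    have h4 : 0 ≤ 3 * Real.exp (-(2 * c / 3 * M)) * D 0 ^ 2 := by positivity
    linarith
  · push Not at hsmall
    -- While D ≥ 4ν the term 2e is at most D²/2 in size, so a decrease of cD² is at least the
    -- fraction 2c/3 of f.
    have hbd : ∀ k ≤ M, 0 ≤ f k ∧ f k ≤ 3 / 2 * D k ^ 2 := fun k hk => by
      have h1 := abs_le.1 (he k)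
      have h2 := mul_le_mul_of_nonneg_right (hsmall k hk) (hD k)
      rw [hf]
      constructor <;> nlinarith [sq_nonneg (D k)]
    have hind : ∀ k ≤ M, f k ≤ Real.exp (-(2 * c / 3 * k)) * f 0 := by
      intro k
      induction k with
      | zero => intro _; simp
      | succ k ih =>
        intro hk
        have hk' : k ≤ M := by omega
        have h1 := hstep k (hsmall k hk')
        have h2 := hbd k hk'
        have h3 : 1 - 2 * c / 3 ≤ Real.exp (-(2 * c / 3)) := by
          have := Real.add_one_le_exp (-(2 * c / 3)); linarith
        calc f (k + 1) ≤ (1 - 2 * c / 3) * f k := by nlinarith [mul_le_mul_of_nonneg_left h2.2 hc]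
          _ ≤ Real.exp (-(2 * c / 3)) * (Real.exp (-(2 * c / 3 * k)) * f 0) :=
            mul_le_mul h3 (ih hk') h2.1 (Real.exp_pos _).le
          _ = Real.exp (-(2 * c / 3 * (k + 1 : ℕ))) * f 0 := by
            rw [← mul_assoc, ← Real.exp_add]; congr 2; push_cast; ring
    have h1 := hind M le_rfl
    have h2 := (hbd 0 (Nat.zero_le M)).2
    have h3 : f m ≤ f M := hanti hm
    have h4 := mul_le_mul_of_nonneg_left h2 hexp.le
    nlinarith [sq_nonneg ν]

namespace SecondStage

variable {n p d r : ℕ} {q : Fin p → ℕ} {X : ∀ j, Matrix (Fin n) (Fin (q j)) ℝ}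
  {B : ∀ j, Matrix (Fin (q j)) (Fin d) ℝ} {E Y : Matrix (Fin n) (Fin d) ℝ} {J : Finset (Fin p)}
  {μ L₀ δ : ℝ} {R : SecondStage q d r}

/-- The distance of the current fit from the target is the fit of a matrix family supported on
the selected predictors. -/
theorem IsRGA.exists_error_eq {Ln : ℝ} (h : R.IsRGA X Y J Ln) (hreg : Regular X B J r μ L₀ δ)
    (k : ℕ) :
    ∃ S : ∀ j, Matrix (Fin (leftDim r (q j) d)) (Fin (rightDim r (q j) d)) ℝ,
      (∀ j, j ∉ J → S j = 0) ∧
      (fitted X fun j => R.lift X j (R.target X B j)) - R.fit X k =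
        fitted X fun j => R.lift X j (S j) := by
  obtain ⟨S, hS, hS0⟩ := h.exists_coef_eq_lift k
  refine ⟨fun j => R.target X B j - S j, fun j hj => ?_, ?_⟩
  · simp only [(R.target_eq_zero hreg hj).2, hS0 j hj, sub_zero]
  · rw [fit, ← fitted_sub]
    congr 1
    ext1 j
    rw [Pi.sub_apply, hS, lift_sub]

/-- The error of the second stage with respect to the target. -/
def err (R : SecondStage q d r) (X : ∀ j, Matrix (Fin n) (Fin (q j)) ℝ)
    (B : ∀ j, Matrix (Fin (q j)) (Fin d) ℝ) (k : ℕ) : Matrix (Fin n) (Fin d) ℝ :=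
  (fitted X fun j => R.lift X j (R.target X B j)) - R.fit X k

/-- The noise acts only through its correlations with the dictionary, each at most μξ_E, over an
effective dimension κ. Hence the level ξ_E√(κ/n) rather than ‖E‖. -/
theorem IsRGA.abs_inn_noise_err_le {Ln : ℝ} (h : R.IsRGA X Y J Ln)
    (hreg : Regular X B J r μ L₀ δ) (k : ℕ) :
    |inn E (R.err X B k)| ≤
      √(kappa q d J r * (μ * noiseSize X E) ^ 2 * μ ^ 3 / n) * fro (R.err X B k) := by
  have hμ : 0 < μ := by linarith [hreg.one_le]
  have hn : (0 : ℝ) < n := by exact_mod_cast hreg.n_pos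
  obtain ⟨S, hS0, hS⟩ := h.exists_error_eq hreg k
  have h1 := h.inn_fitted_lift_sq_le hreg hS0 (Z := E) fun j hj => h.opNorm_corr_noise_le hreg hj
  rw [← hS] at h1
  refine abs_le_of_sq_le_sq ?_ (mul_nonneg (Real.sqrt_nonneg _) (fro_nonneg _))
  rw [mul_pow, Real.sq_sqrt (by positivity), div_mul_eq_mul_div, le_div_iff₀ hn]
  calc _ = n * inn E (R.err X B k) ^ 2 := mul_comm _ _
    _ ≤ _ := h1
    _ = _ := by rw [err]; ring

/-- Testing the Cauchy-Schwarz bound on the error itself makes it vanish. This settles the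
degenerate case, since the contraction rate divides by κ. -/
theorem IsRGA.err_eq_zero {Ln : ℝ} (h : R.IsRGA X Y J Ln) (hreg : Regular X B J r μ L₀ δ)
    (hκ : kappa q d J r = 0) (k : ℕ) : R.err X B k = 0 := by
  have hn : (0 : ℝ) < n := by exact_mod_cast hreg.n_pos
  obtain ⟨S, hS0, hS⟩ := h.exists_error_eq hreg k
  have h1 := h.inn_fitted_lift_sq_le hreg hS0 (Z := R.err X B k)
    (ψ := ∑ j, opNorm (R.corr X (R.err X B k) j))
    fun j _ => Finset.single_le_sum (f := fun j => opNorm (R.corr X (R.err X B k) j))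
      (fun j _ => opNorm_nonneg _) (Finset.mem_univ j)
  rw [hκ, ← hS] at h1
  have h2 : n * inn (R.err X B k) (R.err X B k) ^ 2 ≤ 0 := by
    simpa [err] using h1
  have h3 : inn (R.err X B k) (R.err X B k) ^ 2 ≤ 0 := by
    by_contra! hpos
    have := mul_pos hn hpos
    linarith
  have h4 : inn (R.err X B k) (R.err X B k) = 0 :=
    pow_eq_zero_iff two_ne_zero |>.1 (le_antisymm h3 (sq_nonneg _))
  rw [inn_self] at h4
  exact fro_eq_zero (pow_eq_zero_iff two_ne_zero |>.1 h4)

/-- One step of the second stage reduces the residual by a fraction of the squared error, as long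
as the noise is dominated by the error. -/
theorem IsRGA.residual_step (h : R.IsRGA X Y J (√d * L₀)) (hreg : Regular X B J r μ L₀ δ)
    (hκ : 0 < kappa q d J r) (k : ℕ)
    (hcorr : 3 / 4 * fro (R.err X B k) ^ 2 ≤ inn (Y - R.fit X k) (R.err X B k)) :
    fro (Y - R.fit X (k + 1)) ^ 2 ≤
      fro (Y - R.fit X k) ^ 2 - 3 / (40 * kappa q d J r * μ ^ 4) * fro (R.err X B k) ^ 2 := by
  have hμ1 := hreg.one_le
  have hμ : 0 < μ := by linarith
  have hn : (0 : ℝ) < n := by exact_mod_cast hreg.n_pos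
  have hd : (0 : ℝ) < d := by exact_mod_cast hreg.d_pos
  have hL := hreg.radius_pos
  have hLn : 0 < √d * L₀ := by positivity
  have hpath := h.greedyPath
  set κ : ℝ := (kappa q d J r : ℝ) with hκdef
  have hκ1 : 1 ≤ κ := by rw [hκdef]; exact_mod_cast hκ
  set Z := Y - R.fit X k with hZ
  set D := fro (R.err X B k) with hD
  have hD0 : 0 ≤ D := fro_nonneg _
  set a := inn Z (X (R.idx k) * R.lift X (R.idx k) (R.core k)) with ha
  have hcorr_le : ∀ j ∈ J, √d * L₀ * opNorm (R.corr X Z j) ≤ a := fun j hj =>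
    mul_opNorm_le_of_forall hLn fun S hS => by
      rw [← inn_mul_lift]; exact h.core_max k j hj S hS
  have ha0 : 0 ≤ a :=
    (mul_nonneg hLn.le (opNorm_nonneg _)).trans (hcorr_le _ (h.idx_mem k))
  set ψ := a / (√d * L₀) with hψ
  have hψ0 : 0 ≤ ψ := by positivity
  have haψ : a = √d * L₀ * ψ := by rw [hψ]; field_simp
  have hψle : ∀ j ∈ J, opNorm (R.corr X Z j) ≤ ψ := fun j hj => by
    rw [hψ, le_div_iff₀ hLn, mul_comm]; exact hcorr_le j hj
  have htarget := h.inn_target_le hreg hψ0 hψle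
  rw [← haψ] at htarget
  obtain ⟨S, hS0, hS⟩ := h.exists_error_eq hreg k
  have h1 := h.inn_fitted_lift_sq_le hreg hS0 hψle
  rw [← hS] at h1
  change n * inn Z (R.err X B k) ^ 2 ≤ κ * ψ ^ 2 * (μ ^ 3 * D ^ 2) at h1
  -- Cancel `D ^ 2` between the assumed correlation and its Cauchy-Schwarz bound: a large error
  -- forces a large maximal correlation.
  have hψD : 9 / 16 * n * D ^ 2 ≤ κ * μ ^ 3 * ψ ^ 2 := by
    rcases hD0.eq_or_lt with h0 | h0
    · rw [← h0]; simp; positivity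
    · have h2 : (3 / 4 * D ^ 2) ^ 2 ≤ inn Z (R.err X B k) ^ 2 :=
        pow_le_pow_left₀ (by positivity) hcorr 2
      have h3 : D ^ 2 * (9 / 16 * n * D ^ 2) ≤ D ^ 2 * (κ * μ ^ 3 * ψ ^ 2) := by
        have := mul_le_mul_of_nonneg_left h2 hn.le
        nlinarith
      exact le_of_mul_le_mul_left h3 (by positivity)
  -- Split atom minus fit into (atom minus target) plus error. The target takes at most a quarter of
  -- `a`, and the error contributes 3/4 of `D ^ 2`.
  have hdir : 3 / 4 * a + 3 / 4 * D ^ 2 ≤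
      inn Z (X (R.idx k) * R.lift X (R.idx k) (R.core k) - R.fit X k) := by
    have h2 : inn Z (R.err X B k) =
        inn Z (fitted X fun j => R.lift X j (R.target X B j)) - inn Z (R.fit X k) := by
      rw [err, inn_sub_right]
    rw [inn_sub_right]
    linarith
  have hatom : ∀ k, fro (X (R.idx k) * R.lift X (R.idx k) (R.core k)) ≤ √(n * μ) * (√d * L₀) :=
    fun k => (h.fro_mul_lift_le hreg (h.idx_mem k) _).trans (mul_le_mul_of_nonneg_left
      ((fro_le_nuc _).trans (h.core_le k)) (Real.sqrt_nonneg _))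
  have hb := hpath.fro_direction_sq_le (by positivity) hatom k
  have hbe : 4 * (√(n * μ) * (√d * L₀)) ^ 2 = 4 * n * μ * (√d * L₀) ^ 2 := by
    rw [mul_pow, Real.sq_sqrt (by positivity)]; ring
  rw [hbe] at hb
  have himp := hpath.residual_sq_le_sub_min k (a := 3 / 4 * a + 3 / 4 * D ^ 2)
    (b := 4 * n * μ * (√d * L₀) ^ 2) (by positivity) (by positivity) hdir hb
  -- The first entry of the minimum already contains 3/4 of `D ^ 2`. In the second, the constants
  -- give 81/1024, rounded down to 3/40 so that the rate becomes 1/20.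
  refine himp.trans (sub_le_sub_left (le_min ?_ ?_) _)
  · have h2 : 3 / (40 * κ * μ ^ 4) ≤ 3 / 4 := by
      have : 1 ≤ κ * μ ^ 4 := one_le_mul_of_one_le_of_one_le hκ1 (one_le_pow₀ hμ1)
      exact div_le_div_of_nonneg_left (by norm_num) (by norm_num) (by nlinarith)
    nlinarith [mul_le_mul_of_nonneg_right h2 (sq_nonneg D)]
  · rw [le_div_iff₀ (by positivity)]
    have h2 : (3 / 4 * a) ^ 2 ≤ (3 / 4 * a + 3 / 4 * D ^ 2) ^ 2 :=
      pow_le_pow_left₀ (by positivity) (by nlinarith [sq_nonneg D]) 2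
    refine le_trans ?_ h2
    have h3 : 3 / (40 * κ * μ ^ 4) * D ^ 2 * (4 * n * μ * (√d * L₀) ^ 2) =
        (9 / 16 * n * D ^ 2) * (√d * L₀) ^ 2 * (8 / 15) / (κ * μ ^ 3) := by
      field_simp; ring
    have h4 : (3 / 4 * a) ^ 2 = 9 / 16 * (√d * L₀) ^ 2 * ψ ^ 2 := by rw [haψ]; ring
    rw [h3, h4, div_le_iff₀ (by positivity)]
    have h5 := mul_le_mul_of_nonneg_right hψD (sq_nonneg (√d * L₀))
    have h6 : 0 ≤ κ * μ ^ 3 * ψ ^ 2 * (√d * L₀) ^ 2 := by positivity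
    linarith

/-- The error bound for the second stage: linear convergence until the error is of the order of
the noise and the bias. -/
theorem IsRGA.fro_err_sq_le (h : R.IsRGA X (response X B E) J (√d * L₀))
    (hreg : Regular X B J r μ L₀ δ) (hκ : 0 < kappa q d J r) {M m : ℕ} (hm : M ≤ m) :
    fro (R.err X B m) ^ 2 ≤
      52 * (√(kappa q d J r * (μ * noiseSize X E) ^ 2 * μ ^ 3 / n) +
        fro (fitted X B - fitted X fun j => R.lift X j (R.target X B j))) ^ 2 +
      3 * Real.exp (-(M / (20 * kappa q d J r * μ ^ 4))) * (n * d * μ * L₀ ^ 2) := by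
  have hμ1 := hreg.one_le
  have hμ : 0 < μ := by linarith
  have hn : (0 : ℝ) < n := by exact_mod_cast hreg.n_pos
  have hL := hreg.radius_pos
  have hκ0 : (0 : ℝ) < kappa q d J r := by exact_mod_cast hκ
  have hpath := h.greedyPath
  set b := fitted X B - fitted X fun j => R.lift X j (R.target X B j) with hb
  set ν := √(kappa q d J r * (μ * noiseSize X E) ^ 2 * μ ^ 3 / n) + fro b with hν
  have hν0 : 0 ≤ ν := add_nonneg (Real.sqrt_nonneg _) (fro_nonneg _)
  have hres : ∀ k, response X B E - R.fit X k = R.err X B k + (E + b) := fun k => by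
    rw [hb, err, response]; abel
  have he : ∀ k, |inn (E + b) (R.err X B k)| ≤ ν * fro (R.err X B k) := fun k => by
    rw [inn_add_left, hν, add_mul]
    exact (abs_add_le _ _).trans (add_le_add (h.abs_inn_noise_err_le hreg k) (abs_inn_le _ _))
  -- The bias is treated as additional noise: the excess of the squared residual over ‖E + b‖² is D²
  -- plus a linear term of size at most 2νD.
  have hf : ∀ k, fro (response X B E - R.fit X k) ^ 2 - fro (E + b) ^ 2 =
      fro (R.err X B k) ^ 2 + 2 * inn (E + b) (R.err X B k) := fun k => by
    rw [hres, fro_sq_add, inn_comm]; ring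
  have hmain := error_sq_le_of_contraction (D := fun k => fro (R.err X B k))
    (f := fun k => fro (response X B E - R.fit X k) ^ 2 - fro (E + b) ^ 2)
    (c := 3 / (40 * kappa q d J r * μ ^ 4)) (fun k => fro_nonneg _) hν0 (by positivity) hf he
    (fun i j hij => sub_le_sub_right (hpath.residual_sq_antitone hij) _)
    (fun k hk => by
      -- For D ≥ 4ν the correlation is at least D² - νD ≥ (3/4)D², as the step lemma requires.
      have h1 := h.residual_step hreg hκ k (by
        rw [hres, inn_add_left, inn_self]
        have h2 := (abs_le.1 (he k)).1
        have h3 := mul_le_mul_of_nonneg_right hk (fro_nonneg (R.err X B k))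
        nlinarith)
      linarith) hm
  refine hmain.trans (add_le_add le_rfl ?_)
  have h0 : R.err X B 0 = fitted X fun j => R.lift X j (R.target X B j) := by
    rw [err, hpath.zero, sub_zero]
  have hD0 : fro (R.err X B 0) ^ 2 ≤ n * d * μ * L₀ ^ 2 := by
    rw [h0]
    refine (pow_le_pow_left₀ (fro_nonneg _) (h.fro_target_le hreg) 2).trans_eq ?_
    rw [mul_pow, mul_pow, Real.sq_sqrt (by positivity), Real.sq_sqrt (by positivity)]; ring
  have hexp : 2 * (3 / (40 * kappa q d J r * μ ^ 4)) / 3 * (M : ℝ) =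
      M / (20 * kappa q d J r * μ ^ 4) := by
    field_simp; ring
  rw [hexp]
  exact mul_le_mul_of_nonneg_left hD0 (by positivity)

open Classical in
/-- The estimation error of the second stage after sufficiently many steps. -/
theorem IsRGA.sum_frobSq_le (h : R.IsRGA X (response X B E) J (√d * L₀))
    (hreg : Regular X B J r μ L₀ δ) {ξ A τ : ℝ} (hξ : 0 < ξ)
    (hnoise : noiseSize X E ≤ A * ξ) (hτ : 0 < τ) (hτ1 : τ < 1)
    (hlog : 0 ≤ Real.log ((n : ℝ) ^ 2 * d / ξ ^ 2)) {m : ℕ}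
    (hm : ⌈64 * μ ^ 5 / τ ^ 2 * kappa q d J r * Real.log ((n : ℝ) ^ 2 * d / ξ ^ 2)⌉₊ ≤ m) :
    (d : ℝ)⁻¹ * ∑ j, frobSq (B j - R.coef X m j) ≤
      (208 * μ ^ 6 * A ^ 2 + 6 * μ ^ 2 * L₀ ^ 2) *
          (kappa q d J r * ξ ^ 2 / ((n : ℝ) ^ 2 * d)) +
        210 * μ ^ 2 * L₀ ^ 2 * A ^ 2 * (ξ ^ 2 / ((n : ℝ) ^ 2 * δ ^ 2) *
          (if (largeRelevant X B).Nonempty then 1 else 0)) := by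
  have hμ1 := hreg.one_le
  have hμ : 0 < μ := by linarith
  have hn : (0 : ℝ) < n := by exact_mod_cast hreg.n_pos
  have hd : (0 : ℝ) < d := by exact_mod_cast hreg.d_pos
  have hL := hreg.radius_pos
  have hδ := hreg.delta_pos
  have hN0 := noiseSize_nonneg X E
  set ind : ℝ := if (largeRelevant X B).Nonempty then 1 else 0 with hind
  have hind2 : ind ^ 2 = ind := by rw [hind]; split_ifs <;> norm_num
  have hind0 : 0 ≤ ind := by rw [hind]; split_ifs <;> norm_num
  set κ : ℝ := (kappa q d J r : ℝ) with hκdef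
  have hκ0 : 0 ≤ κ := Nat.cast_nonneg _
  set b := fitted X B - fitted X fun j => R.lift X j (R.target X B j) with hb
  have hnoise2 : noiseSize X E ^ 2 ≤ A ^ 2 * ξ ^ 2 := by
    rw [← mul_pow]; exact pow_le_pow_left₀ hN0 hnoise 2
  have hbsq : fro b ^ 2 ≤ n * d * (μ * L₀ ^ 2 * A ^ 2 * (ξ ^ 2 / ((n : ℝ) ^ 2 * δ ^ 2) * ind)) := by
    refine (pow_le_pow_left₀ (fro_nonneg _) (h.fro_bias_le hreg) 2).trans ?_
    rw [← hind, mul_pow, mul_pow, mul_pow, mul_pow, Real.sq_sqrt (by positivity),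
      Real.sq_sqrt (by positivity), hind2, div_pow]
    calc (n : ℝ) * μ * (d * L₀ ^ 2) * (noiseSize X E ^ 2 / (n * δ) ^ 2) * ind
        ≤ n * μ * (d * L₀ ^ 2) * (A ^ 2 * ξ ^ 2 / (n * δ) ^ 2) * ind := by gcongr
      _ = _ := by rw [mul_pow]; ring
  have hDsq : fro (R.err X B m) ^ 2 ≤ 104 * (κ * μ ^ 5 * A ^ 2 * ξ ^ 2 / n) + 104 * fro b ^ 2 +
      3 * (κ * ξ ^ 2 / ((n : ℝ) ^ 2 * d)) * (n * d * μ * L₀ ^ 2) := by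
    -- For κ = 0 the error vanishes. Otherwise κ ≥ 1, which allows the geometric term to be absorbed
    -- in the variance term.
    rcases Nat.eq_zero_or_pos (kappa q d J r) with hz | hpos
    · rw [h.err_eq_zero hreg hz, fro_zero, zero_pow two_ne_zero]
      have := fro_nonneg b
      positivity
    · have hκ1 : 1 ≤ κ := by rw [hκdef]; exact_mod_cast hpos
      refine (h.fro_err_sq_le hreg hpos hm).trans ?_
      rw [← hb, ← hκdef]
      have hsq : √(κ * (μ * noiseSize X E) ^ 2 * μ ^ 3 / n) ^ 2 ≤
          κ * μ ^ 5 * A ^ 2 * ξ ^ 2 / n := by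
        rw [Real.sq_sqrt (by positivity)]
        refine div_le_div_of_nonneg_right ?_ hn.le
        calc κ * (μ * noiseSize X E) ^ 2 * μ ^ 3 = κ * μ ^ 5 * noiseSize X E ^ 2 := by ring
          _ ≤ κ * μ ^ 5 * (A ^ 2 * ξ ^ 2) := mul_le_mul_of_nonneg_left hnoise2 (by positivity)
          _ = _ := by ring
      have hexp : Real.exp (-((⌈64 * μ ^ 5 / τ ^ 2 * κ *
          Real.log ((n : ℝ) ^ 2 * d / ξ ^ 2)⌉₊ : ℝ) / (20 * κ * μ ^ 4))) ≤
          κ * ξ ^ 2 / ((n : ℝ) ^ 2 * d) := by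
        set ℓ := Real.log ((n : ℝ) ^ 2 * d / ξ ^ 2) with hℓ
        -- About 20κμ⁴ℓ steps suffice to reach exp(-ℓ); the prescribed number is larger because μ/τ²
        -- ≥ 1.
        have h1 : ℓ ≤ (⌈64 * μ ^ 5 / τ ^ 2 * κ * ℓ⌉₊ : ℝ) / (20 * κ * μ ^ 4) := by
          rw [le_div_iff₀ (by positivity)]
          refine le_trans ?_ (Nat.le_ceil _)
          have h2 : 1 ≤ μ / τ ^ 2 := by
            rw [le_div_iff₀ (by positivity)]
            nlinarith
          have h3 : 64 * μ ^ 5 / τ ^ 2 * κ * ℓ = 64 * (κ * μ ^ 4 * ℓ) * (μ / τ ^ 2) := by ring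
          rw [h3]
          have h4 : 0 ≤ κ * μ ^ 4 * ℓ := by positivity
          nlinarith
        have h5 : Real.exp (-ℓ) = ξ ^ 2 / ((n : ℝ) ^ 2 * d) := by
          rw [hℓ, Real.exp_neg, Real.exp_log (by positivity), inv_div]
        calc _ ≤ Real.exp (-ℓ) := Real.exp_le_exp.2 (by linarith)
          _ = 1 * (ξ ^ 2 / ((n : ℝ) ^ 2 * d)) := by rw [h5, one_mul]
          _ ≤ κ * (ξ ^ 2 / ((n : ℝ) ^ 2 * d)) :=
            mul_le_mul_of_nonneg_right hκ1 (by positivity)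
          _ = _ := by ring
      have h6 := mul_le_mul_of_nonneg_right hexp (show 0 ≤ n * d * μ * L₀ ^ 2 by positivity)
      nlinarith [sq_nonneg (√(κ * (μ * noiseSize X E) ^ 2 * μ ^ 3 / n) - fro b)]
  have hsum : n * μ⁻¹ * ∑ j, fro (B j - R.coef X m j) ^ 2 ≤
      2 * fro (R.err X B m) ^ 2 + 2 * fro b ^ 2 := by
    obtain ⟨S, hS, hS0⟩ := h.exists_coef_eq_lift m
    have h1 := le_fro_fitted_sq hreg.n_pos hreg.convex (C := B - R.coef X m) (fun j hj => by
      rw [Pi.sub_apply, (R.target_eq_zero hreg hj).1, hS, hS0 j hj, lift_zero, sub_zero])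
    have h2 : fitted X (B - R.coef X m) = R.err X B m + b := by
      rw [fitted_sub, hb, err, fit]; abel
    rw [h2] at h1
    have h3 := pow_le_pow_left₀ (fro_nonneg _) (fro_add_le (R.err X B m) b) 2
    refine h1.trans (h3.trans ?_)
    nlinarith [sq_nonneg (fro (R.err X B m) - fro b)]
  simp only [frobSq_eq]
  have hfin : ∑ j, fro (B j - R.coef X m j) ^ 2 ≤
      μ / n * (2 * fro (R.err X B m) ^ 2 + 2 * fro b ^ 2) := by
    rw [div_mul_eq_mul_div, le_div_iff₀ hn]
    have := mul_le_mul_of_nonneg_left hsum hμ.le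
    calc _ = μ * (n * μ⁻¹ * ∑ j, fro (B j - R.coef X m j) ^ 2) := by field_simp
      _ ≤ _ := this
  calc (d : ℝ)⁻¹ * ∑ j, fro (B j - R.coef X m j) ^ 2
      ≤ (d : ℝ)⁻¹ * (μ / n * (208 * (κ * μ ^ 5 * A ^ 2 * ξ ^ 2 / n) +
          6 * (κ * ξ ^ 2 / ((n : ℝ) ^ 2 * d)) * (n * d * μ * L₀ ^ 2) +
          210 * (n * d * (μ * L₀ ^ 2 * A ^ 2 * (ξ ^ 2 / ((n : ℝ) ^ 2 * δ ^ 2) * ind))))) := by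
        refine mul_le_mul_of_nonneg_left (hfin.trans (mul_le_mul_of_nonneg_left ?_ (by positivity)))
          (by positivity)
        linarith
    _ = _ := by field_simp

end SecondStage

/-! ### Events of probability tending to one -/

section Probability

variable {Ω : Type*} [MeasurableSpace Ω] {P : Measure Ω}

theorem WPTO.mono {A A' : ℕ → Ω → Prop} (h : WPTO P A)
    (hAA' : ∀ᶠ n in atTop, ∀ ω, A n ω → A' n ω) : WPTO P A' := by
  refine tendsto_of_tendsto_of_tendsto_of_le_of_le' tendsto_const_nhds h
    (Eventually.of_forall fun _ => zero_le) ?_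
  filter_upwards [hAA'] with n hn
  exact measure_mono fun ω hω hA => hω (hn ω hA)

theorem WPTO.and {A A' : ℕ → Ω → Prop} (h : WPTO P A) (h' : WPTO P A') :
    WPTO P fun n ω => A n ω ∧ A' n ω := by
  have hsum := h.add h'
  rw [add_zero] at hsum
  refine tendsto_of_tendsto_of_tendsto_of_le_of_le tendsto_const_nhds hsum
    (fun _ => zero_le) fun n => ?_
  refine (measure_mono fun ω hω => ?_).trans (measure_union_le _ _)
  by_cases hA : A n ω
  · exact Or.inr fun hA' => hω ⟨hA, hA'⟩
  · exact Or.inl hA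

theorem IsBigOp.exists_nonneg {x : ℕ → Ω → ℝ} {y : ℕ → ℝ} (hy : ∀ n, 0 ≤ y n)
    (h : IsBigOp P (fun n ω => (x n ω : EReal)) fun n _ => y n) {ε : ℝ} (hε : 0 < ε) :
    ∃ M : ℝ, 0 ≤ M ∧
      limsup (fun n => P {ω | ¬ x n ω ≤ M * y n}) atTop < ENNReal.ofReal ε := by
  obtain ⟨M, hM⟩ := h ε hε
  refine ⟨max M 0, le_max_right _ _, lt_of_le_of_lt (limsup_le_limsup ?_) hM⟩
  refine Eventually.of_forall fun n => measure_mono fun ω hω => ?_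
  refine EReal.coe_lt_coe_iff.2 (lt_of_le_of_lt ?_ (not_le.1 hω))
  exact mul_le_mul_of_nonneg_right (le_max_left _ _) (hy n)

/-- If `K_n ξ_n = O_p(n d_n^{1/2})` and `s_n² = o(K_n)` then `ξ_n = o_p(n d_n^{1/2} s_n⁻²)`. -/
theorem wpto_noise_small {x : ℕ → Ω → ℝ} {d K : ℕ → ℕ} {s : ℕ → ℝ} {L₀ η : ℝ} (hL₀ : 0 < L₀)
    (hη : 0 < η) (hx : ∀ n ω, 0 ≤ x n ω) (hs : ∀ n, 0 < s n)
    (hsK : (fun n => s n ^ 2) =o[atTop] fun n => (K n : ℝ))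
    (h : IsBigOp P (fun n ω => ((K n * x n ω : ℝ) : EReal)) fun n _ => n * √(d n)) :
    WPTO P fun n ω => 2 * x n ω * (√(d n) * L₀) ≤ η * (n * d n) * (s n ^ 2)⁻¹ := by
  refine ENNReal.tendsto_nhds_zero.2 fun ε hε => ?_
  obtain ⟨e, he, heε⟩ : ∃ e : ℝ, 0 < e ∧ ENNReal.ofReal e ≤ ε := by
    rcases eq_or_ne ε ⊤ with rfl | htop
    · exact ⟨1, one_pos, le_top⟩
    · exact ⟨ε.toReal, ENNReal.toReal_pos hε.ne' htop, ENNReal.ofReal_toReal_le⟩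
  obtain ⟨M, hM0, hM⟩ := h.exists_nonneg (fun n => by positivity) he
  -- The little-o constant is chosen to offset the big-O constant `M`; `M + 1` keeps the denominator
  -- positive.
  have hc : 0 < η / (2 * L₀ * (M + 1)) := by positivity
  filter_upwards [eventually_lt_of_limsup_lt hM, hsK.bound hc] with n hn hsn
  refine (measure_mono fun ω hω => ?_).trans (hn.le.trans heε)
  refine fun hle => hω ?_
  rw [Real.norm_of_nonneg (sq_nonneg _), Real.norm_of_nonneg (Nat.cast_nonneg _)] at hsn
  have hs2 : 0 < s n ^ 2 := pow_pos (hs n) 2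
  rw [← div_eq_mul_inv, le_div_iff₀ hs2]
  have hdd : √(d n : ℝ) * √(d n) = d n := Real.mul_self_sqrt (Nat.cast_nonneg _)
  have hx0 := hx n ω
  calc 2 * x n ω * (√(d n) * L₀) * s n ^ 2
      ≤ 2 * x n ω * (√(d n) * L₀) * (η / (2 * L₀ * (M + 1)) * K n) :=
        mul_le_mul_of_nonneg_left hsn (by positivity)
    _ = (√(d n) * η / (M + 1)) * (K n * x n ω) := by field_simp
    _ ≤ (√(d n) * η / (M + 1)) * (M * (n * √(d n))) :=
        mul_le_mul_of_nonneg_left hle (by positivity)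
    _ = η * (n * (√(d n) * √(d n))) * (M / (M + 1)) := by ring
    _ ≤ η * (n * (√(d n) * √(d n))) * 1 :=
        mul_le_mul_of_nonneg_left ((div_le_one (by positivity)).2 (by linarith)) (by positivity)
    _ = η * (n * d n) := by rw [hdd, mul_one]

/-- Transfer of a stochastic order along an event of probability tending to one. -/
theorem isBigOp_of_wpto {x : ℕ → Ω → EReal} {y : ℕ → Ω → ℝ} {z : ℕ → Ω → ℝ} {w : ℕ → ℝ}
    (hw : ∀ n, 0 ≤ w n) (hz : IsBigOp P (fun n ω => (z n ω : EReal)) fun n _ => w n)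
    {G : ℕ → Ω → Prop} (hG : WPTO P G)
    (h : ∀ M : ℝ, 0 ≤ M → ∃ M' : ℝ, ∀ᶠ n in atTop, ∀ ω, G n ω → z n ω ≤ M * w n →
      x n ω ≤ ((M' * y n ω : ℝ) : EReal)) :
    IsBigOp P x y := by
  intro ε hε
  obtain ⟨M, hM0, hM⟩ := hz.exists_nonneg hw hε
  obtain ⟨M', hM'⟩ := h M hM0
  refine ⟨M', ?_⟩
  -- Two intermediate levels: the noise event has probability below `a`, the exceptional event gets
  -- `b - a`, and `b` is still strictly below ε.
  obtain ⟨a, hMa, haε⟩ := exists_between hM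
  obtain ⟨b, hab, hbε⟩ := exists_between haε
  have hpos : 0 < b - a := tsub_pos_of_lt hab
  refine lt_of_le_of_lt (limsup_le_of_le (by isBoundedDefault) ?_) hbε
  filter_upwards [hM', eventually_lt_of_limsup_lt hMa,
    ENNReal.tendsto_nhds_zero.1 hG _ hpos] with n h1 h2 h3
  calc P {ω | ((M' * y n ω : ℝ) : EReal) < x n ω}
      ≤ P ({ω | ¬ z n ω ≤ M * w n} ∪ {ω | ¬ G n ω}) := by
        refine measure_mono fun ω hω => ?_
        by_cases hz' : z n ω ≤ M * w n
        · exact Or.inr fun hg => absurd (h1 ω hg hz') (not_le.2 hω)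
        · exact Or.inl hz'
    _ ≤ P {ω | ¬ z n ω ≤ M * w n} + P {ω | ¬ G n ω} := measure_union_le _ _
    _ ≤ a + (b - a) := add_le_add h2.le h3
    _ = b := add_tsub_cancel_of_le hab.le

end Probability

/-- After sure screening the data are regular for the second stage. -/
theorem regular_of_screening {n p d : ℕ} {q : Fin p → ℕ} {X : ∀ j, Matrix (Fin n) (Fin (q j)) ℝ}
    {B : ∀ j, Matrix (Fin (q j)) (Fin d) ℝ} {R : FirstStage q d} {k K : ℕ} {μ L₀ δ : ℝ}
    (hn : 0 < n) (hd : 0 < d) (hμ : 1 ≤ μ) (hL₀ : 0 < L₀) (hδ : 0 < δ)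
    (hX : ∀ j, GramBound (X j) μ)
    (hJ : ∀ J : Finset (Fin p), J.card ≤ 2 * K →
      ∀ i, μ⁻¹ < (gram_isHermitian (stack X J)).eigenvalues i)
    (hkK : k ≤ K) (hB : ∑ j, nuc (B j) ≤ √d * L₀ / (4 * μ ^ 2))
    (hscreen : ∀ j ∈ relevant B, (B j).rank ≤ (R.coef k j).rank)
    (hsv : ∀ j ∈ largeRelevant X B,
      n * δ ≤ sv ((X j)ᵀ * fitted X B) (marginalRank X B j - 1))
    (hrev : ∀ j ∈ largeRelevant X B,
      ∀ (U : Matrix (Fin (q j)) (Fin (marginalRank X B j)) ℝ)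
        (V : Matrix (Fin d) (Fin (marginalRank X B j)) ℝ),
        IsLeadingSVD ((X j)ᵀ * fitted X B) U V →
          ∃ Q : Matrix (Fin (marginalRank X B j)) (Fin (marginalRank X B j)) ℝ,
            gram (X j) * B j = U * Q * Vᵀ) :
    Regular X B (R.selected k) (R.totalRank k) μ L₀ δ := by
  have hmem : ∀ j ∈ relevant B, j ∈ R.selected k := fun j hj => by
    by_contra hnot
    have h1 := hscreen j hj
    rw [R.coef_eq_zero_of_notMem_selected hnot, Matrix.rank_zero] at h1
    exact absurd (rank_pos_of_ne_zero hj) (not_lt.2 h1)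
  refine ⟨hn, hd, hμ, hL₀, hδ, hX, hJ _ ((R.card_selected_le k).trans (by omega)), hmem,
    fun j _ => (marginalRank_le_sum X B j).trans ?_, hB, hsv, hrev⟩
  -- Unselected predictors have zero true coefficients, so the sum of the true ranks runs over the
  -- selected set, where screening compares it term by term.
  rw [FirstStage.totalRank, ← Finset.sum_subset (Finset.subset_univ (R.selected k))]
  · refine Finset.sum_le_sum fun i _ => ?_
    by_cases hi : B i = 0
    · rw [hi, Matrix.rank_zero]; exact Nat.zero_le _
    · exact hscreen i hi
  · intro i _ hi
    have : B i = 0 := by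
      by_contra h; exact hi (hmem i h)
    rw [this, Matrix.rank_zero]

end TSRGA

end

/-! ### Assembly of the theorem -/

open TSRGA Classical in
theorem theorem2 (μ L₀ Mo : ℝ) (hμ : 0 < μ) (hL₀ : 0 < L₀) (hMo : 0 < Mo) :
    -- the threshold constant `C` has to be small, depending only on `μ`, `L₀` and `Mo`
    ∃ C₀ : ℝ, 0 < C₀ ∧ ∀ C : ℝ, 0 < C → C ≤ C₀ →
    ∀ (Ω : Type*) [MeasurableSpace Ω] (P : Measure Ω) [IsProbabilityMeasure P]
      -- dimensions, data and true coefficients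
      (p d : ℕ → ℕ) (q : ∀ n, Fin (p n) → ℕ)
      (X : ∀ n, Ω → ∀ j, Matrix (Fin n) (Fin (q n j)) ℝ)
      (E : ∀ n, Ω → Matrix (Fin n) (Fin (d n)) ℝ)
      (B : ∀ n j, Matrix (Fin (q n j)) (Fin (d n)) ℝ)
      (K : ℕ → ℕ) (s δ ξ : ℕ → ℝ) (L εL τ : ℝ),
      (∀ n, 0 < p n) → (∀ n, 0 < d n) → (∀ n j, 0 < q n j) → (∀ n, 0 < K n) →
      -- the choice of the nuclear norm bound `d_n^{1/2} L₀`
      εL < 1 → 1 - εL ≤ μ⁻¹ ^ 2 / 4 → L / (1 - εL) ≤ L₀ →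
      CondC1 P X μ → CondC2 P X E K → CondC3 P X K μ → CondC4 B K s L →
      NoiseLevel P E Mo →
      CondC5 P X B E δ → CondC6 P X B →
      (∀ n, 0 < ξ n) →
      IsBigOp P (fun n ω => (noiseSize (X n ω) (E n ω) : EReal)) (fun n _ => ξ n) →
      -- `n² d_n / ξ_n²` stays above some constant larger than one
      (∃ c : ℝ, c < 1 ∧ ∀ᶠ n : ℕ in atTop, ξ n ≤ c * (n * √(d n))) →
      0 < τ → τ < 1 →
      -- an arbitrary run of the first stage, stopped at `kH n ω`
      ∀ (R₁ : ∀ n, Ω → FirstStage (q n) (d n)),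
      (∀ n ω, (R₁ n ω).IsRGA (X n ω) (response (X n ω) (B n) (E n ω)) (√(d n) * L₀)) →
      ∀ kH : ℕ → Ω → ℕ,
      (∀ n ω, kH n ω = (R₁ n ω).kHat (X n ω) (response (X n ω) (B n) (E n ω)) (K n)
        (C * (s n ^ 2)⁻¹)) →
      -- an arbitrary run of the second stage
      ∀ (R₂ : ∀ n ω, SecondStage (q n) (d n) ((R₁ n ω).totalRank (kH n ω))),
      (∀ n ω, (R₂ n ω).IsRGA (X n ω) (response (X n ω) (B n) (E n ω))
        ((R₁ n ω).selected (kH n ω)) (√(d n) * L₀)) →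
      ∀ κ : ℕ → Ω → ℕ,
      (∀ n ω, κ n ω = kappa (q n) (d n) ((R₁ n ω).selected (kH n ω))
        ((R₁ n ω).totalRank (kH n ω))) →
      ∀ mₙ : ℕ → Ω → ℕ,
      (∀ n ω, mₙ n ω =
        ⌈64 * μ ^ 5 / τ ^ 2 * κ n ω * Real.log ((n : ℝ) ^ 2 * d n / ξ n ^ 2)⌉₊) →
      IsBigOp P
        (fun n ω => ⨆ m ≥ mₙ n ω,
          (((d n : ℝ)⁻¹ * ∑ j, frobSq (B n j - (R₂ n ω).coef (X n ω) m j) : ℝ) : EReal))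
        (fun n ω =>
          κ n ω * ξ n ^ 2 / ((n : ℝ) ^ 2 * d n) * Real.log ((n : ℝ) ^ 2 * d n / ξ n ^ 2)
          + ξ n ^ 2 / ((n : ℝ) ^ 2 * δ n ^ 2)
            * (if (largeRelevant (X n ω) (B n)).Nonempty then 1 else 0)) := by
  -- The reciprocal of the constant in screening: a missed rank forces a decrease of the squared
  -- residual that any smaller `C` would not have let stop.
  refine ⟨(64 * μ ^ 3 * L₀ ^ 2 * (Mo + μ * L₀ ^ 2))⁻¹, by positivity, ?_⟩
  intro C hC hC₀ Ω _ P _ p d q X E B K s δ ξ L εL τ hp hd hq hK hε hεμ hL hC1 hC2 hC3 hC4 hnoise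
    hC5 hC6 hξ hξE hξc hτ hτ1 R₁ hR₁ kH hkH R₂ hR₂ κ hκ mₙ hmₙ
  obtain ⟨hnuc, hs, -, hsK, hsv⟩ := hC4
  obtain ⟨hδ, -, hC5⟩ := hC5
  obtain ⟨c₀, hc₀, hξc⟩ := hξc
  have hC₀' : C * (64 * μ ^ 3 * L₀ ^ 2 * (Mo + μ * L₀ ^ 2)) ≤ 1 := by
    rwa [← one_div, le_div_iff₀ (by positivity)] at hC₀
  -- the total nuclear norm of the true coefficients
  have hBn : ∀ n, ∑ j, nuc (B n j) ≤ √(d n) * L₀ / (4 * μ ^ 2) := fun n => by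
    have hd' : (0 : ℝ) < √(d n) := by have := hd n; positivity
    have h1 := hnuc n
    rw [inv_mul_le_iff₀ hd'] at h1
    rw [div_le_iff₀ (by linarith)] at hL
    have h2 : L₀ * (1 - εL) ≤ L₀ * (μ⁻¹ ^ 2 / 4) := mul_le_mul_of_nonneg_left hεμ hL₀.le
    calc _ ≤ √(d n) * L := h1
      _ ≤ √(d n) * (L₀ * (μ⁻¹ ^ 2 / 4)) := mul_le_mul_of_nonneg_left (hL.trans h2) hd'.le
      _ = _ := by field_simp
  obtain ⟨η, hη, hη₁, hη₂⟩ : ∃ η : ℝ, 0 < η ∧ 10 * μ * L₀ ^ 2 * η ≤ 1 ∧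
      4 * Mo * L₀ ^ 4 * η ≤ 1 := by
    refine ⟨min (10 * μ * L₀ ^ 2)⁻¹ (4 * Mo * L₀ ^ 4)⁻¹, by positivity, ?_, ?_⟩
    · exact (mul_le_mul_of_nonneg_left (min_le_left _ _) (by positivity)).trans_eq
        (mul_inv_cancel₀ (by positivity))
    · exact (mul_le_mul_of_nonneg_left (min_le_right _ _) (by positivity)).trans_eq
        (mul_inv_cancel₀ (by positivity))
  have hsmall := wpto_noise_small (P := P) hL₀ hη
    (fun n ω => noiseSize_nonneg (X n ω) (E n ω)) hs hsK hC2.2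
  -- the good event
  have hgood : WPTO P fun n ω => Regular (X n ω) (B n) ((R₁ n ω).selected (kH n ω))
      ((R₁ n ω).totalRank (kH n ω)) μ L₀ (δ n) := by
    refine ((hC1.and hC3).and ((hnoise.and hsmall).and (hC5.and hC6))).mono ?_
    have hc₁ : 0 < (L₀ ^ 4)⁻¹ := by positivity
    have hc₂ : 0 < C / (8 * Mo * (Mo + μ * L₀ ^ 2)) := by positivity
    filter_upwards [eventually_gt_atTop 0, hsK.bound hc₁, hsK.bound hc₂] with n hn hsn₁ hsn₂ ω
    rintro ⟨⟨h1, h3⟩, ⟨⟨hE₁, hE₂⟩, hsm⟩, h5, h6⟩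
    rw [Real.norm_of_nonneg (sq_nonneg _), Real.norm_of_nonneg (Nat.cast_nonneg _)] at hsn₁ hsn₂
    have hX : ∀ j, GramBound (X n ω j) μ := fun j => gramBound_of_eigenvalues (h1 j)
    have hμ1 : 1 ≤ μ := (hX ⟨0, hp n⟩).one_le hμ (hq n _)
    have hn' : (0 : ℝ) < n := by exact_mod_cast hn
    have hd' : (0 : ℝ) < d n := by exact_mod_cast hd n
    rw [frobSq_eq] at hE₁ hE₂
    have hBn' : ∑ j, nuc (B n j) ≤ √(d n) * L₀ :=
      (hBn n).trans (div_le_self (by positivity) (by nlinarith))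
    refine regular_of_screening hn (hd n) hμ1 hL₀ (hδ n) hX h3
      (hkH n ω ▸ (R₁ n ω).kHat_le (K n) _) (hBn n) ?_ h5 h6
    rw [hkH n ω]
    refine rank_le_rank_coef_kHat hn (hd n) hμ1 hL₀ hMo hC hC₀' (hs n) hX h3 ?_ ?_ hBn' (hsv n)
      ?_ ?_ hη.le hη₁ hη₂ hsm (hR₁ n ω)
    · rwa [← div_eq_inv_mul, le_div_iff₀ (by positivity)] at hE₁
    · rwa [inv_mul_le_iff₀ (by positivity), mul_comm] at hE₂
    · rwa [← div_eq_inv_mul, le_div_iff₀ (by positivity), mul_comm] at hsn₁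
    · rwa [div_mul_eq_mul_div, le_div_iff₀ (by positivity), mul_comm] at hsn₂
  refine isBigOp_of_wpto (fun n => (hξ n).le) hξE hgood fun A hA => ?_
  -- Raising the constant to at least 1/2 makes it positive, so that log(c⁻²) is a genuine positive
  -- lower bound for the logarithm in the rate.
  set c := max c₀ (1 / 2) with hc
  have hc0 : 0 < c := lt_of_lt_of_le (by norm_num) (le_max_right _ _)
  have hc1 : c < 1 := max_lt hc₀ (by norm_num)
  set ℓ := Real.log ((c ^ 2)⁻¹) with hℓ
  have hℓ0 : 0 < ℓ := Real.log_pos (one_lt_inv₀ (by positivity) |>.2 (by nlinarith))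
  set A₁ := 208 * μ ^ 6 * A ^ 2 + 6 * μ ^ 2 * L₀ ^ 2 with hA₁
  set A₂ := 210 * μ ^ 2 * L₀ ^ 2 * A ^ 2 with hA₂
  -- The deterministic bound has no logarithm in its variance term; it is inserted at the cost of
  -- dividing by its lower bound ℓ.
  refine ⟨A₁ / ℓ + A₂, ?_⟩
  filter_upwards [eventually_gt_atTop 0, hξc] with n hn hξn ω hreg hξω
  have hn' : (0 : ℝ) < n := by exact_mod_cast hn
  have hd' : (0 : ℝ) < d n := by exact_mod_cast hd n
  have hξ0 := hξ n
  have hlog : ℓ ≤ Real.log ((n : ℝ) ^ 2 * d n / ξ n ^ 2) := by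
    refine Real.log_le_log (by positivity) ?_
    rw [le_div_iff₀ (by positivity), inv_mul_le_iff₀ (by positivity)]
    have h1 : ξ n ≤ c * (n * √(d n)) :=
      hξn.trans (mul_le_mul_of_nonneg_right (le_max_left _ _) (by positivity))
    refine (pow_le_pow_left₀ hξ0.le h1 2).trans_eq ?_
    rw [mul_pow, mul_pow, Real.sq_sqrt hd'.le]
  refine iSup₂_le fun m hm => EReal.coe_le_coe_iff.2 ?_
  have hm' : mₙ n ω ≤ m := hm
  rw [hmₙ n ω, hκ n ω] at hm'
  refine ((hR₂ n ω).sum_frobSq_le hreg hξ0 hξω hτ hτ1 (hℓ0.le.trans hlog) hm').trans ?_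
  rw [← hκ n ω]
  set x := (κ n ω : ℝ) * ξ n ^ 2 / ((n : ℝ) ^ 2 * d n) with hx
  set y := ξ n ^ 2 / ((n : ℝ) ^ 2 * δ n ^ 2) *
    (if (largeRelevant (X n ω) (B n)).Nonempty then (1 : ℝ) else 0) with hy
  set lg := Real.log ((n : ℝ) ^ 2 * d n / ξ n ^ 2) with hlg
  have hx0 : 0 ≤ x := by positivity
  have hy0 : 0 ≤ y := mul_nonneg (by positivity) (by split_ifs <;> norm_num)
  have hA₁0 : 0 ≤ A₁ := by positivity
  have hA₂0 : 0 ≤ A₂ := by positivity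
  have hlg0 : 0 ≤ lg := hℓ0.le.trans hlog
  have h1 : A₁ * x ≤ A₁ / ℓ * (x * lg) := by
    calc A₁ * x = A₁ / ℓ * (x * ℓ) := by field_simp
      _ ≤ A₁ / ℓ * (x * lg) :=
        mul_le_mul_of_nonneg_left (mul_le_mul_of_nonneg_left hlog hx0) (by positivity)
  have h2 : 0 ≤ A₂ * (x * lg) := by positivity
  have h3 : 0 ≤ A₁ / ℓ * y := by positivity
  calc A₁ * x + A₂ * y ≤ A₁ / ℓ * (x * lg) + A₂ * (x * lg) + A₁ / ℓ * y + A₂ * y := by linarith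
    _ = (A₁ / ℓ + A₂) * (x * lg + y) := by ring
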